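/- Consider the surface growth equation $$u_t=-u_{xxxx}-\big((u_x)^2\big)_{xx}$$ for real functions that are $2\pi$-periodic in $x$ and satisfy $\int_0^{2\pi}u(t,x)\,\mathrm dx=0$. Let $H^1$ denote the space of $2\pi$-periodic functions of zero average with a weak derivative in $L^2(0,2\pi)$ (represented by their continuous versions), with norm $\|f\|_{H^1}:=\|f_x\|_{L^2(0,2\pi)}$. For an interval $I\subseteq[0,\infty)$ with $0\in I$, an $H^1$ solution on $I$ is a function $u\in C^0(I,H^1)$ such that, for every smooth $2\pi$-periodic $\phi$ and every $t\in I$, $$\int_0^{2\pi}u(t)\phi\,\mathrm dx-\int_0^{2\pi}u(0)\phi\,\mathrm dx=\int_0^t\int_0^{2\pi}\big(-u\,\phi_{xxxx}-(u_x)^2\phi_{xx}\big)\,\mathrm dx\,\mathrm ds .$$ **Theorem (Smallness Condition).** Let $u$ be an $H^1$ solution on $I$ and suppose that for some $t\in I$ $$\|u(t)\|_{H^1}<\tfrac12=:\varepsilon_0 .$$ Then $u$ is globally regular and unique: there is an $H^1$ solution $v$ on $[0,\infty)$ with $v=u$ on $I$, such that $v$ is $C^\infty$ in $(t,x)$ on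 $(0,\infty)\times\mathbb R$ and satisfies the equation pointwise there, and every $H^1$ solution $w$ on any interval $J$ (with $0\in J\subseteq[0,\infty)$) with $w(0)=u(0)$ satisfies $w=v$ on $J$. -/

import Mathlib

open Real Set Filter Topology MeasureTheory
open scoped ContDiff

/-- The space `H¹` of the equation: real `2π`-periodic functions of zero average which are
absolutely continuous on a period and whose derivative is square integrable over it. In one space
dimension these are exactly the continuous representatives of the periodic functions with weak
derivative in `L²`, and the weak derivative is the almost everywhere derivative `deriv f`. -/
structure MemH1 (f : ℝ → ℝ) : Prop where
  periodic : Function.Periodic f (2 * π)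
  absolutelyContinuous : AbsolutelyContinuousOnInterval f 0 (2 * π)
  memLp_deriv : MemLp (deriv f) 2 (volume.restrict (Ioc 0 (2 * π)))
  mean_zero : ∫ x in (0 : ℝ)..(2 * π), f x = 0

/-- The norm `‖f‖_{H¹} = ‖∂ₓ f‖_{L²(0, 2π)}` of a function `f` with `MemH1 f`. -/
noncomputable def h1Norm (f : ℝ → ℝ) : ℝ :=
  √(∫ x in (0 : ℝ)..(2 * π), (deriv f x) ^ 2)

/-- `u`, written `u t x`, is a solution in `C⁰(I, H¹)` of the surface growth equation
`u_t = - u_xxxx - (u_x²)_xx` with periodic boundary conditions and zero average, on the time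
interval `I`, which contains `0` and lies in `[0, ∞)`. The equation holds in the weak sense, integrated in time from the
initial value `u 0` and tested with all smooth `2π`-periodic functions of `x`. -/
structure IsH1Solution (I : Set ℝ) (u : ℝ → ℝ → ℝ) : Prop where
  zero_mem : (0 : ℝ) ∈ I
  subset_nonneg : I ⊆ Ici 0
  ordConnected : I.OrdConnected
  memH1 : ∀ t ∈ I, MemH1 (u t)
  continuous_h1 : ∀ t ∈ I, Tendsto (fun s => h1Norm (fun x => u s x - u t x)) (𝓝[I] t) (𝓝 0)
  weak_eq : ∀ φ : ℝ → ℝ, ContDiff ℝ ∞ φ → Function.Periodic φ (2 * π) → ∀ t ∈ I,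
    (∫ x in (0 : ℝ)..(2 * π), u t x * φ x) - (∫ x in (0 : ℝ)..(2 * π), u 0 x * φ x) =
      ∫ s in (0 : ℝ)..t, ∫ x in (0 : ℝ)..(2 * π),
        (-(u s x * iteratedDeriv 4 φ x) - (deriv (u s) x) ^ 2 * iteratedDeriv 2 φ x)

/-! Everything is carried out on the Fourier coefficients `a k` of the slope `u_x`, where the
equation reads `a k' = -k⁴ a k + i k³ (a ∗ a) k`. By Parseval the `H¹` norm is `√(2π)` times the
`ℓ²` norm of `a`.

The equation is subcritical in `ℓ²`. By Cauchy–Schwarz `a ∗ a` is bounded by `‖a‖²` uniformly in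
`k`, and Duhamel's formula turns the forcing `k³` against the damping `k⁴` into a factor `1/|k|`,
which is square summable. This single gain yields uniqueness (`SeqSol.unique`, by a norm weighted
with `e^{-λt}`), local existence on a time depending only on the size of the datum
(`SeqSol.exists_local`, by a contraction), and smoothing (`SeqSol.conv_decay`,
`SeqSol.coeff_decay`): each round through Duhamel and convolution gains a quarter power of `k`, so
at positive times the coefficients decay faster than any power.

Smallness enters through the energy. With `κ = √(∑_{k≠0} k⁻²) = √(π²/3)`, the cubic term satisfies
`∑ |k|³ |a k| |(a ∗ a) k| ≤ 2κ ‖a‖ ∑ k⁴ |a k|²` (`trilinear_le`). Hence the derivative of `‖a‖²` is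
at most `(-2 + 4κ‖a‖) ∑ k⁴ |a k|²`, which is negative when `2κ‖a‖ < 1` and `a ≠ 0`. A small norm
therefore stays small (`SeqSol.l2Norm_lt`), and local solutions of a fixed length can be glued
forever (`SeqSol.exists_global`). For the threshold `1/2` the condition becomes `√(π²/3) ≤ √(2π)`,
which holds with room to spare.

It remains to pass between functions and coefficients. Testing the weak equation with `cos kx` and
`sin kx` gives the coefficient equation (`IsH1Solution.seqSol`). Conversely a global coefficient
solution is summed to `u = ∑ a k / (ik) e^{ikx}`, which is an `H¹` solution
(`GlobalSol.isH1Solution`). Rapid decay permits termwise differentiation, and the equation trades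
time derivatives for space derivatives (`contDiffOn_of_evolution`). Uniqueness of coefficients
becomes uniqueness of solutions because a function of zero mean is determined by its slope. -/

/-! ### Square summable sequences and their convolution -/

/-- Square summability of a sequence indexed by the integers. -/
def SqSummable (a : ℤ → ℂ) : Prop := Summable fun k => ‖a k‖ ^ 2

/-- The `ℓ²` norm of a sequence. -/
noncomputable def l2Norm (a : ℤ → ℂ) : ℝ := √(∑' k, ‖a k‖ ^ 2)

/-- The convolution of two sequences. -/
noncomputable def seqConv (a b : ℤ → ℂ) (k : ℤ) : ℂ := ∑' m, a m * b (k - m)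

theorem summable_mul_of_sq {ι : Type*} {f g : ι → ℝ} (hf : Summable fun i => f i ^ 2)
    (hg : Summable fun i => g i ^ 2) : Summable fun i => f i * g i := by
  refine Summable.of_norm_bounded (hf.add hg) fun i => ?_
  rw [Real.norm_eq_abs, abs_mul]
  nlinarith [sq_nonneg (|f i| - |g i|), sq_abs (f i), sq_abs (g i), abs_nonneg (f i),
    abs_nonneg (g i)]

theorem tsum_mul_le_sqrt_mul_sqrt {ι : Type*} {f g : ι → ℝ} (hf0 : ∀ i, 0 ≤ f i)
    (hg0 : ∀ i, 0 ≤ g i) (hf : Summable fun i => f i ^ 2) (hg : Summable fun i => g i ^ 2) :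
    ∑' i, f i * g i ≤ √(∑' i, f i ^ 2) * √(∑' i, g i ^ 2) := by
  have h := Real.inner_le_Lp_mul_Lq_tsum_of_nonneg (f := f) (g := g)
    (p := 2) (q := 2) Real.HolderConjugate.two_two hf0 hg0
    (by simpa using hf) (by simpa using hg)
  simpa [Real.sqrt_eq_rpow] using h

theorem l2Norm_nonneg (a : ℤ → ℂ) : 0 ≤ l2Norm a := Real.sqrt_nonneg _

theorem l2Norm_sq (a : ℤ → ℂ) : l2Norm a ^ 2 = ∑' k, ‖a k‖ ^ 2 :=
  Real.sq_sqrt (tsum_nonneg fun _ => by positivity)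

theorem SqSummable.of_le {a : ℤ → ℂ} {A : ℤ → ℝ} (hA : Summable fun k => A k ^ 2)
    (h : ∀ k, ‖a k‖ ≤ A k) : SqSummable a :=
  Summable.of_nonneg_of_le (fun _ => by positivity)
    (fun k => pow_le_pow_left₀ (norm_nonneg _) (h k) 2) hA

theorem l2Norm_le_of_le {a : ℤ → ℂ} {A : ℤ → ℝ} (hA : Summable fun k => A k ^ 2)
    (h : ∀ k, ‖a k‖ ≤ A k) : l2Norm a ≤ √(∑' k, A k ^ 2) :=
  Real.sqrt_le_sqrt ((SqSummable.of_le hA h).tsum_le_tsum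
    (fun k => pow_le_pow_left₀ (norm_nonneg _) (h k) 2) hA)

theorem norm_le_l2Norm {a : ℤ → ℂ} (ha : SqSummable a) (k : ℤ) : ‖a k‖ ≤ l2Norm a :=
  Real.le_sqrt_of_sq_le (ha.le_tsum k fun _ _ => by positivity)

theorem summable_add_sq {ι : Type*} {f g : ι → ℝ} (hf : Summable fun i => f i ^ 2)
    (hg : Summable fun i => g i ^ 2) : Summable fun i => (f i + g i) ^ 2 := by
  refine ((hf.add hg).add ((summable_mul_of_sq hf hg).mul_left 2)).congr fun i => ?_
  ring

theorem SqSummable.add {a b : ℤ → ℂ} (ha : SqSummable a) (hb : SqSummable b) :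
    SqSummable (a + b) :=
  SqSummable.of_le (summable_add_sq ha hb) fun k => norm_add_le (a k) (b k)

theorem SqSummable.neg {a : ℤ → ℂ} (ha : SqSummable a) : SqSummable (-a) := by
  simpa [SqSummable] using ha

theorem SqSummable.sub {a b : ℤ → ℂ} (ha : SqSummable a) (hb : SqSummable b) :
    SqSummable (a - b) := by
  rw [sub_eq_add_neg]; exact ha.add hb.neg

theorem sqrt_tsum_add_sq_le {ι : Type*} {f g : ι → ℝ} (hf0 : ∀ i, 0 ≤ f i)
    (hg0 : ∀ i, 0 ≤ g i) (hf : Summable fun i => f i ^ 2) (hg : Summable fun i => g i ^ 2) :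
    √(∑' i, (f i + g i) ^ 2) ≤ √(∑' i, f i ^ 2) + √(∑' i, g i ^ 2) := by
  have h := Real.Lp_add_le_tsum_of_nonneg (f := f) (g := g) (p := 2) (by norm_num) hf0 hg0
    (by simpa using hf) (by simpa using hg)
  simpa [Real.sqrt_eq_rpow] using h.2

theorem l2Norm_add_le {a b : ℤ → ℂ} (ha : SqSummable a) (hb : SqSummable b) :
    l2Norm (a + b) ≤ l2Norm a + l2Norm b :=
  (l2Norm_le_of_le (summable_add_sq ha hb) fun k => norm_add_le (a k) (b k)).trans
    (sqrt_tsum_add_sq_le (fun _ => norm_nonneg _) (fun _ => norm_nonneg _) ha hb)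

theorem l2Norm_neg (a : ℤ → ℂ) : l2Norm (-a) = l2Norm a := by simp [l2Norm]

theorem l2Norm_sub_le {a b : ℤ → ℂ} (ha : SqSummable a) (hb : SqSummable b) :
    l2Norm (a - b) ≤ l2Norm a + l2Norm b := by
  rw [sub_eq_add_neg, ← l2Norm_neg b]; exact l2Norm_add_le ha hb.neg

theorem l2Norm_sub_comm (a b : ℤ → ℂ) : l2Norm (a - b) = l2Norm (b - a) := by
  rw [← l2Norm_neg, neg_sub]

theorem abs_l2Norm_sub_le {a b : ℤ → ℂ} (ha : SqSummable a) (hb : SqSummable b) :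
    |l2Norm a - l2Norm b| ≤ l2Norm (a - b) := by
  have h1 := l2Norm_add_le (ha.sub hb) hb
  have h2 := l2Norm_add_le (hb.sub ha) ha
  rw [sub_add_cancel] at h1 h2
  rw [l2Norm_sub_comm] at h2
  rw [abs_le]; constructor <;> linarith

theorem summable_sq_comp_sub {f : ℤ → ℝ} (hf : Summable fun k => f k ^ 2) (k : ℤ) :
    Summable fun m => f (k - m) ^ 2 :=
  (Equiv.subLeft k).summable_iff.2 hf

theorem tsum_sq_comp_sub (f : ℤ → ℝ) (k : ℤ) : ∑' m, f (k - m) ^ 2 = ∑' m, f m ^ 2 :=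
  (Equiv.subLeft k).tsum_eq fun m => f m ^ 2

theorem summable_conv {f g : ℤ → ℝ} (hf : Summable fun k => f k ^ 2)
    (hg : Summable fun k => g k ^ 2) (k : ℤ) : Summable fun m => f m * g (k - m) :=
  summable_mul_of_sq hf (summable_sq_comp_sub hg k)

theorem tsum_conv_le {f g : ℤ → ℝ} (hf0 : ∀ i, 0 ≤ f i) (hg0 : ∀ i, 0 ≤ g i)
    (hf : Summable fun k => f k ^ 2) (hg : Summable fun k => g k ^ 2) (k : ℤ) :
    ∑' m, f m * g (k - m) ≤ √(∑' k, f k ^ 2) * √(∑' k, g k ^ 2) := by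
  rw [← tsum_sq_comp_sub g k]
  exact tsum_mul_le_sqrt_mul_sqrt hf0 (fun _ => hg0 _) hf (summable_sq_comp_sub hg k)

theorem summable_norm_seqConv {a b : ℤ → ℂ} (ha : SqSummable a) (hb : SqSummable b) (k : ℤ) :
    Summable fun m => ‖a m * b (k - m)‖ := by
  simpa only [norm_mul] using summable_conv ha hb k

theorem summable_seqConv {a b : ℤ → ℂ} (ha : SqSummable a) (hb : SqSummable b) (k : ℤ) :
    Summable fun m => a m * b (k - m) :=
  (summable_norm_seqConv ha hb k).of_norm

theorem norm_seqConv_le_tsum {a b : ℤ → ℂ} (ha : SqSummable a) (hb : SqSummable b) (k : ℤ) :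
    ‖seqConv a b k‖ ≤ ∑' m, ‖a m‖ * ‖b (k - m)‖ := by
  have h := norm_tsum_le_tsum_norm (summable_norm_seqConv ha hb k)
  simp only [norm_mul] at h
  exact h

/-- Cauchy–Schwarz. No decay in `k` is claimed: the linear part supplies all the decay the `ℓ²`
theory needs. -/
theorem norm_seqConv_le {a b : ℤ → ℂ} (ha : SqSummable a) (hb : SqSummable b) (k : ℤ) :
    ‖seqConv a b k‖ ≤ l2Norm a * l2Norm b :=
  (norm_seqConv_le_tsum ha hb k).trans
    (tsum_conv_le (fun _ => norm_nonneg _) (fun _ => norm_nonneg _) ha hb k)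

theorem seqConv_comm (a b : ℤ → ℂ) (k : ℤ) : seqConv a b k = seqConv b a k := by
  rw [seqConv, ← (Equiv.subLeft k).tsum_eq]
  simp [seqConv, mul_comm]

theorem seqConv_self_sub {a b : ℤ → ℂ} (ha : SqSummable a) (hb : SqSummable b) (k : ℤ) :
    seqConv a a k - seqConv b b k = seqConv (a - b) (a + b) k := by
  have h : seqConv (a - b) (a + b) k =
      seqConv a a k + seqConv a b k - seqConv b a k - seqConv b b k := by
    simp only [seqConv]
    rw [← (summable_seqConv ha ha k).tsum_add (summable_seqConv ha hb k),
      ← Summable.tsum_sub _ (summable_seqConv hb ha k),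
      ← Summable.tsum_sub _ (summable_seqConv hb hb k)]
    · refine tsum_congr fun m => ?_
      simp only [Pi.sub_apply, Pi.add_apply]; ring
    · exact ((summable_seqConv ha ha k).add (summable_seqConv ha hb k)).sub
        (summable_seqConv hb ha k)
    · exact (summable_seqConv ha ha k).add (summable_seqConv ha hb k)
  rw [h, seqConv_comm b a]; ring

/-- Factoring a difference of squares makes the nonlinearity locally Lipschitz from `ℓ²` to bounded
sequences; uniqueness and the Picard contraction both rest on this. -/
theorem norm_seqConv_self_sub_le {a b : ℤ → ℂ} (ha : SqSummable a) (hb : SqSummable b) (k : ℤ) :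
    ‖seqConv a a k - seqConv b b k‖ ≤ l2Norm (a - b) * (l2Norm a + l2Norm b) := by
  rw [seqConv_self_sub ha hb]
  exact (norm_seqConv_le (ha.sub hb) (ha.add hb) k).trans
    (mul_le_mul_of_nonneg_left (l2Norm_add_le ha hb) (l2Norm_nonneg _))

theorem continuousOn_seqConv {X : Type*} [TopologicalSpace X] {s : Set X} {a b : X → ℤ → ℂ}
    {A B : ℤ → ℝ} (hA : Summable fun k => A k ^ 2) (hB : Summable fun k => B k ^ 2)
    (ha : ∀ x ∈ s, ∀ k, ‖a x k‖ ≤ A k) (hb : ∀ x ∈ s, ∀ k, ‖b x k‖ ≤ B k)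
    (hac : ∀ k, ContinuousOn (fun x => a x k) s) (hbc : ∀ k, ContinuousOn (fun x => b x k) s)
    (k : ℤ) : ContinuousOn (fun x => seqConv (a x) (b x) k) s := by
  refine continuousOn_tsum (fun m => (hac m).mul (hbc _)) (summable_conv hA hB k)
    fun m x hx => ?_
  rw [norm_mul]
  exact mul_le_mul (ha x hx m) (hb x hx _) (norm_nonneg _) ((norm_nonneg _).trans (ha x hx m))

theorem l2Norm_const_mul (c : ℂ) (a : ℤ → ℂ) : l2Norm (fun k => c * a k) = ‖c‖ * l2Norm a := by
  simp only [l2Norm, norm_mul, mul_pow, tsum_mul_left]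
  rw [Real.sqrt_mul (by positivity), Real.sqrt_sq (norm_nonneg _)]

/-! ### The equation for the Fourier coefficients -/

/-- The integrating factor `e^{lam (t - t₀)}` removes the damping, and the norm of the product is
compared with an explicit primitive. The factor `1 - e^{-lam (t - t₀)}` is kept because local
existence draws a power of time from it. -/
theorem norm_le_of_hasDerivWithinAt_linear {y f : ℝ → ℂ} {lam F t₀ t₁ : ℝ} (hlam : 0 < lam)
    (hy : ∀ t ∈ Icc t₀ t₁, HasDerivWithinAt y (-(lam : ℂ) * y t + f t) (Icc t₀ t₁) t)
    (hf : ∀ t ∈ Icc t₀ t₁, ‖f t‖ ≤ F) {t : ℝ} (ht : t ∈ Icc t₀ t₁) :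
    ‖y t‖ ≤ rexp (-(lam * (t - t₀))) * ‖y t₀‖ + F / lam * (1 - rexp (-(lam * (t - t₀)))) := by
  have hE : ∀ s : ℝ, HasDerivAt (fun s : ℝ => rexp (lam * (s - t₀)))
      (lam * rexp (lam * (s - t₀))) s := fun s => by
    have := (((hasDerivAt_id s).sub_const t₀).const_mul lam).exp
    simpa [mul_comm] using this
  have hz : ∀ s ∈ Icc t₀ t₁, HasDerivWithinAt
      (fun s => ((rexp (lam * (s - t₀)) : ℝ) : ℂ) * y s)
      (((rexp (lam * (s - t₀)) : ℝ) : ℂ) * f s) (Icc t₀ t₁) s := fun s hs => by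
    have := ((hE s).ofReal_comp.hasDerivWithinAt (s := Icc t₀ t₁)).mul (hy s hs)
    refine this.congr_deriv ?_
    push_cast; ring
  have key := image_norm_le_of_norm_deriv_right_le_deriv_boundary
    (f := fun s => ((rexp (lam * (s - t₀)) : ℝ) : ℂ) * y s)
    (f' := fun s => ((rexp (lam * (s - t₀)) : ℝ) : ℂ) * f s)
    (B := fun s => ‖y t₀‖ + F / lam * (rexp (lam * (s - t₀)) - 1))
    (B' := fun s => F * rexp (lam * (s - t₀))) (a := t₀) (b := t₁)
    (fun s hs => (hz s hs).continuousWithinAt)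
    (fun s hs => (hz s (Ico_subset_Icc_self hs)).mono_of_mem_nhdsWithin
      (Icc_mem_nhdsGE_of_mem hs))
    (by simp)
    (fun s => by
      refine ((((hE s).sub_const 1).const_mul (F / lam)).const_add _).congr_deriv ?_
      field_simp)
    (fun s hs => by
      rw [norm_mul, Complex.norm_real, Real.norm_eq_abs, abs_of_pos (Real.exp_pos _), mul_comm]
      exact mul_le_mul_of_nonneg_right (hf s (Ico_subset_Icc_self hs)) (Real.exp_pos _).le)
    ht
  simp only [norm_mul, Complex.norm_real, Real.norm_eq_abs, abs_of_pos (Real.exp_pos _)] at key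
  have hpos := Real.exp_pos (-(lam * (t - t₀)))
  have hmul : rexp (-(lam * (t - t₀))) * rexp (lam * (t - t₀)) = 1 := by
    rw [← Real.exp_add]; simp
  calc ‖y t‖ = rexp (-(lam * (t - t₀))) * (rexp (lam * (t - t₀)) * ‖y t‖) := by
        rw [← mul_assoc, hmul, one_mul]
    _ ≤ rexp (-(lam * (t - t₀))) * (‖y t₀‖ + F / lam * (rexp (lam * (t - t₀)) - 1)) :=
        mul_le_mul_of_nonneg_left key hpos.le
    _ = _ := by linear_combination (F / lam) * hmul

/-- The evolution equation satisfied by the Fourier coefficients of the slope `u_x` of a solution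
of the surface growth equation, on the time interval `[0, T]`. -/
structure SeqSol (T : ℝ) (a : ℝ → ℤ → ℂ) : Prop where
  zero_mode : ∀ t ∈ Icc 0 T, a t 0 = 0
  dominated : ∃ A : ℤ → ℝ, Summable (fun k => A k ^ 2) ∧ ∀ t ∈ Icc 0 T, ∀ k, ‖a t k‖ ≤ A k
  ode : ∀ k : ℤ, ∀ t ∈ Icc 0 T, HasDerivWithinAt (fun s => a s k)
    (-(k : ℂ) ^ 4 * a t k + Complex.I * (k : ℂ) ^ 3 * seqConv (a t) (a t) k) (Icc 0 T) t

namespace SeqSol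

variable {T : ℝ} {a b : ℝ → ℤ → ℂ}

theorem continuousOn (h : SeqSol T a) (k : ℤ) : ContinuousOn (fun t => a t k) (Icc 0 T) :=
  fun t ht => (h.ode k t ht).continuousWithinAt

theorem sqSummable (h : SeqSol T a) {t : ℝ} (ht : t ∈ Icc 0 T) : SqSummable (a t) := by
  obtain ⟨A, hA, hle⟩ := h.dominated
  exact SqSummable.of_le hA (hle t ht)

theorem exists_l2Norm_le (h : SeqSol T a) : ∃ M, 0 ≤ M ∧ ∀ t ∈ Icc 0 T, l2Norm (a t) ≤ M := by
  obtain ⟨A, hA, hle⟩ := h.dominated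
  exact ⟨_, Real.sqrt_nonneg _, fun t ht => l2Norm_le_of_le hA (hle t ht)⟩

/-- Continuity of each mode alone would not suffice: the majorant in `dominated`, common to all
times, makes the convolution series converge uniformly. -/
theorem continuousOn_seqConv (h : SeqSol T a) (k : ℤ) :
    ContinuousOn (fun t => seqConv (a t) (a t) k) (Icc 0 T) := by
  obtain ⟨A, hA, hle⟩ := h.dominated
  exact _root_.continuousOn_seqConv hA hA hle hle h.continuousOn h.continuousOn k

theorem mono (h : SeqSol T a) {T' : ℝ} (hT : T' ≤ T) : SeqSol T' a := by
  have hsub : Icc 0 T' ⊆ Icc 0 T := Icc_subset_Icc_right hT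
  obtain ⟨A, hA, hle⟩ := h.dominated
  exact ⟨fun t ht => h.zero_mode t (hsub ht), ⟨A, hA, fun t ht => hle t (hsub ht)⟩,
    fun k t ht => (h.ode k t (hsub ht)).mono hsub⟩

theorem congr (h : SeqSol T a) (hab : ∀ t ∈ Icc 0 T, b t = a t) : SeqSol T b := by
  obtain ⟨A, hA, hle⟩ := h.dominated
  refine ⟨fun t ht => by rw [hab t ht, h.zero_mode t ht],
    ⟨A, hA, fun t ht => by rw [hab t ht]; exact hle t ht⟩, fun k t ht => ?_⟩
  rw [hab t ht]
  exact (h.ode k t ht).congr (fun s hs => by rw [hab s hs]) (by rw [hab t ht])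

theorem append {τ : ℝ} (hT : 0 ≤ T) (hτ : 0 ≤ τ) (ha : SeqSol T a) (hb : SeqSol τ b)
    (hab : b 0 = a T) : SeqSol (T + τ) (fun t => if t ≤ T then a t else b (t - T)) := by
  obtain ⟨A, hA, hleA⟩ := ha.dominated
  obtain ⟨B, hB, hleB⟩ := hb.dominated
  have hA0 : ∀ k, 0 ≤ A k := fun k => (norm_nonneg _).trans (hleA 0 ⟨le_rfl, hT⟩ k)
  have hB0 : ∀ k, 0 ≤ B k := fun k => (norm_nonneg _).trans (hleB 0 ⟨le_rfl, hτ⟩ k)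
  have hmem : ∀ t ∈ Icc 0 (T + τ), ¬ t ≤ T → t - T ∈ Icc 0 τ := fun t ht h => by
    push Not at h; exact ⟨by linarith, by linarith [ht.2]⟩
  refine ⟨fun t ht => ?_, ⟨fun k => A k + B k, summable_add_sq hA hB, fun t ht k => ?_⟩,
    fun k t ht => ?_⟩
  · split_ifs with h
    · exact ha.zero_mode t ⟨ht.1, h⟩
    · exact hb.zero_mode _ (hmem t ht h)
  · split_ifs with h
    · exact (hleA t ⟨ht.1, h⟩ k).trans (by linarith [hB0 k])
    · exact (hleB _ (hmem t ht h) k).trans (by linarith [hA0 k])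
  · have hval : ∀ s ∈ Icc T (T + τ), (if s ≤ T then a s else b (s - T)) = b (s - T) := by
      intro s hs
      split_ifs with h
      · have : s = T := le_antisymm h hs.1
        rw [this, sub_self, hab]
      · rfl
    have h1 : ∀ s ∈ Icc 0 T, (if s ≤ T then a s else b (s - T)) = a s := fun s hs => if_pos hs.2
    -- The derivative is taken within each closed piece separately. At the junction both pieces give
    -- the same value because `b 0 = a T`; outside a piece the derivative within it is vacuous.
    rw [← Icc_union_Icc_eq_Icc hT (by linarith : T ≤ T + τ)]
    apply HasDerivWithinAt.union
    · by_cases h : t ∈ Icc 0 T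
      · rw [h1 t h]
        exact (ha.ode k t h).congr (fun s hs => by rw [h1 s hs]) (by rw [h1 t h])
      · exact HasFDerivWithinAt.of_notMem_closure (by rwa [isClosed_Icc.closure_eq])
    · by_cases h : t ∈ Icc T (T + τ)
      · rw [hval t h]
        have hm : t - T ∈ Icc 0 τ := ⟨by linarith [h.1], by linarith [h.2]⟩
        have hd : HasDerivWithinAt (fun s => b (s - T) k)
            (-(k : ℂ) ^ 4 * b (t - T) k + Complex.I * (k : ℂ) ^ 3 *
              seqConv (b (t - T)) (b (t - T)) k) (Icc T (T + τ)) t := by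
          have := (hb.ode k _ hm).scomp t (h := fun s => s - T)
            (((hasDerivAt_id t).sub_const T).hasDerivWithinAt (s := Icc T (T + τ)))
            (fun s hs => ⟨by linarith [hs.1], by linarith [hs.2]⟩)
          simpa [Function.comp_def] using this
        exact hd.congr (fun s hs => by rw [hval s hs]) (by rw [hval t h])
      · exact HasFDerivWithinAt.of_notMem_closure (by rwa [isClosed_Icc.closure_eq])

end SeqSol

/-! ### Uniqueness for the coefficient equation -/

theorem summable_abs_int_inv_sq : Summable fun k : ℤ => (|(k : ℝ)|⁻¹) ^ 2 := by
  refine (Real.summable_one_div_int_pow.2 (by norm_num : 1 < 2)).congr fun k => ?_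
  rw [inv_pow, sq_abs, one_div]

theorem cube_div_pow_four_add_le (k : ℤ) {lam : ℝ} (hlam : 0 ≤ lam) :
    |(k : ℝ)| ^ 3 / ((k : ℝ) ^ 4 + lam) ≤ |(k : ℝ)|⁻¹ := by
  rcases eq_or_ne k 0 with rfl | hk
  · simp
  · have hk' : 0 < |(k : ℝ)| := abs_pos.2 (by exact_mod_cast hk)
    have h4 : (k : ℝ) ^ 4 = |(k : ℝ)| ^ 4 := (Even.pow_abs (by decide) _).symm
    rw [h4, ← one_div, div_le_div_iff₀ (by positivity) hk']
    nlinarith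

theorem summable_sq_cube_div {lam : ℝ} (hlam : 0 ≤ lam) :
    Summable fun k : ℤ => (|(k : ℝ)| ^ 3 / ((k : ℝ) ^ 4 + lam)) ^ 2 := by
  refine Summable.of_nonneg_of_le (fun k => by positivity) (fun k => ?_) summable_abs_int_inv_sq
  have h := cube_div_pow_four_add_le k hlam
  have h0 : 0 ≤ |(k : ℝ)| ^ 3 / ((k : ℝ) ^ 4 + lam) := by positivity
  exact pow_le_pow_left₀ h0 h 2

/-- Dominated convergence with majorant `k⁻²`. The square root of this sum is, up to a factor, the
Lipschitz constant of Duhamel's formula in the norm weighted by `e^{-lam t}`. -/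
theorem tendsto_tsum_cube_div :
    Tendsto (fun lam : ℝ => ∑' k : ℤ, (|(k : ℝ)| ^ 3 / ((k : ℝ) ^ 4 + lam)) ^ 2) atTop (𝓝 0) := by
  have h : Tendsto (fun lam : ℝ => ∑' k : ℤ, (|(k : ℝ)| ^ 3 / ((k : ℝ) ^ 4 + lam)) ^ 2) atTop
      (𝓝 (∑' _ : ℤ, (0 : ℝ))) := by
    refine tendsto_tsum_of_dominated_convergence summable_abs_int_inv_sq (fun k => ?_) ?_
    · have : Tendsto (fun lam : ℝ => |(k : ℝ)| ^ 3 / ((k : ℝ) ^ 4 + lam)) atTop (𝓝 0) :=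
        tendsto_const_nhds.div_atTop (tendsto_atTop_add_const_left _ _ tendsto_id)
      simpa using this.pow 2
    · filter_upwards [eventually_ge_atTop 0] with lam hlam k
      rw [Real.norm_eq_abs, abs_of_nonneg (by positivity)]
      exact pow_le_pow_left₀ (by positivity) (cube_div_pow_four_add_le k hlam) 2
  simpa using h

namespace SeqSol

variable {T : ℝ} {a b : ℝ → ℤ → ℂ}

/-- The weighted difference `e^{-lam t} (a - b)` starts from zero, is damped at rate `k⁴ + lam` and
is forced by at most `C (M + N) |k|³`. Taking `lam` large makes the resulting `ℓ²` bound at most `C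
/ 2`; one `lam` serves every `C`, so the bound can be iterated. -/
theorem l2Norm_sub_le_half (ha : SeqSol T a) (hb : SeqSol T b) (hab : a 0 = b 0) :
    ∃ lam : ℝ, ∀ C, (∀ t ∈ Icc 0 T, rexp (-(lam * t)) * l2Norm (a t - b t) ≤ C) →
      ∀ t ∈ Icc 0 T, rexp (-(lam * t)) * l2Norm (a t - b t) ≤ C / 2 := by
  obtain ⟨M, hM0, hM⟩ := ha.exists_l2Norm_le
  obtain ⟨N, hN0, hN⟩ := hb.exists_l2Norm_le
  have hlim : Tendsto (fun lam : ℝ => (M + N) *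
      √(∑' k : ℤ, (|(k : ℝ)| ^ 3 / ((k : ℝ) ^ 4 + lam)) ^ 2)) atTop (𝓝 0) := by
    simpa using (tendsto_tsum_cube_div.sqrt).const_mul (M + N)
  obtain ⟨lam, hlam, hlam0⟩ := ((hlim.eventually (ge_mem_nhds (by norm_num : (0 : ℝ) < 1 / 2))).and
    (eventually_gt_atTop 0)).exists
  refine ⟨lam, fun C hC t ht => ?_⟩
  have hC0 : 0 ≤ C := (mul_nonneg (Real.exp_pos _).le (l2Norm_nonneg _)).trans (hC t ht)
  have hbound : ∀ k : ℤ, ‖((rexp (-(lam * t)) : ℝ) : ℂ) * (a t - b t) k‖ ≤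
      C * (M + N) * (|(k : ℝ)| ^ 3 / ((k : ℝ) ^ 4 + lam)) := by
    intro k
    have hE : ∀ s : ℝ, HasDerivAt (fun s : ℝ => rexp (-(lam * s)))
        (-lam * rexp (-(lam * s))) s := fun s => by
      have := (((hasDerivAt_id s).const_mul lam).neg).exp
      simpa [mul_comm] using this
    have hy : ∀ s ∈ Icc 0 T, HasDerivWithinAt
        (fun s => ((rexp (-(lam * s)) : ℝ) : ℂ) * (a s - b s) k)
        (-(((k : ℝ) ^ 4 + lam : ℝ) : ℂ) * (((rexp (-(lam * s)) : ℝ) : ℂ) * (a s - b s) k) +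
          ((rexp (-(lam * s)) : ℝ) : ℂ) * (Complex.I * (k : ℂ) ^ 3 *
            (seqConv (a s) (a s) k - seqConv (b s) (b s) k))) (Icc 0 T) s := fun s hs => by
      have := ((hE s).ofReal_comp.hasDerivWithinAt (s := Icc 0 T)).mul
        ((ha.ode k s hs).sub (hb.ode k s hs))
      refine this.congr_deriv ?_
      simp only [Pi.sub_apply]
      push_cast; ring
    have hf : ∀ s ∈ Icc 0 T, ‖((rexp (-(lam * s)) : ℝ) : ℂ) * (Complex.I * (k : ℂ) ^ 3 *
            (seqConv (a s) (a s) k - seqConv (b s) (b s) k))‖ ≤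
          C * (M + N) * |(k : ℝ)| ^ 3 := fun s hs => by
      have h1 := norm_seqConv_self_sub_le (ha.sqSummable hs) (hb.sqSummable hs) k
      have h2 : l2Norm (a s) + l2Norm (b s) ≤ M + N := add_le_add (hM s hs) (hN s hs)
      have h3 := hC s hs
      have h4 := Real.exp_pos (-(lam * s))
      rw [norm_mul, norm_mul, norm_mul, Complex.norm_real, Complex.norm_I, norm_pow,
        Complex.norm_intCast, Real.norm_eq_abs, abs_of_pos h4, one_mul]
      calc rexp (-(lam * s)) * (|(k : ℝ)| ^ 3 * ‖seqConv (a s) (a s) k - seqConv (b s) (b s) k‖)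
          ≤ rexp (-(lam * s)) * (|(k : ℝ)| ^ 3 * (l2Norm (a s - b s) * (M + N))) := by
            gcongr
            exact h1.trans (mul_le_mul_of_nonneg_left h2 (l2Norm_nonneg _))
        _ = (rexp (-(lam * s)) * l2Norm (a s - b s)) * (M + N) * |(k : ℝ)| ^ 3 := by ring
        _ ≤ _ := by gcongr
    have h := norm_le_of_hasDerivWithinAt_linear (by positivity) hy hf ht
    rw [hab] at h
    simp only [sub_self, Pi.zero_apply, mul_zero, norm_zero, zero_add] at h
    refine h.trans ?_
    rw [mul_div_assoc]
    have hpos := Real.exp_pos (-(((k : ℝ) ^ 4 + lam) * (t - 0)))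
    exact mul_le_of_le_one_right (by positivity) (by linarith)
  have hsum : Summable fun k : ℤ =>
      (C * (M + N) * (|(k : ℝ)| ^ 3 / ((k : ℝ) ^ 4 + lam))) ^ 2 :=
    ((summable_sq_cube_div hlam0.le).mul_left ((C * (M + N)) ^ 2)).congr fun k =>
      (mul_pow _ _ 2).symm
  have h := l2Norm_le_of_le hsum hbound
  rw [l2Norm_const_mul, Complex.norm_real, Real.norm_eq_abs, abs_of_pos (Real.exp_pos _)] at h
  refine h.trans ?_
  rw [tsum_congr fun k : ℤ => mul_pow (C * (M + N)) (|(k : ℝ)| ^ 3 / ((k : ℝ) ^ 4 + lam)) 2,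
    tsum_mul_left]
  rw [Real.sqrt_mul (by positivity), Real.sqrt_sq (by positivity)]
  nlinarith

/-- The halving estimate, iterated from a crude a priori bound, forces the weighted difference to
vanish. -/
theorem unique (ha : SeqSol T a) (hb : SeqSol T b) (hab : a 0 = b 0) :
    ∀ t ∈ Icc 0 T, a t = b t := by
  obtain ⟨lam, hlam⟩ := l2Norm_sub_le_half ha hb hab
  obtain ⟨M, hM0, hM⟩ := ha.exists_l2Norm_le
  obtain ⟨N, hN0, hN⟩ := hb.exists_l2Norm_le
  -- The halving lemma does not record the sign of `lam`, hence the absolute value.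
  have hE : ∀ t ∈ Icc 0 T, rexp (-(lam * t)) ≤ rexp (|lam| * T) := fun t ht => by
    apply Real.exp_le_exp.2
    have := neg_abs_le lam
    nlinarith [ht.1, ht.2, abs_nonneg lam, mul_nonneg (abs_nonneg lam) ht.1]
  have hall : ∀ n : ℕ, ∀ t ∈ Icc 0 T,
      rexp (-(lam * t)) * l2Norm (a t - b t) ≤ rexp (|lam| * T) * (M + N) * (1 / 2) ^ n := by
    intro n
    induction n with
    | zero =>
      intro t ht
      have h1 := l2Norm_sub_le (ha.sqSummable ht) (hb.sqSummable ht)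
      simp only [pow_zero, mul_one]
      exact mul_le_mul (hE t ht) (by linarith [hM t ht, hN t ht]) (l2Norm_nonneg _)
        (Real.exp_pos _).le
    | succ n ih =>
      intro t ht
      refine (hlam _ ih t ht).trans (le_of_eq ?_)
      rw [pow_succ]; ring
  intro t ht
  have hlim : Tendsto (fun n : ℕ => rexp (|lam| * T) * (M + N) * (1 / 2 : ℝ) ^ n) atTop (𝓝 0) := by
    simpa using (tendsto_pow_atTop_nhds_zero_of_lt_one (by norm_num : (0 : ℝ) ≤ 1 / 2)
      (by norm_num)).const_mul (rexp (|lam| * T) * (M + N))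
  have h0 := ge_of_tendsto' hlim fun n => hall n t ht
  have h1 : l2Norm (a t - b t) ≤ 0 := by
    by_contra! h
    exact absurd h0 (not_le.2 (mul_pos (Real.exp_pos _) h))
  funext k
  have h2 := (norm_le_l2Norm ((ha.sqSummable ht).sub (hb.sqSummable ht)) k).trans h1
  exact sub_eq_zero.1 (norm_le_zero_iff.1 h2)

end SeqSol

/-! ### Local existence for the coefficient equation -/

/-- The solution with zero initial value of `y' = - k⁴ y + i k³ f`. -/
noncomputable def duhamel (k : ℤ) (f : ℝ → ℂ) (t : ℝ) : ℂ :=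
  ((rexp (-((k : ℝ) ^ 4 * t)) : ℝ) : ℂ) *
    ∫ s in (0 : ℝ)..t, ((rexp ((k : ℝ) ^ 4 * s) : ℝ) : ℂ) * (Complex.I * (k : ℂ) ^ 3 * f s)

theorem hasDerivAt_exp_const_mul (c t : ℝ) :
    HasDerivAt (fun s : ℝ => rexp (c * s)) (c * rexp (c * t)) t := by
  have := ((hasDerivAt_id t).const_mul c).exp
  simpa [mul_comm] using this

@[simp] theorem duhamel_zero_right (k : ℤ) (f : ℝ → ℂ) : duhamel k f 0 = 0 := by simp [duhamel]

@[simp] theorem duhamel_zero_left (f : ℝ → ℂ) (t : ℝ) : duhamel 0 f t = 0 := by simp [duhamel]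

theorem continuous_duhamel_integrand (k : ℤ) {f : ℝ → ℂ} (hf : Continuous f) :
    Continuous fun s : ℝ =>
      ((rexp ((k : ℝ) ^ 4 * s) : ℝ) : ℂ) * (Complex.I * (k : ℂ) ^ 3 * f s) := by
  fun_prop

theorem hasDerivAt_duhamel (k : ℤ) {f : ℝ → ℂ} (hf : Continuous f) (t : ℝ) :
    HasDerivAt (duhamel k f)
      (-(k : ℂ) ^ 4 * duhamel k f t + Complex.I * (k : ℂ) ^ 3 * f t) t := by
  have hg := continuous_duhamel_integrand k hf
  have h1 := intervalIntegral.integral_hasDerivAt_right (hg.intervalIntegrable 0 t)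
    hg.aestronglyMeasurable.stronglyMeasurableAtFilter hg.continuousAt
  have h2 := (hasDerivAt_exp_const_mul (-(k : ℝ) ^ 4) t).ofReal_comp
  simp only [neg_mul] at h2
  have hmul : ((rexp (-((k : ℝ) ^ 4 * t)) : ℝ) : ℂ) * ((rexp ((k : ℝ) ^ 4 * t) : ℝ) : ℂ) = 1 := by
    rw [← Complex.ofReal_mul, ← Real.exp_add]; simp
  refine (h2.mul h1).congr_deriv ?_
  rw [← mul_assoc _ _ (Complex.I * (k : ℂ) ^ 3 * f t), hmul, duhamel]
  push_cast; ring

theorem duhamel_sub (k : ℤ) {f g : ℝ → ℂ} (hf : Continuous f) (hg : Continuous g) (t : ℝ) :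
    duhamel k (fun s => f s - g s) t = duhamel k f t - duhamel k g t := by
  rw [duhamel, duhamel, duhamel, ← mul_sub, ← intervalIntegral.integral_sub
    ((continuous_duhamel_integrand k hf).intervalIntegrable _ _)
    ((continuous_duhamel_integrand k hg).intervalIntegrable _ _)]
  congr 2
  funext s
  ring

theorem norm_duhamel_le {k : ℤ} (hk : k ≠ 0) {f : ℝ → ℂ} (hf : Continuous f) {F τ t : ℝ}
    (hF : ∀ s ∈ Icc 0 τ, ‖f s‖ ≤ F) (ht : t ∈ Icc 0 τ) :
    ‖duhamel k f t‖ ≤ |(k : ℝ)| ^ 3 * F / (k : ℝ) ^ 4 * (1 - rexp (-((k : ℝ) ^ 4 * t))) := by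
  have hk4 : (0 : ℝ) < (k : ℝ) ^ 4 := by positivity
  have h := norm_le_of_hasDerivWithinAt_linear (y := duhamel k f)
    (f := fun s => Complex.I * (k : ℂ) ^ 3 * f s) (F := |(k : ℝ)| ^ 3 * F) hk4
    (fun s _ => by
      have := (hasDerivAt_duhamel k hf s).hasDerivWithinAt (s := Icc 0 τ)
      push_cast; exact this)
    (fun s hs => by
      rw [norm_mul, norm_mul, Complex.norm_I, one_mul, norm_pow, Complex.norm_intCast]
      exact mul_le_mul_of_nonneg_left (hF s hs) (by positivity)) ht
  simpa using h

/-- The weight `|k| ^ (3 / 4)`. -/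
noncomputable def modeWeight (k : ℤ) : ℝ := |(k : ℝ)| ^ (3 / 4 : ℝ)

theorem modeWeight_nonneg (k : ℤ) : 0 ≤ modeWeight k := Real.rpow_nonneg (abs_nonneg _) _

@[simp] theorem modeWeight_zero : modeWeight 0 = 0 := by
  simp [modeWeight, Real.zero_rpow]

theorem modeWeight_pos {k : ℤ} (hk : k ≠ 0) : 0 < modeWeight k :=
  Real.rpow_pos_of_pos (abs_pos.2 (by exact_mod_cast hk)) _

/-- Any exponent above `1/2` gives summability; staying below `1` leaves part of the Duhamel gain
`1/|k|` to be exchanged for a power of time. The mode `k = 0` contributes `0⁻¹ = 0`. -/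
theorem summable_inv_modeWeight_sq : Summable fun k => (modeWeight k)⁻¹ ^ 2 := by
  refine (Real.summable_abs_int_rpow (by norm_num : (1 : ℝ) < 3 / 2)).congr fun k => ?_
  rw [modeWeight, ← Real.rpow_neg (abs_nonneg _), ← Real.rpow_natCast, ← Real.rpow_mul
    (abs_nonneg _)]
  norm_num

/-- Interpolation between the bounds `1` and `x`; it supplies the small power of time that makes the
Picard map contract. -/
theorem one_sub_exp_neg_le_rpow {x p : ℝ} (hx : 0 ≤ x) (hp : 0 ≤ p) (hp1 : p ≤ 1) :
    1 - rexp (-x) ≤ x ^ p := by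
  rcases le_total 1 x with h | h
  · exact (by linarith [Real.exp_pos (-x)] : 1 - rexp (-x) ≤ 1).trans (Real.one_le_rpow h hp)
  · have h1 : 1 - rexp (-x) ≤ x := by linarith [Real.add_one_le_exp (-x)]
    refine h1.trans ?_
    conv_lhs => rw [← Real.rpow_one x]
    exact Real.rpow_le_rpow_of_exponent_ge_of_imp hx h hp1 (fun _ h => by linarith)

theorem modeWeight_mul_norm_duhamel_le (k : ℤ) {f : ℝ → ℂ} (hf : Continuous f) {F τ t : ℝ}
    (hF0 : 0 ≤ F) (hF : ∀ s ∈ Icc 0 τ, ‖f s‖ ≤ F) (ht : t ∈ Icc 0 τ) :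
    modeWeight k * ‖duhamel k f t‖ ≤ F * τ ^ (1 / 16 : ℝ) := by
  have hτ : 0 ≤ τ := ht.1.trans ht.2
  rcases eq_or_ne k 0 with rfl | hk
  · simp only [modeWeight_zero, zero_mul]; positivity
  have hk0 : 0 < |(k : ℝ)| := abs_pos.2 (by exact_mod_cast hk)
  have hk4 : (k : ℝ) ^ 4 = |(k : ℝ)| ^ 4 := (Even.pow_abs (by decide) _).symm
  have h1 := norm_duhamel_le hk hf hF ht
  have h2 : 1 - rexp (-((k : ℝ) ^ 4 * t)) ≤ ((k : ℝ) ^ 4 * τ) ^ (1 / 16 : ℝ) :=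
    (one_sub_exp_neg_le_rpow (mul_nonneg (by positivity) ht.1) (by norm_num) (by norm_num)).trans
      (Real.rpow_le_rpow (mul_nonneg (by positivity) ht.1)
        (mul_le_mul_of_nonneg_left ht.2 (by positivity)) (by norm_num))
  -- The powers of `|k|` cancel, `3/4 + (3 - 4) + 4 · (1/16) = 0`, which is where the exponent
  -- `1/16` comes from.
  have h3 : modeWeight k * (|(k : ℝ)| ^ 3 / (k : ℝ) ^ 4) * ((k : ℝ) ^ 4) ^ (1 / 16 : ℝ) = 1 := by
    rw [modeWeight, hk4, ← Real.rpow_natCast, ← Real.rpow_natCast, ← Real.rpow_mul hk0.le,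
      ← Real.rpow_sub hk0, ← Real.rpow_add hk0, ← Real.rpow_add hk0]
    norm_num
  calc modeWeight k * ‖duhamel k f t‖
      ≤ modeWeight k * (|(k : ℝ)| ^ 3 * F / (k : ℝ) ^ 4 * ((k : ℝ) ^ 4 * τ) ^ (1 / 16 : ℝ)) :=
        mul_le_mul_of_nonneg_left (h1.trans (mul_le_mul_of_nonneg_left h2 (by positivity)))
          (modeWeight_nonneg k)
    _ = (modeWeight k * (|(k : ℝ)| ^ 3 / (k : ℝ) ^ 4) * ((k : ℝ) ^ 4) ^ (1 / 16 : ℝ)) *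
          (F * τ ^ (1 / 16 : ℝ)) := by
        rw [Real.mul_rpow (by positivity) hτ]; ring
    _ = F * τ ^ (1 / 16 : ℝ) := by rw [h3, one_mul]

/-- The coefficient family `e^{-k⁴|t|} a₀(k) + β(k, t) / |k|^{3/4}`. -/
noncomputable def seqOfWeighted (a₀ : ℤ → ℂ) (β : BoundedContinuousFunction (ℤ × ℝ) ℂ)
    (t : ℝ) (k : ℤ) : ℂ :=
  ((rexp (-((k : ℝ) ^ 4 * |t|)) : ℝ) : ℂ) * a₀ k + β (k, t) * (((modeWeight k)⁻¹ : ℝ) : ℂ)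

section Picard

variable {a₀ : ℤ → ℂ} (β γ : BoundedContinuousFunction (ℤ × ℝ) ℂ)

/-- The absolute value `|t|` keeps the exponential at most `1` for negative times too, so the bound
holds on the whole line, where the Picard map is set. -/
theorem norm_seqOfWeighted_le (t : ℝ) (k : ℤ) :
    ‖seqOfWeighted a₀ β t k‖ ≤ ‖a₀ k‖ + ‖β‖ * (modeWeight k)⁻¹ := by
  refine (norm_add_le _ _).trans (add_le_add ?_ ?_)
  · rw [norm_mul, Complex.norm_real, Real.norm_eq_abs, abs_of_pos (Real.exp_pos _)]
    refine mul_le_of_le_one_left (norm_nonneg _) (Real.exp_le_one_iff.2 ?_)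
    have : 0 ≤ (k : ℝ) ^ 4 * |t| := by positivity
    linarith
  · rw [norm_mul, Complex.norm_real, Real.norm_eq_abs,
      abs_of_nonneg (inv_nonneg.2 (modeWeight_nonneg k))]
    exact mul_le_mul_of_nonneg_right (β.norm_coe_le_norm _) (inv_nonneg.2 (modeWeight_nonneg k))

theorem summable_const_mul_inv_modeWeight_sq (c : ℝ) :
    Summable fun k => (c * (modeWeight k)⁻¹) ^ 2 := by
  simpa only [mul_pow] using summable_inv_modeWeight_sq.mul_left (c ^ 2)

theorem sqrt_tsum_const_mul_inv_modeWeight_sq {c : ℝ} (hc : 0 ≤ c) :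
    √(∑' k, (c * (modeWeight k)⁻¹) ^ 2) = c * √(∑' k, (modeWeight k)⁻¹ ^ 2) := by
  simp only [mul_pow, tsum_mul_left]
  rw [Real.sqrt_mul (by positivity), Real.sqrt_sq hc]

theorem sqSummable_seqOfWeighted (ha₀ : SqSummable a₀) (t : ℝ) :
    SqSummable (seqOfWeighted a₀ β t) :=
  SqSummable.of_le (summable_add_sq ha₀ (summable_const_mul_inv_modeWeight_sq _))
    (norm_seqOfWeighted_le β t)

theorem l2Norm_seqOfWeighted_le (ha₀ : SqSummable a₀) (t : ℝ) :
    l2Norm (seqOfWeighted a₀ β t) ≤ l2Norm a₀ + ‖β‖ * √(∑' k, (modeWeight k)⁻¹ ^ 2) := by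
  rw [← sqrt_tsum_const_mul_inv_modeWeight_sq (norm_nonneg β)]
  exact (l2Norm_le_of_le (summable_add_sq ha₀ (summable_const_mul_inv_modeWeight_sq _))
    (norm_seqOfWeighted_le β t)).trans (sqrt_tsum_add_sq_le (fun _ => norm_nonneg _)
      (fun k => mul_nonneg (norm_nonneg _) (inv_nonneg.2 (modeWeight_nonneg k))) ha₀
      (summable_const_mul_inv_modeWeight_sq _))

theorem l2Norm_seqOfWeighted_sub_le (t : ℝ) :
    l2Norm (seqOfWeighted a₀ β t - seqOfWeighted a₀ γ t) ≤
      ‖β - γ‖ * √(∑' k, (modeWeight k)⁻¹ ^ 2) := by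
  rw [← sqrt_tsum_const_mul_inv_modeWeight_sq (norm_nonneg _)]
  refine l2Norm_le_of_le (summable_const_mul_inv_modeWeight_sq _) fun k => ?_
  have h : (seqOfWeighted a₀ β t - seqOfWeighted a₀ γ t) k =
      (β - γ) (k, t) * (((modeWeight k)⁻¹ : ℝ) : ℂ) := by
    simp only [seqOfWeighted, Pi.sub_apply, BoundedContinuousFunction.coe_sub]; ring
  rw [h, norm_mul, Complex.norm_real, Real.norm_eq_abs,
    abs_of_nonneg (inv_nonneg.2 (modeWeight_nonneg k))]
  exact mul_le_mul_of_nonneg_right ((β - γ).norm_coe_le_norm _)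
    (inv_nonneg.2 (modeWeight_nonneg k))

theorem continuous_seqOfWeighted (k : ℤ) : Continuous fun t => seqOfWeighted a₀ β t k := by
  unfold seqOfWeighted
  fun_prop

theorem continuous_seqConv_seqOfWeighted (ha₀ : SqSummable a₀) (k : ℤ) :
    Continuous fun t => seqConv (seqOfWeighted a₀ β t) (seqOfWeighted a₀ β t) k := by
  rw [← continuousOn_univ]
  have hA := summable_add_sq ha₀ (summable_const_mul_inv_modeWeight_sq ‖β‖)
  exact continuousOn_seqConv hA hA (fun t _ => norm_seqOfWeighted_le β t)
    (fun t _ => norm_seqOfWeighted_le β t)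
    (fun k => (continuous_seqOfWeighted β k).continuousOn)
    (fun k => (continuous_seqOfWeighted β k).continuousOn) k

/-- Clamping time to `[0, τ]` keeps the image of the Picard map bounded on the whole line. -/
theorem clamp_mem {τ : ℝ} (hτ : 0 ≤ τ) (t : ℝ) : max 0 (min t τ) ∈ Icc 0 τ :=
  ⟨le_max_left _ _, max_le hτ (min_le_right _ _)⟩

theorem modeWeight_mul_norm_duhamel_seqConv_le (ha₀ : SqSummable a₀) {τ t : ℝ}
    (ht : t ∈ Icc 0 τ) (k : ℤ) :
    modeWeight k * ‖duhamel k
      (fun s => seqConv (seqOfWeighted a₀ β s) (seqOfWeighted a₀ β s) k) t‖ ≤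
      (l2Norm a₀ + ‖β‖ * √(∑' k, (modeWeight k)⁻¹ ^ 2)) ^ 2 * τ ^ (1 / 16 : ℝ) := by
  refine modeWeight_mul_norm_duhamel_le k (continuous_seqConv_seqOfWeighted β ha₀ k)
    (sq_nonneg _) (fun s _ => ?_) ht
  have hs := sqSummable_seqOfWeighted β ha₀ s
  have h := l2Norm_seqOfWeighted_le β ha₀ s
  rw [sq]
  exact (norm_seqConv_le hs hs k).trans (mul_le_mul h h (l2Norm_nonneg _)
    ((l2Norm_nonneg _).trans h))

/-- The Picard map of the coefficient equation on `[0, τ]`, in weighted unknowns. -/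
noncomputable def picard (ha₀ : SqSummable a₀) {τ : ℝ} (hτ : 0 ≤ τ) :
    BoundedContinuousFunction (ℤ × ℝ) ℂ :=
  BoundedContinuousFunction.ofNormedAddCommGroup
    (fun p : ℤ × ℝ => ((modeWeight p.1 : ℝ) : ℂ) * duhamel p.1
      (fun s => seqConv (seqOfWeighted a₀ β s) (seqOfWeighted a₀ β s) p.1) (max 0 (min p.2 τ)))
    (by
      -- The integers are discrete, so joint continuity is continuity in time of each mode.
      rw [continuous_prod_of_discrete_left]
      intro k
      have h : Continuous (duhamel k
          (fun s => seqConv (seqOfWeighted a₀ β s) (seqOfWeighted a₀ β s) k)) :=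
        continuous_iff_continuousAt.2 fun t =>
          (hasDerivAt_duhamel k (continuous_seqConv_seqOfWeighted β ha₀ k) t).continuousAt
      have h' : Continuous fun t : ℝ => max 0 (min t τ) := by fun_prop
      have h2 := (continuous_const (y := ((modeWeight k : ℝ) : ℂ))).mul (h.comp h')
      exact h2)
    ((l2Norm a₀ + ‖β‖ * √(∑' k, (modeWeight k)⁻¹ ^ 2)) ^ 2 * τ ^ (1 / 16 : ℝ))
    (fun p => by
      rw [norm_mul, Complex.norm_real, Real.norm_eq_abs, abs_of_nonneg (modeWeight_nonneg _)]
      exact modeWeight_mul_norm_duhamel_seqConv_le β ha₀ (clamp_mem hτ _) _)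

theorem picard_apply (ha₀ : SqSummable a₀) {τ : ℝ} (hτ : 0 ≤ τ) (k : ℤ) (t : ℝ) :
    picard β ha₀ hτ (k, t) = ((modeWeight k : ℝ) : ℂ) * duhamel k
      (fun s => seqConv (seqOfWeighted a₀ β s) (seqOfWeighted a₀ β s) k) (max 0 (min t τ)) := rfl

theorem norm_picard_le (ha₀ : SqSummable a₀) {τ : ℝ} (hτ : 0 ≤ τ) :
    ‖picard β ha₀ hτ‖ ≤
      (l2Norm a₀ + ‖β‖ * √(∑' k, (modeWeight k)⁻¹ ^ 2)) ^ 2 * τ ^ (1 / 16 : ℝ) :=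
  BoundedContinuousFunction.norm_ofNormedAddCommGroup_le _ (by positivity) _

theorem norm_picard_sub_le (ha₀ : SqSummable a₀) {τ R : ℝ} (hτ : 0 ≤ τ) (hβ : ‖β‖ ≤ R)
    (hγ : ‖γ‖ ≤ R) :
    ‖picard β ha₀ hτ - picard γ ha₀ hτ‖ ≤
      √(∑' k, (modeWeight k)⁻¹ ^ 2) * (2 * (l2Norm a₀ + R * √(∑' k, (modeWeight k)⁻¹ ^ 2))) *
        τ ^ (1 / 16 : ℝ) * ‖β - γ‖ := by
  set W := √(∑' k, (modeWeight k)⁻¹ ^ 2) with hW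
  have hW0 : 0 ≤ W := Real.sqrt_nonneg _
  have hR : 0 ≤ R := (norm_nonneg _).trans hβ
  have hN := l2Norm_nonneg a₀
  rw [BoundedContinuousFunction.norm_le (by positivity)]
  rintro ⟨k, t⟩
  rw [BoundedContinuousFunction.coe_sub, Pi.sub_apply, picard_apply, picard_apply, ← mul_sub,
    ← duhamel_sub k (continuous_seqConv_seqOfWeighted β ha₀ k)
      (continuous_seqConv_seqOfWeighted γ ha₀ k), norm_mul, Complex.norm_real, Real.norm_eq_abs,
    abs_of_nonneg (modeWeight_nonneg _)]
  refine (modeWeight_mul_norm_duhamel_le k (F := ‖β - γ‖ * W * (2 * (l2Norm a₀ + R * W)))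
    ((continuous_seqConv_seqOfWeighted β ha₀ k).sub (continuous_seqConv_seqOfWeighted γ ha₀ k))
    (by positivity) (fun s _ => ?_) (clamp_mem hτ t)).trans (le_of_eq (by ring))
  have hβs := sqSummable_seqOfWeighted β ha₀ s
  have hγs := sqSummable_seqOfWeighted γ ha₀ s
  refine (norm_seqConv_self_sub_le hβs hγs k).trans ?_
  have h1 : l2Norm (seqOfWeighted a₀ β s) ≤ l2Norm a₀ + R * W :=
    (l2Norm_seqOfWeighted_le β ha₀ s).trans (by gcongr)
  have h2 : l2Norm (seqOfWeighted a₀ γ s) ≤ l2Norm a₀ + R * W :=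
    (l2Norm_seqOfWeighted_le γ ha₀ s).trans (by gcongr)
  exact mul_le_mul (l2Norm_seqOfWeighted_sub_le β γ s) (by linarith)
    (add_nonneg (l2Norm_nonneg _) (l2Norm_nonneg _)) (by positivity)

/-- At a fixed point the weight cancels and Duhamel's formula remains on `[0, τ]`; in mode zero,
where the weight vanishes, the Duhamel term vanishes as well. -/
theorem SeqSol.of_picard_eq (ha₀ : SqSummable a₀) (h₀ : a₀ 0 = 0) {τ : ℝ} (hτ : 0 ≤ τ)
    (hβ : picard β ha₀ hτ = β) :
    seqOfWeighted a₀ β 0 = a₀ ∧ SeqSol τ (seqOfWeighted a₀ β) := by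
  have hval : ∀ t ∈ Icc 0 τ, ∀ k, seqOfWeighted a₀ β t k =
      ((rexp (-((k : ℝ) ^ 4 * t)) : ℝ) : ℂ) * a₀ k +
        duhamel k (fun s => seqConv (seqOfWeighted a₀ β s) (seqOfWeighted a₀ β s) k) t := by
    intro t ht k
    conv_lhs => rw [seqOfWeighted, ← hβ, picard_apply, min_eq_left ht.2, max_eq_right ht.1,
      abs_of_nonneg ht.1]
    rcases eq_or_ne k 0 with rfl | hk
    · simp
    · have : ((modeWeight k : ℝ) : ℂ) ≠ 0 := by exact_mod_cast (modeWeight_pos hk).ne'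
      push_cast
      field_simp
  refine ⟨funext fun k => by rw [hval 0 ⟨le_rfl, hτ⟩]; simp, fun t ht => ?_,
    ⟨_, summable_add_sq ha₀ (summable_const_mul_inv_modeWeight_sq ‖β‖),
      fun t _ k => norm_seqOfWeighted_le β t k⟩, fun k t ht => ?_⟩
  · rw [hval t ht]; simp [h₀]
  · have h1 := ((hasDerivAt_exp_const_mul (-(k : ℝ) ^ 4) t).ofReal_comp.mul_const (a₀ k)).add
      (hasDerivAt_duhamel k (continuous_seqConv_seqOfWeighted β ha₀ k) t)
    have h2 := (h1.hasDerivWithinAt (s := Icc 0 τ)).congr (f₁ := fun s => seqOfWeighted a₀ β s k)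
      (fun s hs => by rw [hval s hs]; simp) (by rw [hval t ht]; simp)
    refine h2.congr_deriv ?_
    rw [hval t ht]
    push_cast
    ring_nf

end Picard

/-- Contraction on the unit ball of the weighted unknowns. That `τ` depends on the bound `M` alone
is what allows continuation. -/
theorem SeqSol.exists_local {M : ℝ} (hM : 0 ≤ M) :
    ∃ τ, 0 < τ ∧ ∀ a₀ : ℤ → ℂ, SqSummable a₀ → a₀ 0 = 0 → l2Norm a₀ ≤ M →
      ∃ a, a 0 = a₀ ∧ SeqSol τ a := by
  set W := √(∑' k, (modeWeight k)⁻¹ ^ 2) with hW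
  have hW0 : 0 ≤ W := Real.sqrt_nonneg _
  -- `K` dominates both the self-map constant `(M + W)²` and the Lipschitz constant `2 W (M + W)`.
  -- With `τ = (1/(2K))¹⁶` the factor `τ^{1/16}` equals `1/(2K)`, which brings them below `1` and
  -- `1/2`.
  set K := (M + W) ^ 2 + W * (2 * (M + W)) + 1 with hK
  have hK0 : 0 < K := by positivity
  refine ⟨(1 / (2 * K)) ^ (16 : ℕ), by positivity, fun a₀ ha₀ h₀ haM => ?_⟩
  have hτ : (0 : ℝ) ≤ (1 / (2 * K)) ^ (16 : ℕ) := by positivity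
  have hroot : ((1 / (2 * K)) ^ (16 : ℕ)) ^ (1 / 16 : ℝ) = 1 / (2 * K) := by
    rw [← Real.rpow_natCast, ← Real.rpow_mul (by positivity)]
    norm_num
  have hN := l2Norm_nonneg a₀
  have hmaps : MapsTo (fun β => picard β ha₀ hτ)
      (Metric.closedBall (0 : BoundedContinuousFunction (ℤ × ℝ) ℂ) 1) (Metric.closedBall 0 1) := by
    intro β hβ
    rw [mem_closedBall_zero_iff] at hβ ⊢
    refine (norm_picard_le β ha₀ hτ).trans ?_
    rw [hroot, mul_one_div, div_le_one (by positivity)]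
    have h1 : l2Norm a₀ + ‖β‖ * W ≤ M + W := by nlinarith
    have h2 : (l2Norm a₀ + ‖β‖ * W) ^ 2 ≤ (M + W) ^ 2 :=
      pow_le_pow_left₀ (by positivity) h1 2
    nlinarith [mul_nonneg hW0 (add_nonneg hM hW0)]
  have hcontr : ContractingWith (1 / 2) (hmaps.restrict _ _ _) := by
    refine ⟨by norm_num, LipschitzWith.of_dist_le_mul fun β γ => ?_⟩
    have hβ := mem_closedBall_zero_iff.1 β.2
    have hγ := mem_closedBall_zero_iff.1 γ.2
    simp only [Subtype.dist_eq, MapsTo.val_restrict_apply, dist_eq_norm]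
    refine (norm_picard_sub_le _ _ ha₀ hτ hβ hγ).trans ?_
    refine mul_le_mul_of_nonneg_right ?_ (norm_nonneg _)
    rw [hroot, ← hW, one_mul, mul_one_div, div_le_iff₀ (by positivity)]
    have h1 : W * (2 * (l2Norm a₀ + W)) ≤ W * (2 * (M + W)) := by gcongr
    push_cast
    nlinarith [sq_nonneg (M + W)]
  obtain ⟨β, -, hβ, -⟩ := hcontr.exists_fixedPoint' Metric.isClosed_closedBall.isComplete hmaps
    (x := 0) (by simp) (edist_ne_top _ _)
  exact ⟨_, SeqSol.of_picard_eq β ha₀ h₀ hτ hβ⟩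

/-! ### Smoothing -/

/-- The term of index `⌈p⌉` in the exponential series at `k⁴ η` already dominates, as `|k| ≤ k⁴` for
nonzero integers. -/
theorem exists_rpow_mul_exp_neg_le {p η : ℝ} (hη : 0 < η) :
    ∃ C, 0 ≤ C ∧ ∀ k : ℤ, k ≠ 0 → |(k : ℝ)| ^ p * rexp (-((k : ℝ) ^ 4 * η)) ≤ C := by
  set n := ⌈p⌉₊ with hn
  refine ⟨n.factorial / η ^ n, by positivity, fun k hk => ?_⟩
  have hk1 : (1 : ℝ) ≤ |(k : ℝ)| := by exact_mod_cast Int.one_le_abs hk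
  have hk4 : |(k : ℝ)| ≤ (k : ℝ) ^ 4 := by
    rw [(Even.pow_abs (by decide) _).symm]
    exact le_self_pow₀ hk1 (by norm_num)
  have h1 : |(k : ℝ)| ^ p ≤ ((k : ℝ) ^ 4) ^ n := by
    calc |(k : ℝ)| ^ p ≤ |(k : ℝ)| ^ (n : ℝ) :=
          Real.rpow_le_rpow_of_exponent_le hk1 (Nat.le_ceil p)
      _ = |(k : ℝ)| ^ n := Real.rpow_natCast _ _
      _ ≤ _ := pow_le_pow_left₀ (abs_nonneg _) hk4 n
  have h2 := Real.pow_div_factorial_le_exp ((k : ℝ) ^ 4 * η) (by positivity) n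
  rw [div_le_iff₀ (by positivity), mul_pow] at h2
  rw [Real.exp_neg, le_div_iff₀ (by positivity), ← div_eq_mul_inv, div_mul_eq_mul_div,
    div_le_iff₀ (Real.exp_pos _)]
  calc |(k : ℝ)| ^ p * η ^ n ≤ ((k : ℝ) ^ 4) ^ n * η ^ n := by gcongr
    _ ≤ _ := by linarith

/-- One of two frequencies with sum `k` has size at least `|k| / 2`; this moves a weight inside a
convolution. -/
theorem abs_rpow_le_two_rpow_mul (k m : ℤ) {p : ℝ} (hp : 0 ≤ p) :
    |(k : ℝ)| ^ p ≤ 2 ^ p * (|(m : ℝ)| ^ p + |((k - m : ℤ) : ℝ)| ^ p) := by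
  have h : |(k : ℝ)| ≤ 2 * max |(m : ℝ)| |((k - m : ℤ) : ℝ)| := by
    have h1 : |(k : ℝ)| ≤ |(m : ℝ)| + |((k - m : ℤ) : ℝ)| := by
      have := abs_add_le (m : ℝ) ((k - m : ℤ) : ℝ)
      push_cast at this ⊢
      simpa using this
    linarith [le_max_left |(m : ℝ)| |((k - m : ℤ) : ℝ)|, le_max_right |(m : ℝ)| |((k - m : ℤ) : ℝ)|]
  refine (Real.rpow_le_rpow (abs_nonneg _) h hp).trans ?_
  rw [Real.mul_rpow (by norm_num) (by positivity)]
  refine mul_le_mul_of_nonneg_left ?_ (by positivity)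
  have h1 : 0 ≤ |(m : ℝ)| ^ p := by positivity
  have h2 : 0 ≤ |((k - m : ℤ) : ℝ)| ^ p := by positivity
  rcases max_cases |(m : ℝ)| |((k - m : ℤ) : ℝ)| with ⟨h, -⟩ | ⟨h, -⟩ <;> rw [h] <;> linarith

namespace SeqSol

variable {T : ℝ} {a : ℝ → ℤ → ℂ}

/-- Forcing `k³` against damping `k⁴` gains one power of `k`. The datum at time `η` is harmless
after a further time `η`, since `e^{-k⁴ η}` beats every power. -/
theorem coeff_decay_of_conv_decay (h : SeqSol T a) {ρ η C : ℝ} (hη : 0 < η) (hC : 0 ≤ C)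
    (hconv : ∀ t ∈ Icc η T, ∀ k : ℤ, |(k : ℝ)| ^ ρ * ‖seqConv (a t) (a t) k‖ ≤ C) :
    ∃ C', 0 ≤ C' ∧ ∀ t ∈ Icc (2 * η) T, ∀ k : ℤ, |(k : ℝ)| ^ (ρ + 1) * ‖a t k‖ ≤ C' := by
  obtain ⟨M, hM0, hM⟩ := h.exists_l2Norm_le
  obtain ⟨D, hD0, hD⟩ := exists_rpow_mul_exp_neg_le (p := ρ + 1) hη
  refine ⟨D * M + C, by positivity, fun t ht k => ?_⟩
  have hsub : Icc η T ⊆ Icc 0 T := Icc_subset_Icc_left hη.le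
  have htη : t ∈ Icc η T := ⟨by linarith [ht.1], ht.2⟩
  rcases eq_or_ne k 0 with rfl | hk
  · rw [h.zero_mode t (hsub htη), norm_zero, mul_zero]; positivity
  have hk0 : 0 < |(k : ℝ)| := abs_pos.2 (by exact_mod_cast hk)
  have hk4 : (k : ℝ) ^ 4 = |(k : ℝ)| ^ 4 := (Even.pow_abs (by decide) _).symm
  have hkpos : 0 < (k : ℝ) ^ 4 := by positivity
  have hρ : 0 < |(k : ℝ)| ^ ρ := by positivity
  have hρ1 : |(k : ℝ)| ^ (ρ + 1) = |(k : ℝ)| ^ ρ * |(k : ℝ)| := Real.rpow_add_one hk0.ne' ρ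
  have hb := norm_le_of_hasDerivWithinAt_linear (y := fun s => a s k) (t₀ := η) (t₁ := T)
    (f := fun s => Complex.I * (k : ℂ) ^ 3 * seqConv (a s) (a s) k)
    (F := |(k : ℝ)| ^ 3 * (C / |(k : ℝ)| ^ ρ)) hkpos
    (fun s hs => by
      have := (h.ode k s (hsub hs)).mono hsub
      push_cast; exact this)
    (fun s hs => by
      rw [norm_mul, norm_mul, Complex.norm_I, one_mul, norm_pow, Complex.norm_intCast]
      refine mul_le_mul_of_nonneg_left ?_ (by positivity)
      rw [le_div_iff₀ hρ, mul_comm]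
      exact hconv s hs k) htη
  have hηk : ‖a η k‖ ≤ M := (norm_le_l2Norm (h.sqSummable ⟨hη.le, htη.1.trans htη.2⟩) k).trans
    (hM η ⟨hη.le, htη.1.trans htη.2⟩)
  have hexp : rexp (-((k : ℝ) ^ 4 * (t - η))) ≤ rexp (-((k : ℝ) ^ 4 * η)) := by
    apply Real.exp_le_exp.2
    have : η ≤ t - η := by linarith [ht.1]
    nlinarith
  calc |(k : ℝ)| ^ (ρ + 1) * ‖a t k‖
      ≤ |(k : ℝ)| ^ (ρ + 1) * (rexp (-((k : ℝ) ^ 4 * η)) * M +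
          |(k : ℝ)| ^ 3 * (C / |(k : ℝ)| ^ ρ) / (k : ℝ) ^ 4) := by
        refine mul_le_mul_of_nonneg_left (hb.trans (add_le_add ?_ ?_)) (by positivity)
        · exact mul_le_mul hexp hηk (norm_nonneg _) (Real.exp_pos _).le
        · exact mul_le_of_le_one_right (by positivity)
            (by linarith [Real.exp_pos (-((k : ℝ) ^ 4 * (t - η)))])
    _ = |(k : ℝ)| ^ (ρ + 1) * rexp (-((k : ℝ) ^ 4 * η)) * M + C := by
        rw [hρ1, hk4]; field_simp
    _ ≤ _ := by
        have := hD k hk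
        gcongr

/-- Of the `ρ + 1` powers, `3/4` are spent on making `|m|^{ρ + 1/4} |a m|` square summable;
Cauchy–Schwarz against the other factor, bounded in `ℓ²`, then gives a net gain of `1/4`. -/
theorem conv_decay_of_coeff_decay (h : SeqSol T a) {ρ δ C : ℝ} (hρ : 0 ≤ ρ) (hδ : 0 < δ)
    (hC : 0 ≤ C) (hcoeff : ∀ t ∈ Icc δ T, ∀ k : ℤ, |(k : ℝ)| ^ (ρ + 1) * ‖a t k‖ ≤ C) :
    ∃ C', 0 ≤ C' ∧ ∀ t ∈ Icc δ T, ∀ k : ℤ,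
      |(k : ℝ)| ^ (ρ + 1 / 4) * ‖seqConv (a t) (a t) k‖ ≤ C' := by
  obtain ⟨M, hM0, hM⟩ := h.exists_l2Norm_le
  set W := √(∑' k, (modeWeight k)⁻¹ ^ 2) with hW
  have hW0 : 0 ≤ W := Real.sqrt_nonneg _
  set q := ρ + 1 / 4 with hq
  have hq0 : 0 ≤ q := by positivity
  refine ⟨2 ^ q * (2 * (C * W * M)), by positivity, fun t ht k => ?_⟩
  have ht0 : t ∈ Icc 0 T := ⟨hδ.le.trans ht.1, ht.2⟩
  have hle : ∀ m : ℤ, |(m : ℝ)| ^ q * ‖a t m‖ ≤ C * (modeWeight m)⁻¹ := by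
    intro m
    rcases eq_or_ne m 0 with rfl | hm
    · rw [h.zero_mode t ht0]; simp
    have hm0 : 0 < |(m : ℝ)| := abs_pos.2 (by exact_mod_cast hm)
    have h1 : |(m : ℝ)| ^ (ρ + 1) = |(m : ℝ)| ^ q * modeWeight m := by
      rw [modeWeight, ← Real.rpow_add hm0, hq]; ring_nf
    have h2 := hcoeff t ht m
    rw [h1] at h2
    rw [← div_eq_mul_inv, le_div_iff₀ (modeWeight_pos hm)]
    linarith
  have hsw : Summable fun m : ℤ => (|(m : ℝ)| ^ q * ‖a t m‖) ^ 2 := by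
    refine Summable.of_nonneg_of_le (fun _ => by positivity) (fun m => ?_)
      (summable_const_mul_inv_modeWeight_sq C)
    exact pow_le_pow_left₀ (by positivity) (hle m) 2
  have hwle : √(∑' m : ℤ, (|(m : ℝ)| ^ q * ‖a t m‖) ^ 2) ≤ C * W := by
    rw [hW, ← sqrt_tsum_const_mul_inv_modeWeight_sq hC]
    refine Real.sqrt_le_sqrt (hsw.tsum_le_tsum (fun m => ?_)
      (summable_const_mul_inv_modeWeight_sq C))
    exact pow_le_pow_left₀ (by positivity) (hle m) 2
  have hs := h.sqSummable ht0
  have hs' : Summable fun m : ℤ => ‖a t m‖ ^ 2 := hs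
  have s1 := summable_conv hsw hs' k
  have s2 := summable_conv hs' hsw k
  have b1 := tsum_conv_le (fun m : ℤ => by positivity) (fun m : ℤ => norm_nonneg (a t m)) hsw hs' k
  have b2 := tsum_conv_le (fun m : ℤ => norm_nonneg (a t m)) (fun m : ℤ => by positivity) hs' hsw k
  have hN : √(∑' m : ℤ, ‖a t m‖ ^ 2) ≤ M := hM t ht0
  calc |(k : ℝ)| ^ q * ‖seqConv (a t) (a t) k‖
      ≤ |(k : ℝ)| ^ q * ∑' m, ‖a t m‖ * ‖a t (k - m)‖ :=
        mul_le_mul_of_nonneg_left (norm_seqConv_le_tsum hs hs k) (by positivity)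
    _ = ∑' m, |(k : ℝ)| ^ q * (‖a t m‖ * ‖a t (k - m)‖) := tsum_mul_left.symm
    _ ≤ ∑' m : ℤ, 2 ^ q * (|(m : ℝ)| ^ q * ‖a t m‖ * ‖a t (k - m)‖ +
          ‖a t m‖ * (|((k - m : ℤ) : ℝ)| ^ q * ‖a t (k - m)‖)) := by
        refine Summable.tsum_le_tsum (fun m => ?_) ((summable_conv hs' hs' k).mul_left _)
          ((s1.add s2).mul_left _)
        have := abs_rpow_le_two_rpow_mul k m hq0
        calc _ ≤ 2 ^ q * (|(m : ℝ)| ^ q + |((k - m : ℤ) : ℝ)| ^ q) * (‖a t m‖ * ‖a t (k - m)‖) := by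
              gcongr
          _ = _ := by ring
    _ = 2 ^ q * (∑' m : ℤ, |(m : ℝ)| ^ q * ‖a t m‖ * ‖a t (k - m)‖ +
          ∑' m : ℤ, ‖a t m‖ * (|((k - m : ℤ) : ℝ)| ^ q * ‖a t (k - m)‖)) := by
        rw [tsum_mul_left, s1.tsum_add s2]
    _ ≤ 2 ^ q * (C * W * M + M * (C * W)) := by
        refine mul_le_mul_of_nonneg_left (add_le_add (b1.trans ?_) (b2.trans ?_)) (by positivity)
        · exact mul_le_mul hwle hN (Real.sqrt_nonneg _) (by positivity)
        · exact mul_le_mul hN hwle (Real.sqrt_nonneg _) hM0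
    _ = _ := by ring

/-- Each round gains a quarter power and doubles the starting time, so the induction hypothesis is
used from `δ / 2` on. -/
theorem conv_decay_quarter (h : SeqSol T a) (n : ℕ) : ∀ δ > 0, ∃ C, 0 ≤ C ∧ ∀ t ∈ Icc δ T,
    ∀ k : ℤ, |(k : ℝ)| ^ ((n : ℝ) * (1 / 4)) * ‖seqConv (a t) (a t) k‖ ≤ C := by
  induction n with
  | zero =>
    intro δ hδ
    obtain ⟨M, hM0, hM⟩ := h.exists_l2Norm_le
    refine ⟨M * M, by positivity, fun t ht k => ?_⟩
    have ht0 : t ∈ Icc 0 T := ⟨hδ.le.trans ht.1, ht.2⟩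
    have hs := h.sqSummable ht0
    simp only [Nat.cast_zero, zero_mul, Real.rpow_zero, one_mul]
    exact (norm_seqConv_le hs hs k).trans (mul_le_mul (hM t ht0) (hM t ht0) (l2Norm_nonneg _) hM0)
  | succ n ih =>
    intro δ hδ
    obtain ⟨C, hC0, hC⟩ := ih (δ / 2) (by positivity)
    obtain ⟨C', hC'0, hC'⟩ := h.coeff_decay_of_conv_decay (by positivity) hC0 hC
    rw [mul_div_cancel₀ δ two_ne_zero] at hC'
    obtain ⟨C'', hC''0, hC''⟩ := h.conv_decay_of_coeff_decay (by positivity) hδ hC'0 hC'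
    refine ⟨C'', hC''0, fun t ht k => ?_⟩
    have := hC'' t ht k
    rwa [show (n : ℝ) * (1 / 4) + 1 / 4 = ((n + 1 : ℕ) : ℝ) * (1 / 4) by push_cast; ring] at this

theorem conv_decay (h : SeqSol T a) (n : ℕ) {δ : ℝ} (hδ : 0 < δ) :
    ∃ C, 0 ≤ C ∧ ∀ t ∈ Icc δ T, ∀ k : ℤ, |(k : ℝ)| ^ n * ‖seqConv (a t) (a t) k‖ ≤ C := by
  obtain ⟨C, hC0, hC⟩ := h.conv_decay_quarter (4 * n) δ hδ
  refine ⟨C, hC0, fun t ht k => ?_⟩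
  have := hC t ht k
  rwa [show ((4 * n : ℕ) : ℝ) * (1 / 4) = n by push_cast; ring, Real.rpow_natCast] at this

theorem coeff_decay (h : SeqSol T a) (n : ℕ) {δ : ℝ} (hδ : 0 < δ) :
    ∃ C, 0 ≤ C ∧ ∀ t ∈ Icc δ T, ∀ k : ℤ, |(k : ℝ)| ^ n * ‖a t k‖ ≤ C := by
  obtain ⟨C, hC0, hC⟩ := h.conv_decay n (half_pos hδ)
  obtain ⟨C', hC'0, hC'⟩ := h.coeff_decay_of_conv_decay (ρ := n) (half_pos hδ) hC0
    (by simpa only [Real.rpow_natCast] using hC)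
  rw [mul_div_cancel₀ δ two_ne_zero] at hC'
  refine ⟨C', hC'0, fun t ht k => ?_⟩
  rcases eq_or_ne k 0 with rfl | hk
  · rw [h.zero_mode t ⟨hδ.le.trans ht.1, ht.2⟩]; simpa using hC'0
  · refine (mul_le_mul_of_nonneg_right ?_ (norm_nonneg _)).trans (hC' t ht k)
    rw [← Nat.cast_add_one, Real.rpow_natCast]
    exact pow_le_pow_right₀ (by exact_mod_cast Int.one_le_abs hk) (Nat.le_succ n)

end SeqSol

/-! ### The energy estimate and global existence -/

/-- Two copies of `ζ(2) = π²/6`, the term `k = 0` being zero. The constant in the smallness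
condition originates here. -/
theorem tsum_abs_int_inv_sq : ∑' k : ℤ, (|(k : ℝ)|⁻¹) ^ 2 = π ^ 2 / 3 := by
  have h := hasSum_zeta_two
  have h2 := HasSum.of_nat_of_neg (f := fun k : ℤ => (|(k : ℝ)|⁻¹) ^ 2) (g := π ^ 2 / 6)
    (g' := π ^ 2 / 6) (by simpa using h) (by simpa using h)
  rw [h2.tsum_eq]
  simp only [Int.cast_zero, abs_zero, inv_zero]; ring

theorem summable_of_sq_mul_le {x : ℤ → ℝ} {C : ℝ} (hx : ∀ k, 0 ≤ x k) (h0 : x 0 = 0)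
    (h : ∀ k : ℤ, |(k : ℝ)| ^ 2 * x k ≤ C) : Summable x := by
  refine Summable.of_nonneg_of_le hx (fun k => ?_) (summable_abs_int_inv_sq.mul_left C)
  rcases eq_or_ne k 0 with rfl | hk
  · simp [h0]
  · have : 0 < |(k : ℝ)| := abs_pos.2 (by exact_mod_cast hk)
    rw [inv_pow, ← div_eq_mul_inv, le_div_iff₀ (by positivity), mul_comm]
    exact h k

section Trilinear

variable {c : ℤ → ℂ} (hc0 : c 0 = 0) (hc : ∀ n : ℕ, ∃ C, ∀ k : ℤ, |(k : ℝ)| ^ n * ‖c k‖ ≤ C)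
include hc0 hc

theorem summable_pow_mul_norm (n : ℕ) : Summable fun k : ℤ => |(k : ℝ)| ^ n * ‖c k‖ := by
  obtain ⟨C, hC⟩ := hc (n + 2)
  refine summable_of_sq_mul_le (C := C) (fun k => by positivity) (by simp [hc0]) fun k => ?_
  refine (le_of_eq ?_).trans (hC k)
  ring

theorem summable_pow_mul_norm_sq (n : ℕ) :
    Summable fun k : ℤ => (|(k : ℝ)| ^ n * ‖c k‖) ^ 2 := by
  obtain ⟨C, hC⟩ := hc n
  refine Summable.of_nonneg_of_le (fun k => by positivity) (fun k => ?_)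
    ((summable_pow_mul_norm hc0 hc n).mul_left C)
  rw [sq]
  exact mul_le_mul_of_nonneg_right (hC k) (by positivity)

theorem sqSummable_of_decay : SqSummable c := by
  simpa [SqSummable] using summable_pow_mul_norm_sq hc0 hc 0

/-- Cauchy–Schwarz against `1/|m|`: the absolute Fourier sum of `u_xx` is controlled by the `ℓ²`
norm of the coefficients of `u_xxx`. -/
theorem tsum_abs_mul_norm_le :
    ∑' m : ℤ, |(m : ℝ)| * ‖c m‖ ≤ √(π ^ 2 / 3) * √(∑' k : ℤ, (|(k : ℝ)| ^ 2 * ‖c k‖) ^ 2) := by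
  rw [← tsum_abs_int_inv_sq]
  refine le_trans (le_of_eq (tsum_congr fun m => ?_)) (tsum_mul_le_sqrt_mul_sqrt
    (fun m : ℤ => inv_nonneg.2 (abs_nonneg (m : ℝ)))
    (fun m => by positivity) summable_abs_int_inv_sq (summable_pow_mul_norm_sq hc0 hc 2))
  rcases eq_or_ne m 0 with rfl | hm
  · simp
  · have : 0 < |(m : ℝ)| := abs_pos.2 (by exact_mod_cast hm)
    field_simp

/-- A discrete Leibniz rule: `|k| ≤ |m| + |k - m|`, and the two resulting sums coincide by symmetry.
-/
theorem abs_mul_norm_seqConv_le (k : ℤ) :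
    |(k : ℝ)| * ‖seqConv c c k‖ ≤ 2 * ∑' m : ℤ, |(m : ℝ)| * ‖c m‖ * ‖c (k - m)‖ := by
  have hs := sqSummable_of_decay hc0 hc
  have hs' : Summable fun m : ℤ => ‖c m‖ ^ 2 := hs
  have hw : Summable fun m : ℤ => (|(m : ℝ)| * ‖c m‖) ^ 2 := by
    simpa using summable_pow_mul_norm_sq hc0 hc 1
  have s1 := summable_conv hw hs' k
  have s2 := summable_conv hs' hw k
  have hswap : ∑' m : ℤ, ‖c m‖ * (|((k - m : ℤ) : ℝ)| * ‖c (k - m)‖) =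
      ∑' m : ℤ, |(m : ℝ)| * ‖c m‖ * ‖c (k - m)‖ := by
    rw [← (Equiv.subLeft k).tsum_eq]
    refine tsum_congr fun m => ?_
    simp only [Equiv.subLeft_apply, sub_sub_cancel]
    ring
  calc |(k : ℝ)| * ‖seqConv c c k‖ ≤ |(k : ℝ)| * ∑' m, ‖c m‖ * ‖c (k - m)‖ :=
        mul_le_mul_of_nonneg_left (norm_seqConv_le_tsum hs hs k) (abs_nonneg _)
    _ = ∑' m, |(k : ℝ)| * (‖c m‖ * ‖c (k - m)‖) := tsum_mul_left.symm
    _ ≤ ∑' m : ℤ, (|(m : ℝ)| * ‖c m‖ * ‖c (k - m)‖ +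
          ‖c m‖ * (|((k - m : ℤ) : ℝ)| * ‖c (k - m)‖)) := by
        refine Summable.tsum_le_tsum (fun m => ?_) ((summable_conv hs' hs' k).mul_left _)
          (s1.add s2)
        have h1 : |(k : ℝ)| ≤ |(m : ℝ)| + |((k - m : ℤ) : ℝ)| := by
          have := abs_add_le (m : ℝ) ((k - m : ℤ) : ℝ)
          push_cast at this ⊢
          simpa using this
        calc _ ≤ (|(m : ℝ)| + |((k - m : ℤ) : ℝ)|) * (‖c m‖ * ‖c (k - m)‖) := by gcongr
          _ = _ := by ring
    _ = _ := by rw [s1.tsum_add s2, hswap]; ring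

/-- Absolute convergence of the double series, needed to exchange the order of summation: the
factors in `p.1` and `p.2` are summable and the third is bounded. -/
theorem summable_trilinear : Summable fun p : ℤ × ℤ =>
    |(p.1 : ℝ)| ^ 2 * ‖c p.1‖ * (|(p.2 : ℝ)| * ‖c p.2‖ * ‖c (p.1 - p.2)‖) := by
  have hA := summable_pow_mul_norm hc0 hc 2
  have hB := summable_pow_mul_norm hc0 hc 1
  obtain ⟨C, hC⟩ := hc 0
  have hAB := (hA.mul_of_nonneg hB (fun k => by dsimp only [Pi.zero_apply]; positivity)
    (fun k => by dsimp only [Pi.zero_apply]; positivity)).mul_left C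
  refine Summable.of_nonneg_of_le (fun p => by positivity) (fun p => ?_) hAB
  have h1 := mul_le_mul_of_nonneg_right (hC (p.1 - p.2))
    (by positivity : 0 ≤ |(p.1 : ℝ)| ^ 2 * ‖c p.1‖ * (|(p.2 : ℝ)| ^ 1 * ‖c p.2‖))
  refine le_trans (le_of_eq ?_) h1
  ring

theorem tsum_mul_shift_le (m : ℤ) :
    ∑' k : ℤ, |(k : ℝ)| ^ 2 * ‖c k‖ * (|(m : ℝ)| * ‖c m‖ * ‖c (k - m)‖) ≤
      |(m : ℝ)| * ‖c m‖ * (√(∑' k : ℤ, (|(k : ℝ)| ^ 2 * ‖c k‖) ^ 2) * l2Norm c) := by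
  have hs : Summable fun m : ℤ => ‖c m‖ ^ 2 := sqSummable_of_decay hc0 hc
  have hsm : Summable fun k : ℤ => ‖c (k - m)‖ ^ 2 := (Equiv.subRight m).summable_iff.2 hs
  have hsm' : ∑' k : ℤ, ‖c (k - m)‖ ^ 2 = ∑' k : ℤ, ‖c k‖ ^ 2 :=
    (Equiv.subRight m).tsum_eq fun k => ‖c k‖ ^ 2
  have h := tsum_mul_le_sqrt_mul_sqrt (f := fun k : ℤ => |(k : ℝ)| ^ 2 * ‖c k‖)
    (g := fun k : ℤ => ‖c (k - m)‖) (fun k => by positivity)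
    (fun k => norm_nonneg (c (k - m))) (summable_pow_mul_norm_sq hc0 hc 2) hsm
  rw [hsm'] at h
  have e : ∀ k : ℤ, |(k : ℝ)| ^ 2 * ‖c k‖ * (|(m : ℝ)| * ‖c m‖ * ‖c (k - m)‖) =
      |(m : ℝ)| * ‖c m‖ * (|(k : ℝ)| ^ 2 * ‖c k‖ * ‖c (k - m)‖) := fun k => by ring
  rw [tsum_congr e, tsum_mul_left]
  exact mul_le_mul_of_nonneg_left h (by positivity)

/-- Summing over `k` first, with `m` fixed, costs one Cauchy–Schwarz inequality; the remaining sum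
over `m` is that of `tsum_abs_mul_norm_le`. -/
theorem tsum_mul_tsum_conv_le :
    (Summable fun k : ℤ => |(k : ℝ)| ^ 2 * ‖c k‖ * ∑' m : ℤ, |(m : ℝ)| * ‖c m‖ * ‖c (k - m)‖) ∧
    ∑' k : ℤ, |(k : ℝ)| ^ 2 * ‖c k‖ * ∑' m : ℤ, |(m : ℝ)| * ‖c m‖ * ‖c (k - m)‖ ≤
      √(π ^ 2 / 3) * l2Norm c * ∑' k : ℤ, (|(k : ℝ)| ^ 2 * ‖c k‖) ^ 2 := by
  have hprod := summable_trilinear hc0 hc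
  have hB : Summable fun m : ℤ => |(m : ℝ)| * ‖c m‖ := by
    simpa using summable_pow_mul_norm hc0 hc 1
  have hfun : (fun k : ℤ => |(k : ℝ)| ^ 2 * ‖c k‖ * ∑' m : ℤ, |(m : ℝ)| * ‖c m‖ * ‖c (k - m)‖) =
      fun k : ℤ => ∑' m : ℤ, |(k : ℝ)| ^ 2 * ‖c k‖ * (|(m : ℝ)| * ‖c m‖ * ‖c (k - m)‖) :=
    funext fun k => tsum_mul_left.symm
  rw [hfun]
  have hp1 : Summable fun k : ℤ => ∑' m : ℤ,
      |(k : ℝ)| ^ 2 * ‖c k‖ * (|(m : ℝ)| * ‖c m‖ * ‖c (k - m)‖) := hprod.prod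
  have hp2 : Summable fun m : ℤ => ∑' k : ℤ,
      |(k : ℝ)| ^ 2 * ‖c k‖ * (|(m : ℝ)| * ‖c m‖ * ‖c (k - m)‖) := hprod.prod_symm.prod
  have hcomm : ∑' k : ℤ, ∑' m : ℤ, |(k : ℝ)| ^ 2 * ‖c k‖ * (|(m : ℝ)| * ‖c m‖ * ‖c (k - m)‖) =
      ∑' m : ℤ, ∑' k : ℤ, |(k : ℝ)| ^ 2 * ‖c k‖ * (|(m : ℝ)| * ‖c m‖ * ‖c (k - m)‖) :=
    (Summable.tsum_comm (f := fun m k : ℤ =>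
      |(k : ℝ)| ^ 2 * ‖c k‖ * (|(m : ℝ)| * ‖c m‖ * ‖c (k - m)‖)) hprod.prod_symm)
  refine ⟨hp1, ?_⟩
  set X := √(∑' k : ℤ, (|(k : ℝ)| ^ 2 * ‖c k‖) ^ 2) with hX
  have hX2 : ∑' k : ℤ, (|(k : ℝ)| ^ 2 * ‖c k‖) ^ 2 = X ^ 2 :=
    (Real.sq_sqrt (tsum_nonneg fun k => sq_nonneg _)).symm
  have h1 : ∑' m : ℤ, ∑' k : ℤ, |(k : ℝ)| ^ 2 * ‖c k‖ * (|(m : ℝ)| * ‖c m‖ * ‖c (k - m)‖) ≤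
      ∑' m : ℤ, |(m : ℝ)| * ‖c m‖ * (X * l2Norm c) :=
    Summable.tsum_le_tsum (tsum_mul_shift_le hc0 hc) hp2 (hB.mul_right _)
  rw [tsum_mul_right] at h1
  have h2 := mul_le_mul_of_nonneg_right (tsum_abs_mul_norm_le hc0 hc)
    (mul_nonneg (Real.sqrt_nonneg (∑' k : ℤ, (|(k : ℝ)| ^ 2 * ‖c k‖) ^ 2)) (l2Norm_nonneg c))
  rw [← hX] at h2
  rw [hcomm, hX2]
  refine h1.trans (h2.trans (le_of_eq ?_))
  ring

/-- One of the three powers of `k` goes to the convolution, the other two stay on `c`. The cubic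
term is thus the dissipation times a multiple of the `ℓ²` norm, hence absorbed when that norm is
small. -/
theorem trilinear_le :
    (Summable fun k : ℤ => |(k : ℝ)| ^ 3 * ‖c k‖ * ‖seqConv c c k‖) ∧
    ∑' k : ℤ, |(k : ℝ)| ^ 3 * ‖c k‖ * ‖seqConv c c k‖ ≤
      2 * (√(π ^ 2 / 3) * l2Norm c * ∑' k : ℤ, (|(k : ℝ)| ^ 2 * ‖c k‖) ^ 2) := by
  obtain ⟨hsum, hle⟩ := tsum_mul_tsum_conv_le hc0 hc
  have hpt : ∀ k : ℤ, |(k : ℝ)| ^ 3 * ‖c k‖ * ‖seqConv c c k‖ ≤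
      2 * (|(k : ℝ)| ^ 2 * ‖c k‖ * ∑' m : ℤ, |(m : ℝ)| * ‖c m‖ * ‖c (k - m)‖) := fun k => by
    have := mul_le_mul_of_nonneg_left (abs_mul_norm_seqConv_le hc0 hc k)
      (by positivity : 0 ≤ |(k : ℝ)| ^ 2 * ‖c k‖)
    calc _ = |(k : ℝ)| ^ 2 * ‖c k‖ * (|(k : ℝ)| * ‖seqConv c c k‖) := by ring
      _ ≤ _ := this
      _ = _ := by ring
  have h1 := Summable.of_nonneg_of_le (fun k => by positivity) hpt (hsum.mul_left 2)
  refine ⟨h1, (h1.tsum_le_tsum hpt (hsum.mul_left 2)).trans ?_⟩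
  rw [tsum_mul_left]
  exact mul_le_mul_of_nonneg_left hle (by norm_num)

end Trilinear

/-! ### Energy decay and continuation of small solutions -/

namespace SeqSol

variable {T : ℝ} {a : ℝ → ℤ → ℂ}

theorem decay_at (h : SeqSol T a) {t : ℝ} (ht : t ∈ Ioc 0 T) (n : ℕ) :
    ∃ C, ∀ k : ℤ, |(k : ℝ)| ^ n * ‖a t k‖ ≤ C := by
  obtain ⟨C, -, hC⟩ := h.coeff_decay n ht.1
  exact ⟨C, fun k => hC t ⟨le_rfl, ht.2⟩ k⟩

theorem hasDerivAt_coeff (h : SeqSol T a) (k : ℤ) {t : ℝ} (ht : t ∈ Ioo 0 T) :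
    HasDerivAt (fun s => a s k)
      (-(k : ℂ) ^ 4 * a t k + Complex.I * (k : ℂ) ^ 3 * seqConv (a t) (a t) k) t :=
  (h.ode k t (Ioo_subset_Icc_self ht)).hasDerivAt (Icc_mem_nhds ht.1 ht.2)

theorem norm_rhs_le (c N : ℂ) (k : ℤ) :
    ‖-(k : ℂ) ^ 4 * c + Complex.I * (k : ℂ) ^ 3 * N‖ ≤
      |(k : ℝ)| ^ 4 * ‖c‖ + |(k : ℝ)| ^ 3 * ‖N‖ := by
  refine (norm_add_le _ _).trans (le_of_eq ?_)
  simp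

/-- Termwise differentiation, legitimate at positive times by smoothing: six powers of decay for `a`
and five for `a ∗ a` leave a summable `k⁻²` after the factors `k⁴` and `k³`. -/
theorem hasDerivAt_energy (h : SeqSol T a) {t : ℝ} (ht : t ∈ Ioo 0 T) :
    (Summable fun k : ℤ => 2 * inner ℝ (a t k)
      (-(k : ℂ) ^ 4 * a t k + Complex.I * (k : ℂ) ^ 3 * seqConv (a t) (a t) k)) ∧
    HasDerivAt (fun s => ∑' k, ‖a s k‖ ^ 2) (∑' k : ℤ, 2 * inner ℝ (a t k)
      (-(k : ℂ) ^ 4 * a t k + Complex.I * (k : ℂ) ^ 3 * seqConv (a t) (a t) k)) t := by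
  obtain ⟨M, hM0, hM⟩ := h.exists_l2Norm_le
  obtain ⟨C₆, hC₆0, hC₆⟩ := h.coeff_decay 6 (half_pos ht.1)
  obtain ⟨C₅, hC₅0, hC₅⟩ := h.conv_decay 5 (half_pos ht.1)
  have hsub : Ioo (t / 2) T ⊆ Ioo 0 T := Ioo_subset_Ioo_left (half_pos ht.1).le
  have htm : t ∈ Ioo (t / 2) T := ⟨by linarith [ht.1], ht.2⟩
  have hbd : ∀ (k : ℤ), ∀ s ∈ Ioo (t / 2) T, ‖2 * inner ℝ (a s k)
      (-(k : ℂ) ^ 4 * a s k + Complex.I * (k : ℂ) ^ 3 * seqConv (a s) (a s) k)‖ ≤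
      2 * M * (C₆ + C₅) * (|(k : ℝ)|⁻¹) ^ 2 := by
    intro k s hs
    have hs0 : s ∈ Icc 0 T := Ioo_subset_Icc_self (hsub hs)
    have hs1 : s ∈ Icc (t / 2) T := Ioo_subset_Icc_self hs
    rcases eq_or_ne k 0 with rfl | hk
    · simp [h.zero_mode s hs0]
    have hk0 : 0 < |(k : ℝ)| := abs_pos.2 (by exact_mod_cast hk)
    have h1 : ‖a s k‖ ≤ M := (norm_le_l2Norm (h.sqSummable hs0) k).trans (hM s hs0)
    have h2 := norm_rhs_le (a s k) (seqConv (a s) (a s) k) k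
    have h3 : |(k : ℝ)| ^ 4 * ‖a s k‖ + |(k : ℝ)| ^ 3 * ‖seqConv (a s) (a s) k‖ ≤
        (C₆ + C₅) * (|(k : ℝ)|⁻¹) ^ 2 := by
      rw [inv_pow, ← div_eq_mul_inv, le_div_iff₀ (by positivity)]
      have e1 := hC₆ s hs1 k
      have e2 := hC₅ s hs1 k
      linarith
    rw [norm_mul, Real.norm_eq_abs, abs_two]
    have h4 := (norm_inner_le_norm (𝕜 := ℝ) (a s k)
      (-(k : ℂ) ^ 4 * a s k + Complex.I * (k : ℂ) ^ 3 * seqConv (a s) (a s) k)).trans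
      (mul_le_mul h1 (h2.trans h3) (norm_nonneg _) hM0)
    linarith
  have hsum : Summable fun k : ℤ => 2 * M * (C₆ + C₅) * (|(k : ℝ)|⁻¹) ^ 2 :=
    summable_abs_int_inv_sq.mul_left _
  refine ⟨Summable.of_norm_bounded hsum fun k => hbd k t htm, ?_⟩
  exact hasDerivAt_tsum_of_isPreconnected hsum isOpen_Ioo isPreconnected_Ioo
    (g := fun k s => ‖a s k‖ ^ 2)
    (fun k s hs => (h.hasDerivAt_coeff k (hsub hs)).norm_sq) hbd htm
    (h.sqSummable (Ioo_subset_Icc_self ht)) htm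

/-- The dissipation contributes `-2 S` and the nonlinearity at most `4 √(π²/3) ‖a‖ S`. Strictness
needs `S > 0`, which follows from `S ≥ ‖a‖²`, a Poincaré inequality due to the missing zero mode. -/
theorem energy_deriv_neg (h : SeqSol T a) {t : ℝ} (ht : t ∈ Ioo 0 T)
    (hpos : 0 < l2Norm (a t)) (hsmall : 2 * √(π ^ 2 / 3) * l2Norm (a t) < 1) :
    ∑' k : ℤ, 2 * inner ℝ (a t k)
      (-(k : ℂ) ^ 4 * a t k + Complex.I * (k : ℂ) ^ 3 * seqConv (a t) (a t) k) < 0 := by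
  have hc0 := h.zero_mode t (Ioo_subset_Icc_self ht)
  have hc := h.decay_at (Ioo_subset_Ioc_self ht)
  obtain ⟨hs3, hle⟩ := trilinear_le hc0 hc
  have hA2 := summable_pow_mul_norm_sq hc0 hc 2
  set S := ∑' k : ℤ, (|(k : ℝ)| ^ 2 * ‖a t k‖) ^ 2 with hS
  have hSpos : 0 < S := by
    have h1 : ∑' k : ℤ, ‖a t k‖ ^ 2 ≤ S := by
      refine Summable.tsum_le_tsum (fun k => ?_) (h.sqSummable (Ioo_subset_Icc_self ht)) hA2
      rcases eq_or_ne k 0 with rfl | hk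
      · simp [hc0]
      · refine pow_le_pow_left₀ (norm_nonneg _) (le_mul_of_one_le_left (norm_nonneg _) ?_) 2
        exact one_le_pow₀ (by exact_mod_cast Int.one_le_abs hk)
    rw [← l2Norm_sq] at h1
    exact (pow_pos hpos 2).trans_le h1
  have hpt : ∀ k : ℤ, 2 * inner ℝ (a t k)
      (-(k : ℂ) ^ 4 * a t k + Complex.I * (k : ℂ) ^ 3 * seqConv (a t) (a t) k) ≤
      2 * (|(k : ℝ)| ^ 3 * ‖a t k‖ * ‖seqConv (a t) (a t) k‖) -
        2 * (|(k : ℝ)| ^ 2 * ‖a t k‖) ^ 2 := by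
    intro k
    have e1 : inner ℝ (a t k) (-(k : ℂ) ^ 4 * a t k) = -(|(k : ℝ)| ^ 2 * ‖a t k‖) ^ 2 := by
      have : -(k : ℂ) ^ 4 * a t k = (-(k : ℝ) ^ 4 : ℝ) • a t k := by
        rw [Complex.real_smul]; push_cast; ring
      rw [this, real_inner_smul_right, real_inner_self_eq_norm_sq, mul_pow, ← pow_mul,
        Even.pow_abs (by decide)]
      ring
    have e2 := real_inner_le_norm (a t k) (Complex.I * (k : ℂ) ^ 3 * seqConv (a t) (a t) k)
    rw [norm_mul, norm_mul, Complex.norm_I, one_mul, norm_pow, Complex.norm_intCast] at e2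
    rw [inner_add_right, e1]
    linarith
  have hsr : Summable fun k : ℤ => 2 * (|(k : ℝ)| ^ 3 * ‖a t k‖ * ‖seqConv (a t) (a t) k‖) -
        2 * (|(k : ℝ)| ^ 2 * ‖a t k‖) ^ 2 := (hs3.mul_left 2).sub (hA2.mul_left 2)
  have h1 := (h.hasDerivAt_energy ht).1.tsum_le_tsum hpt hsr
  rw [(hs3.mul_left 2).tsum_sub (hA2.mul_left 2), tsum_mul_left (a := (2 : ℝ))
    (f := fun k : ℤ => |(k : ℝ)| ^ 3 * ‖a t k‖ * ‖seqConv (a t) (a t) k‖),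
    tsum_mul_left (a := (2 : ℝ)) (f := fun k : ℤ => (|(k : ℝ)| ^ 2 * ‖a t k‖) ^ 2)] at h1
  have h2 := mul_lt_mul_of_pos_right hsmall hSpos
  refine h1.trans_lt ?_
  rw [← hS]
  linarith

theorem continuousOn_energy (h : SeqSol T a) :
    ContinuousOn (fun t => ∑' k, ‖a t k‖ ^ 2) (Icc 0 T) := by
  obtain ⟨A, hA, hle⟩ := h.dominated
  refine continuousOn_tsum (fun k => (h.continuousOn k).norm.pow 2) hA fun k t ht => ?_
  rw [norm_pow, norm_norm]
  exact pow_le_pow_left₀ (norm_nonneg _) (hle t ht k) 2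

theorem continuousOn_l2Norm (h : SeqSol T a) :
    ContinuousOn (fun t => l2Norm (a t)) (Icc 0 T) :=
  h.continuousOn_energy.sqrt

/-- Small `ℓ²` norm is preserved by the evolution. -/
theorem l2Norm_lt (h : SeqSol T a) {r : ℝ} (hr : 2 * √(π ^ 2 / 3) * r ≤ 1)
    (h0 : l2Norm (a 0) < r) : ∀ t ∈ Icc 0 T, l2Norm (a t) < r := by
  intro t ht
  obtain ⟨q, hq0, hqr⟩ := exists_between h0
  have hqpos : 0 < q := (l2Norm_nonneg _).trans_lt hq0
  rcases ht.1.eq_or_lt with rfl | htpos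
  · exact h0
  have hT0 : (0 : ℝ) ∈ Icc 0 T := ⟨le_rfl, ht.1.trans ht.2⟩
  have hev : ∀ᶠ s in 𝓝[Icc 0 T] 0, l2Norm (a s) < q :=
    (h.continuousOn_l2Norm 0 hT0).eventually (gt_mem_nhds hq0)
  rw [nhdsWithin_Icc_eq_nhdsGE (htpos.trans_le ht.2)] at hev
  -- The energy is known to be differentiable only at positive times; continuity at `0` provides a
  -- positive starting time at which the norm is still below `q`.
  obtain ⟨δ, ⟨hδ0, hδt⟩, hδ⟩ : ∃ δ, δ ∈ Ioc 0 t ∧ l2Norm (a δ) < q := by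
    have h1 : ∀ᶠ s in 𝓝[>] (0 : ℝ), l2Norm (a s) < q :=
      hev.filter_mono (nhdsWithin_mono _ Ioi_subset_Ici_self)
    have h2 : ∀ᶠ s in 𝓝[>] (0 : ℝ), s ∈ Ioc 0 t := Ioc_mem_nhdsGT htpos
    exact (h2.and h1).exists
  have hκ : 0 < √(π ^ 2 / 3) := by positivity
  have hE : ∀ s, l2Norm (a s) ^ 2 = ∑' k, ‖a s k‖ ^ 2 := fun s => l2Norm_sq _
  -- The barrier is the constant `q²`: at a time of contact the norm is `q < r`, so the energy
  -- strictly decreases and cannot cross.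
  have key := image_le_of_deriv_right_lt_deriv_boundary (f := fun s => ∑' k, ‖a s k‖ ^ 2)
    (f' := fun s => ∑' k : ℤ, 2 * inner ℝ (a s k)
      (-(k : ℂ) ^ 4 * a s k + Complex.I * (k : ℂ) ^ 3 * seqConv (a s) (a s) k))
    (a := δ) (b := T) (B := fun _ => q ^ 2) (B' := fun _ => 0)
    (h.continuousOn_energy.mono (Icc_subset_Icc_left hδ0.le))
    (fun s hs => (h.hasDerivAt_energy ⟨hδ0.trans_le hs.1, hs.2⟩).2.hasDerivWithinAt)
    (by
      rw [← hE]
      exact pow_le_pow_left₀ (l2Norm_nonneg _) hδ.le 2)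
    (fun s => hasDerivAt_const _ _)
    (fun s hs heq => by
      rw [← hE, sq_eq_sq₀ (l2Norm_nonneg _) hqpos.le] at heq
      refine h.energy_deriv_neg ⟨hδ0.trans_le hs.1, hs.2⟩ (heq ▸ hqpos) ?_
      rw [heq]
      exact (mul_lt_mul_of_pos_left hqr (by positivity)).trans_le hr)
    (⟨hδt, ht.2⟩ : t ∈ Icc δ T)
  rw [← hE, sq_le_sq₀ (l2Norm_nonneg _) hqpos.le] at key
  exact key.trans_lt hqr

/-- A solution that becomes small extends to arbitrarily long time intervals. -/
theorem exists_extension (h : SeqSol T a) (hT : 0 ≤ T) {r : ℝ} (hr : 2 * √(π ^ 2 / 3) * r ≤ 1)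
    (hsmall : l2Norm (a T) < r) (T' : ℝ) :
    ∃ b, SeqSol T' b ∧ b 0 = a 0 := by
  have hr0 : 0 ≤ r := (l2Norm_nonneg _).trans hsmall.le
  obtain ⟨τ, hτ, hloc⟩ := SeqSol.exists_local hr0
  -- The bound `r` is kept along the induction, so every step may have the same length `τ`.
  have hstep : ∀ n : ℕ, ∃ b, SeqSol (T + n * τ) b ∧ b 0 = a 0 ∧ l2Norm (b (T + n * τ)) < r := by
    intro n
    induction n with
    | zero => exact ⟨a, by simpa using h, rfl, by simpa using hsmall⟩
    | succ n ih =>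
      obtain ⟨b, hb, hb0, hbr⟩ := ih
      have hS : 0 ≤ T + n * τ := by positivity
      have hmem : T + n * τ ∈ Icc 0 (T + n * τ) := ⟨hS, le_rfl⟩
      obtain ⟨c, hc0, hc⟩ := hloc _ (hb.sqSummable hmem) (hb.zero_mode _ hmem) hbr.le
      have hcr := hc.l2Norm_lt hr (by rw [hc0]; exact hbr) τ ⟨hτ.le, le_rfl⟩
      have happ := hb.append hS hτ.le hc hc0
      refine ⟨_, by convert happ using 1; push_cast; ring, ?_, ?_⟩
      · rw [if_pos hS, hb0]
      · have e : T + ((n + 1 : ℕ) : ℝ) * τ - (T + n * τ) = τ := by push_cast; ring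
        rw [if_neg (by push_cast; linarith), e]
        exact hcr
  obtain ⟨n, hn⟩ := exists_nat_ge ((T' - T) / τ)
  obtain ⟨b, hb, hb0, -⟩ := hstep n
  rw [div_le_iff₀ hτ] at hn
  exact ⟨b, hb.mono (by linarith), hb0⟩

/-- Extensions to different lengths agree on overlaps by uniqueness, so the diagonal `t ↦ b t t`
coincides with each of them. -/
theorem exists_global (h : SeqSol T a) (hT : 0 ≤ T) {r : ℝ} (hr : 2 * √(π ^ 2 / 3) * r ≤ 1)
    (hsmall : l2Norm (a T) < r) : ∃ b, (∀ T', SeqSol T' b) ∧ b 0 = a 0 := by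
  choose b hb hb0 using fun T' : ℝ => h.exists_extension hT hr hsmall T'
  have hagree : ∀ T₁ T₂ : ℝ, ∀ t ∈ Icc 0 (min T₁ T₂), b T₁ t = b T₂ t := fun T₁ T₂ =>
    ((hb T₁).mono (min_le_left _ _)).unique ((hb T₂).mono (min_le_right _ _))
      ((hb0 T₁).trans (hb0 T₂).symm)
  refine ⟨fun t => b t t, fun T' => (hb T').congr fun t ht => ?_, hb0 0⟩
  exact hagree t T' t ⟨ht.1, le_min le_rfl ht.2⟩

end SeqSol

/-! ### Fourier coefficients of `2π`-periodic functions -/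

/-- The Fourier mode `x ↦ e^{ikx}`. -/
noncomputable def mode (k : ℤ) (x : ℝ) : ℂ := Complex.exp (Complex.I * ((k : ℂ) * (x : ℂ)))

@[simp] theorem norm_mode (k : ℤ) (x : ℝ) : ‖mode k x‖ = 1 := by
  rw [mode, mul_comm, ← Complex.ofReal_intCast, ← Complex.ofReal_mul, Complex.norm_exp_ofReal_mul_I]

@[simp] theorem mode_zero (x : ℝ) : mode 0 x = 1 := by simp [mode]

theorem mode_add (k m : ℤ) (x : ℝ) : mode (k + m) x = mode k x * mode m x := by
  rw [mode, mode, mode, ← Complex.exp_add]; push_cast; ring_nf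

theorem mode_neg (k : ℤ) (x : ℝ) : mode (-k) x = (starRingEnd ℂ) (mode k x) := by
  rw [mode, mode, ← Complex.exp_conj]; simp

theorem mode_eq (k : ℤ) (x : ℝ) :
    mode k x = ((Real.cos (k * x) : ℝ) : ℂ) + ((Real.sin (k * x) : ℝ) : ℂ) * Complex.I := by
  rw [mode, mul_comm, Complex.exp_mul_I]; push_cast; rfl

theorem mode_periodic (k : ℤ) : Function.Periodic (mode k) (2 * π) := fun x => by
  rw [mode, mode, Complex.exp_eq_exp_iff_exists_int]
  exact ⟨k, by push_cast; ring⟩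

theorem hasDerivAt_mode (k : ℤ) (x : ℝ) :
    HasDerivAt (mode k) (Complex.I * k * mode k x) x := by
  have h1 : HasDerivAt (fun x : ℝ => Complex.I * ((k : ℂ) * (x : ℂ))) (Complex.I * k) x := by
    simpa using (((hasDerivAt_id x).ofReal_comp).const_mul (k : ℂ)).const_mul Complex.I
  exact h1.cexp.congr_deriv (by rw [mode]; ring)

theorem continuous_mode (k : ℤ) : Continuous (mode k) :=
  continuous_iff_continuousAt.2 fun x => (hasDerivAt_mode k x).continuousAt

theorem fourier_eq_mode {T : ℝ} (hT : T = 2 * π) (k : ℤ) (x : ℝ) :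
    fourier k (x : AddCircle T) = mode k x := by
  have hπ : (π : ℂ) ≠ 0 := by exact_mod_cast Real.pi_ne_zero
  subst hT
  rw [fourier_coe_apply, mode]
  congr 1
  push_cast
  field_simp

/-- The Fourier coefficients of a function on `(0, 2π)`. -/
noncomputable def fcoeff (f : ℝ → ℂ) (k : ℤ) : ℂ :=
  (1 / (2 * π) : ℝ) * ∫ x in (0 : ℝ)..(2 * π), mode (-k) x * f x

theorem fcoeff_eq_fourierCoeffOn (f : ℝ → ℂ) (k : ℤ) :
    fcoeff f k = fourierCoeffOn Real.two_pi_pos f k := by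
  rw [fourierCoeffOn_eq_integral, fcoeff, sub_zero, Complex.real_smul]
  congr 2
  funext x
  rw [fourier_eq_mode rfl, smul_eq_mul]

theorem fcoeff_congr_ae {f g : ℝ → ℂ} (h : f =ᵐ[volume.restrict (Ioc 0 (2 * π))] g) :
    fcoeff f = fcoeff g := by
  funext k
  rw [fcoeff_eq_fourierCoeffOn, fcoeff_eq_fourierCoeffOn, fourierCoeffOn_congr_ae _ h]

theorem intervalIntegrable_mode_mul {f : ℝ → ℂ} {a b : ℝ} (hf : IntervalIntegrable f volume a b)
    (k : ℤ) : IntervalIntegrable (fun x => mode k x * f x) volume a b :=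
  hf.continuousOn_mul (continuous_mode k).continuousOn

theorem fcoeff_sub {f g : ℝ → ℂ} (hf : IntervalIntegrable f volume 0 (2 * π))
    (hg : IntervalIntegrable g volume 0 (2 * π)) :
    fcoeff (fun x => f x - g x) = fcoeff f - fcoeff g := by
  funext k
  simp only [fcoeff, Pi.sub_apply, mul_sub]
  rw [intervalIntegral.integral_sub (intervalIntegrable_mode_mul hf _)
    (intervalIntegrable_mode_mul hg _), mul_sub]

theorem hasSum_sq_fcoeff {f : ℝ → ℂ} (hf : MemLp f 2 (volume.restrict (Ioc 0 (2 * π)))) :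
    HasSum (fun k => ‖fcoeff f k‖ ^ 2) ((2 * π)⁻¹ * ∫ x in (0 : ℝ)..(2 * π), ‖f x‖ ^ 2) := by
  have h := hasSum_sq_fourierCoeffOn Real.two_pi_pos hf
  simp only [← fcoeff_eq_fourierCoeffOn, sub_zero, smul_eq_mul] at h
  exact h

/-- Parseval's identity for two functions. -/
theorem hasSum_conj_fcoeff_mul_fcoeff {f g : ℝ → ℂ}
    (hf : MemLp f 2 (volume.restrict (Ioc 0 (2 * π))))
    (hg : MemLp g 2 (volume.restrict (Ioc 0 (2 * π)))) :
    HasSum (fun k => (starRingEnd ℂ) (fcoeff f k) * fcoeff g k)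
      ((2 * π : ℝ)⁻¹ * ∫ x in (0 : ℝ)..(2 * π), (starRingEnd ℂ) (f x) * g x) := by
  have : Fact (0 < 2 * π) := ⟨Real.two_pi_pos⟩
  have hF := (show MemLp f 2 (volume.restrict (Ioc 0 (0 + 2 * π))) by
    rwa [zero_add]).memLp_liftIoc.haarAddCircle
  have hG := (show MemLp g 2 (volume.restrict (Ioc 0 (0 + 2 * π))) by
    rwa [zero_add]).memLp_liftIoc.haarAddCircle
  have h := (fourierBasis (T := 2 * π)).hasSum_inner_mul_inner hF.toLp hG.toLp
  have hcoef : ∀ (f : ℝ → ℂ) (hF : MemLp (AddCircle.liftIoc (2 * π) 0 f) 2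
      (AddCircle.haarAddCircle (T := 2 * π))) (k : ℤ),
      inner ℂ (fourierBasis (T := 2 * π) k) hF.toLp = fcoeff f k := by
    intro f hF k
    rw [← HilbertBasis.repr_apply_apply, fourierBasis_repr, fourierCoeff_congr_ae hF.coeFn_toLp,
      fourierCoeff_liftIoc_eq, fcoeff_eq_fourierCoeffOn]
    simp [fourierCoeffOn_eq_integral]
  have e1 : ∀ k, inner ℂ hF.toLp (fourierBasis (T := 2 * π) k) =
      (starRingEnd ℂ) (fcoeff f k) := fun k => by rw [← hcoef f hF k, inner_conj_symm]
  simp only [hcoef, e1] at h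
  have e2 : ∫ x : AddCircle (2 * π), inner ℂ (hF.toLp _ x) (hG.toLp _ x) ∂AddCircle.haarAddCircle =
      ∫ x : AddCircle (2 * π), AddCircle.liftIoc (2 * π) 0
        (fun x => (starRingEnd ℂ) (f x) * g x) x ∂AddCircle.haarAddCircle := by
    apply integral_congr_ae
    filter_upwards [hF.coeFn_toLp, hG.coeFn_toLp] with x hx hy
    rw [hx, hy, RCLike.inner_apply, mul_comm]
    simp [AddCircle.liftIoc]
  rw [L2.inner_def, e2, AddCircle.integral_haarAddCircle,
    AddCircle.integral_liftIoc_eq_intervalIntegral, zero_add, Complex.real_smul] at h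
  exact h

theorem memLp_mode_mul {f : ℝ → ℂ} (hf : MemLp f 2 (volume.restrict (Ioc 0 (2 * π)))) (k : ℤ) :
    MemLp (fun x => mode k x * f x) 2 (volume.restrict (Ioc 0 (2 * π))) :=
  hf.of_le ((continuous_mode k).aestronglyMeasurable.mul hf.1)
    (Eventually.of_forall fun x => by simp)

theorem fcoeff_mode_mul (f : ℝ → ℂ) (k m : ℤ) :
    fcoeff (fun x => mode (-k) x * f x) m = fcoeff f (m + k) := by
  simp only [fcoeff, neg_add, mode_add, mul_assoc]

theorem fcoeff_neg_of_real (g : ℝ → ℝ) (k : ℤ) :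
    fcoeff (fun x => (g x : ℂ)) (-k) = (starRingEnd ℂ) (fcoeff (fun x => (g x : ℂ)) k) := by
  simp only [fcoeff, map_mul, Complex.conj_ofReal]
  congr 1
  rw [intervalIntegral.integral_of_le Real.two_pi_pos.le,
    intervalIntegral.integral_of_le Real.two_pi_pos.le, ← integral_conj]
  simp only [map_mul, Complex.conj_ofReal, ← mode_neg, neg_neg]

/-- The Fourier coefficients of the square of a function are the convolution square of its Fourier
coefficients. -/
theorem fcoeff_sq {g : ℝ → ℝ} (hg : MemLp g 2 (volume.restrict (Ioc 0 (2 * π)))) (k : ℤ) :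
    fcoeff (fun x => ((g x ^ 2 : ℝ) : ℂ)) k =
      seqConv (fcoeff fun x => (g x : ℂ)) (fcoeff fun x => (g x : ℂ)) k := by
  have hg' : MemLp (fun x => (g x : ℂ)) 2 (volume.restrict (Ioc 0 (2 * π))) := hg.ofReal
  -- Parseval for `g` and `e^{-ikx} g` gives the correlation of the coefficients of `g` with their
  -- shift by `k`; as `g` is real, `m ↦ -m` turns it into a convolution. Only `g ∈ L²` is used.
  have h := (hasSum_conj_fcoeff_mul_fcoeff hg' (memLp_mode_mul hg' (-k))).tsum_eq
  have e : fcoeff (fun x => ((g x ^ 2 : ℝ) : ℂ)) k = (2 * π : ℝ)⁻¹ *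
      ∫ x in (0 : ℝ)..(2 * π), (starRingEnd ℂ) (g x : ℂ) * (mode (-k) x * (g x : ℂ)) := by
    rw [fcoeff, one_div, Complex.ofReal_inv]
    congr 2
    funext x
    rw [Complex.conj_ofReal]; push_cast; ring
  rw [e, ← h, seqConv, ← (Equiv.neg ℤ).tsum_eq]
  refine tsum_congr fun m => ?_
  rw [fcoeff_mode_mul, Equiv.neg_apply, fcoeff_neg_of_real, Complex.conj_conj, neg_add_eq_sub]

theorem fcoeff_ofReal_eq {g : ℝ → ℝ} (hg : IntervalIntegrable g volume 0 (2 * π)) (k : ℤ) :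
    fcoeff (fun x => (g x : ℂ)) k = (1 / (2 * π) : ℝ) *
      (((∫ x in (0 : ℝ)..(2 * π), g x * Real.cos (k * x) : ℝ) : ℂ) -
        ((∫ x in (0 : ℝ)..(2 * π), g x * Real.sin (k * x) : ℝ) : ℂ) * Complex.I) := by
  have hc' : IntervalIntegrable (fun x => g x * Real.cos (k * x)) volume 0 (2 * π) :=
    hg.mul_continuousOn (by fun_prop)
  have hs' : IntervalIntegrable (fun x => g x * Real.sin (k * x)) volume 0 (2 * π) :=
    hg.mul_continuousOn (by fun_prop)
  have hc : IntervalIntegrable (fun x => ((g x * Real.cos (k * x) : ℝ) : ℂ)) volume 0 (2 * π) :=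
    ⟨hc'.1.ofReal, hc'.2.ofReal⟩
  have hs : IntervalIntegrable (fun x => ((g x * Real.sin (k * x) : ℝ) : ℂ)) volume 0 (2 * π) :=
    ⟨hs'.1.ofReal, hs'.2.ofReal⟩
  rw [fcoeff, ← intervalIntegral.integral_ofReal, ← intervalIntegral.integral_ofReal,
    ← intervalIntegral.integral_mul_const, ← intervalIntegral.integral_sub hc (hs.mul_const _)]
  congr 2
  funext x
  rw [mode_eq]
  simp only [Int.cast_neg, neg_mul, Real.cos_neg, Real.sin_neg]
  push_cast; ring

/-- Integration by parts against cosine and sine; periodicity cancels the boundary terms. -/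
theorem fcoeff_deriv {f : ℝ → ℝ} (hf : AbsolutelyContinuousOnInterval f 0 (2 * π))
    (hper : f (2 * π) = f 0) (k : ℤ) :
    fcoeff (fun x => ((deriv f x : ℝ) : ℂ)) k = Complex.I * k * fcoeff (fun x => ((f x : ℝ) : ℂ)) k := by
  have hk1 : Real.cos (k * (2 * π)) = 1 := Real.cos_int_mul_two_pi k
  have hk2 : Real.sin (k * (2 * π)) = 0 := by
    rw [show (k : ℝ) * (2 * π) = ((2 * k : ℤ) : ℝ) * π by push_cast; ring]
    exact Real.sin_int_mul_pi _
  have hcd : ∀ x : ℝ, deriv (fun x : ℝ => Real.cos (k * x)) x = -k * Real.sin (k * x) := fun x => by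
    have := ((hasDerivAt_id x).const_mul (k : ℝ)).cos
    simp only [id, mul_one] at this
    rw [this.deriv]; ring
  have hsd : ∀ x : ℝ, deriv (fun x : ℝ => Real.sin (k * x)) x = k * Real.cos (k * x) := fun x => by
    have := ((hasDerivAt_id x).const_mul (k : ℝ)).sin
    simp only [id, mul_one] at this
    rw [this.deriv]; ring
  have hcos : AbsolutelyContinuousOnInterval (fun x : ℝ => Real.cos (k * x)) 0 (2 * π) :=
    ContDiffOn.absolutelyContinuousOnInterval (by fun_prop)
  have hsin : AbsolutelyContinuousOnInterval (fun x : ℝ => Real.sin (k * x)) 0 (2 * π) :=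
    ContDiffOn.absolutelyContinuousOnInterval (by fun_prop)
  have h1 := hcos.integral_mul_deriv_eq_deriv_mul hf
  have h2 := hsin.integral_mul_deriv_eq_deriv_mul hf
  simp only [hcd, hsd, hk1, hk2, hper, mul_zero, Real.cos_zero, Real.sin_zero, sub_self,
    zero_sub, mul_assoc, intervalIntegral.integral_const_mul] at h1 h2
  rw [fcoeff_ofReal_eq hf.intervalIntegrable_deriv,
    fcoeff_ofReal_eq hf.continuousOn.intervalIntegrable]
  simp only [mul_comm (deriv f _), mul_comm (f _), h1, h2]
  push_cast
  linear_combination (1 / (2 * π) : ℂ) * (k : ℂ) *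
    (∫ x in (0 : ℝ)..(2 * π), Real.sin (k * x) * f x : ℝ) * Complex.I_sq

theorem norm_fcoeff_le (f : ℝ → ℂ) (k : ℤ) :
    ‖fcoeff f k‖ ≤ (1 / (2 * π)) * ∫ x in (0 : ℝ)..(2 * π), ‖f x‖ := by
  rw [fcoeff, norm_mul, Complex.norm_real, Real.norm_eq_abs,
    abs_of_pos (one_div_pos.2 Real.two_pi_pos)]
  refine mul_le_mul_of_nonneg_left ?_ (one_div_pos.2 Real.two_pi_pos).le
  refine (intervalIntegral.norm_integral_le_integral_norm Real.two_pi_pos.le).trans (le_of_eq ?_)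
  simp

/-- A continuous periodic function with summable Fourier coefficients is the sum of its Fourier
series. -/
theorem hasSum_fcoeff_mul_mode {f : ℝ → ℂ} (hper : Function.Periodic f (2 * π))
    (hcont : ContinuousOn f (Icc 0 (2 * π))) (hsum : Summable (fcoeff f)) (x : ℝ) :
    HasSum (fun k => fcoeff f k * mode k x) (f x) := by
  have : Fact (0 < 2 * π) := ⟨Real.two_pi_pos⟩
  -- Packing `f` with all modes into one periodic function lets a single translation bring `x` into
  -- `[0, 2π)` on both sides.
  have hper' : Function.Periodic (fun x => (f x, fun k => mode k x)) (2 * π) := fun x =>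
    Prod.ext (hper x) (funext fun k => mode_periodic k x)
  obtain ⟨y, hy, hxy⟩ := hper'.exists_mem_Ico₀ Real.two_pi_pos x
  simp only [Prod.mk.injEq, funext_iff] at hxy
  rw [hxy.1]
  simp only [hxy.2]
  have hcont' : Continuous (AddCircle.liftIco (2 * π) 0 f) :=
    AddCircle.liftIco_continuous (hper 0).symm (by rwa [zero_add])
  have hcoef : fourierCoeff (⟨_, hcont'⟩ : C(AddCircle (2 * π), ℂ)) = fcoeff f := by
    funext k
    rw [ContinuousMap.coe_mk, fourierCoeff_liftIco_eq, fcoeff_eq_fourierCoeffOn]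
    simp [fourierCoeffOn_eq_integral]
  have h := has_pointwise_sum_fourier_series_of_summable (hcoef ▸ hsum) (y : AddCircle (2 * π))
  rw [hcoef, ContinuousMap.coe_mk, AddCircle.liftIco_coe_apply (by rwa [zero_add])] at h
  simpa only [fourier_eq_mode rfl, smul_eq_mul] using h

/-! ### From `H¹` solutions to the coefficient equation -/

/-- The Fourier coefficients of the derivative of a real function. -/
noncomputable def slopeCoeff (f : ℝ → ℝ) : ℤ → ℂ := fcoeff fun x => ((deriv f x : ℝ) : ℂ)

namespace MemH1

variable {f g : ℝ → ℝ}

theorem map_two_pi (hf : MemH1 f) : f (2 * π) = f 0 := by simpa using hf.periodic 0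

theorem continuousOn (hf : MemH1 f) : ContinuousOn f (Icc 0 (2 * π)) := by
  simpa [uIcc_of_le Real.two_pi_pos.le] using hf.absolutelyContinuous.continuousOn

theorem intervalIntegrable (hf : MemH1 f) : IntervalIntegrable f volume 0 (2 * π) :=
  hf.absolutelyContinuous.continuousOn.intervalIntegrable

theorem intervalIntegrable_deriv_sq (hf : MemH1 f) :
    IntervalIntegrable (fun x => deriv f x ^ 2) volume 0 (2 * π) :=
  (intervalIntegrable_iff_integrableOn_Ioc_of_le Real.two_pi_pos.le).2 hf.memLp_deriv.integrable_sq

theorem hasSum_sq_slopeCoeff (hf : MemH1 f) :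
    HasSum (fun k => ‖slopeCoeff f k‖ ^ 2)
      ((2 * π)⁻¹ * ∫ x in (0 : ℝ)..(2 * π), deriv f x ^ 2) := by
  have h := hasSum_sq_fcoeff (f := fun x => ((deriv f x : ℝ) : ℂ)) hf.memLp_deriv.ofReal
  simpa [slopeCoeff, Complex.norm_real, sq_abs] using h

theorem sqSummable_slopeCoeff (hf : MemH1 f) : SqSummable (slopeCoeff f) :=
  hf.hasSum_sq_slopeCoeff.summable

theorem h1Norm_eq (hf : MemH1 f) : h1Norm f = √(2 * π) * l2Norm (slopeCoeff f) := by
  rw [h1Norm, l2Norm, hf.hasSum_sq_slopeCoeff.tsum_eq, ← Real.sqrt_mul Real.two_pi_pos.le,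
    mul_inv_cancel_left₀ Real.two_pi_pos.ne']

theorem slopeCoeff_eq (hf : MemH1 f) (k : ℤ) :
    slopeCoeff f k = Complex.I * k * fcoeff (fun x => ((f x : ℝ) : ℂ)) k :=
  fcoeff_deriv hf.absolutelyContinuous hf.map_two_pi k

theorem slopeCoeff_zero (hf : MemH1 f) : slopeCoeff f 0 = 0 := by simp [hf.slopeCoeff_eq]

/-- At `k = 0` the zero mean matches the convention that division by zero gives zero. -/
theorem fcoeff_eq (hf : MemH1 f) (k : ℤ) :
    fcoeff (fun x => ((f x : ℝ) : ℂ)) k = slopeCoeff f k / (Complex.I * k) := by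
  rcases eq_or_ne k 0 with rfl | hk
  · simp [fcoeff, intervalIntegral.integral_ofReal, hf.mean_zero]
  · have hk' : (k : ℂ) ≠ 0 := by exact_mod_cast hk
    rw [hf.slopeCoeff_eq, mul_div_cancel_left₀ _ (mul_ne_zero Complex.I_ne_zero hk')]

end MemH1

theorem summable_div_of_sqSummable {a : ℤ → ℂ} (ha : SqSummable a) :
    Summable fun k : ℤ => a k / (Complex.I * k) := by
  refine Summable.of_norm ((summable_mul_of_sq ha summable_abs_int_inv_sq).congr fun k => ?_)
  rw [norm_div, norm_mul, Complex.norm_I, one_mul, Complex.norm_intCast, div_eq_mul_inv]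

namespace MemH1

variable {f g : ℝ → ℝ}

theorem hasSum_slopeCoeff (hf : MemH1 f) (x : ℝ) :
    HasSum (fun k : ℤ => slopeCoeff f k / (Complex.I * k) * mode k x) (f x : ℂ) := by
  have e : fcoeff (fun x => ((f x : ℝ) : ℂ)) = fun k : ℤ => slopeCoeff f k / (Complex.I * k) :=
    funext hf.fcoeff_eq
  have h := hasSum_fcoeff_mul_mode (f := fun x => ((f x : ℝ) : ℂ))
    (fun x => by simp only [hf.periodic x]) (Complex.continuous_ofReal.comp_continuousOn hf.continuousOn)
    (by rw [e]; exact summable_div_of_sqSummable hf.sqSummable_slopeCoeff) x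
  simpa only [hf.fcoeff_eq] using h

theorem deriv_sub_ae (hf : MemH1 f) (hg : MemH1 g) :
    deriv (fun x => f x - g x) =ᵐ[volume.restrict (Ioc 0 (2 * π))]
      fun x => deriv f x - deriv g x := by
  rw [EventuallyEq, ae_restrict_iff' measurableSet_Ioc]
  filter_upwards [hf.absolutelyContinuous.ae_differentiableAt,
    hg.absolutelyContinuous.ae_differentiableAt] with x h1 h2 hx
  have hx' : x ∈ uIcc 0 (2 * π) := by
    rw [uIcc_of_le Real.two_pi_pos.le]; exact Ioc_subset_Icc_self hx
  exact deriv_fun_sub (h1 hx') (h2 hx')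

theorem sub (hf : MemH1 f) (hg : MemH1 g) : MemH1 (fun x => f x - g x) where
  periodic x := by simp only [hf.periodic x, hg.periodic x]
  absolutelyContinuous := hf.absolutelyContinuous.sub hg.absolutelyContinuous
  memLp_deriv := (memLp_congr_ae (hf.deriv_sub_ae hg)).2 (hf.memLp_deriv.sub hg.memLp_deriv)
  mean_zero := by
    rw [intervalIntegral.integral_sub hf.intervalIntegrable hg.intervalIntegrable, hf.mean_zero,
      hg.mean_zero, sub_zero]

theorem slopeCoeff_sub (hf : MemH1 f) (hg : MemH1 g) :
    slopeCoeff (fun x => f x - g x) = slopeCoeff f - slopeCoeff g := by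
  have h1 := hf.absolutelyContinuous.intervalIntegrable_deriv
  have h2 := hg.absolutelyContinuous.intervalIntegrable_deriv
  have h := fcoeff_sub (f := fun x => ((deriv f x : ℝ) : ℂ)) (g := fun x => ((deriv g x : ℝ) : ℂ))
    ⟨h1.1.ofReal, h1.2.ofReal⟩ ⟨h2.1.ofReal, h2.2.ofReal⟩
  rw [slopeCoeff, slopeCoeff, slopeCoeff, ← h]
  apply fcoeff_congr_ae
  filter_upwards [hf.deriv_sub_ae hg] with x hx
  rw [hx, Complex.ofReal_sub]

theorem seqConv_slopeCoeff (hf : MemH1 f) (k : ℤ) :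
    seqConv (slopeCoeff f) (slopeCoeff f) k = fcoeff (fun x => ((deriv f x ^ 2 : ℝ) : ℂ)) k :=
  (fcoeff_sq hf.memLp_deriv k).symm

end MemH1

/-! ### Continuity in time of modes, norms and convolutions -/

section L2Continuity

variable {X : Type*} [TopologicalSpace X] {s : Set X} {a : X → ℤ → ℂ}

theorem continuousOn_of_tendsto_l2Norm_sub (ha : ∀ x ∈ s, SqSummable (a x))
    (h : ∀ x ∈ s, Tendsto (fun y => l2Norm (a y - a x)) (𝓝[s] x) (𝓝 0)) (k : ℤ) :
    ContinuousOn (fun x => a x k) s := by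
  intro x hx
  rw [ContinuousWithinAt, tendsto_iff_norm_sub_tendsto_zero]
  refine squeeze_zero' (Eventually.of_forall fun _ => norm_nonneg _) ?_ (h x hx)
  filter_upwards [self_mem_nhdsWithin] with y hy
  exact norm_le_l2Norm ((ha y hy).sub (ha x hx)) k

theorem continuousOn_l2Norm_of_tendsto (ha : ∀ x ∈ s, SqSummable (a x))
    (h : ∀ x ∈ s, Tendsto (fun y => l2Norm (a y - a x)) (𝓝[s] x) (𝓝 0)) :
    ContinuousOn (fun x => l2Norm (a x)) s := by
  intro x hx
  rw [ContinuousWithinAt, tendsto_iff_norm_sub_tendsto_zero]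
  refine squeeze_zero' (Eventually.of_forall fun _ => norm_nonneg _) ?_ (h x hx)
  filter_upwards [self_mem_nhdsWithin] with y hy
  exact abs_l2Norm_sub_le (ha y hy) (ha x hx)

theorem continuousOn_seqConv_of_tendsto (ha : ∀ x ∈ s, SqSummable (a x))
    (h : ∀ x ∈ s, Tendsto (fun y => l2Norm (a y - a x)) (𝓝[s] x) (𝓝 0)) (k : ℤ) :
    ContinuousOn (fun x => seqConv (a x) (a x) k) s := by
  intro x hx
  rw [ContinuousWithinAt, tendsto_iff_norm_sub_tendsto_zero]
  have hlim : Tendsto (fun y => l2Norm (a y - a x) * (l2Norm (a y) + l2Norm (a x))) (𝓝[s] x)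
      (𝓝 0) := by
    have := (h x hx).mul ((continuousOn_l2Norm_of_tendsto ha h x hx).add
      (tendsto_const_nhds (x := l2Norm (a x))))
    simpa using this
  refine squeeze_zero' (Eventually.of_forall fun _ => norm_nonneg _) ?_ hlim
  filter_upwards [self_mem_nhdsWithin] with y hy
  exact norm_seqConv_self_sub_le (ha y hy) (ha x hx) k

end L2Continuity

theorem iteratedDeriv_two_cos_const_mul (c : ℝ) :
    iteratedDeriv 2 (fun x => Real.cos (c * x)) = fun x => -c ^ 2 * Real.cos (c * x) := by
  rw [iteratedDeriv_comp_const_mul (by fun_prop)]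
  funext x
  simp [iteratedDeriv_succ]

theorem iteratedDeriv_four_cos_const_mul (c : ℝ) :
    iteratedDeriv 4 (fun x => Real.cos (c * x)) = fun x => c ^ 4 * Real.cos (c * x) := by
  rw [iteratedDeriv_comp_const_mul (by fun_prop)]
  funext x
  simp [iteratedDeriv_succ]

theorem iteratedDeriv_two_sin_const_mul (c : ℝ) :
    iteratedDeriv 2 (fun x => Real.sin (c * x)) = fun x => -c ^ 2 * Real.sin (c * x) := by
  rw [iteratedDeriv_comp_const_mul (by fun_prop)]
  funext x
  simp [iteratedDeriv_succ]

theorem iteratedDeriv_four_sin_const_mul (c : ℝ) :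
    iteratedDeriv 4 (fun x => Real.sin (c * x)) = fun x => c ^ 4 * Real.sin (c * x) := by
  rw [iteratedDeriv_comp_const_mul (by fun_prop)]
  funext x
  simp [iteratedDeriv_succ]

theorem hasDerivWithinAt_of_eq_integral {P F : ℝ → ℂ} {T : ℝ}
    (hF : ContinuousOn F (Icc 0 T))
    (h : ∀ t ∈ Icc 0 T, P t - P 0 = ∫ s in (0 : ℝ)..t, F s) {t : ℝ} (ht : t ∈ Icc 0 T) :
    HasDerivWithinAt P (F t) (Icc 0 T) t := by
  have hT : 0 ≤ T := ht.1.trans ht.2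
  -- Extending `F` by its end values makes the two-sided fundamental theorem of calculus available
  -- at the endpoints as well.
  have hG : Continuous (IccExtend hT ((Icc 0 T).domRestrict F)) :=
    continuous_IccExtend_iff.2 (continuousOn_iff_continuous_domRestrict.1 hF)
  have hGF : ∀ s ∈ Icc 0 T, IccExtend hT ((Icc 0 T).domRestrict F) s = F s := fun s hs => by
    rw [IccExtend_of_mem _ _ hs, domRestrict_apply]
  have hd := intervalIntegral.integral_hasDerivAt_right (hG.intervalIntegrable 0 t)
    hG.aestronglyMeasurable.stronglyMeasurableAtFilter hG.continuousAt
  rw [hGF t ht] at hd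
  have hP : ∀ s ∈ Icc 0 T, P s = (∫ r in (0 : ℝ)..s,
      IccExtend hT ((Icc 0 T).domRestrict F) r) + P 0 := fun s hs => by
    rw [← sub_eq_iff_eq_add, h s hs]
    refine intervalIntegral.integral_congr fun r hr => (hGF r ?_).symm
    rw [uIcc_of_le hs.1] at hr
    exact ⟨hr.1, hr.2.trans hs.2⟩
  exact ((hd.add_const (P 0)).hasDerivWithinAt).congr hP (hP t ht)

namespace IsH1Solution

variable {I : Set ℝ} {u : ℝ → ℝ → ℝ}

theorem Icc_subset (hu : IsH1Solution I u) {T : ℝ} (hT : T ∈ I) : Icc 0 T ⊆ I :=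
  hu.ordConnected.out hu.zero_mem hT

theorem tendsto_l2Norm_sub (hu : IsH1Solution I u) {t : ℝ} (ht : t ∈ I) :
    Tendsto (fun s => l2Norm (slopeCoeff (u s) - slopeCoeff (u t))) (𝓝[I] t) (𝓝 0) := by
  have h := (hu.continuous_h1 t ht).const_mul (√(2 * π))⁻¹
  rw [mul_zero] at h
  refine h.congr' ?_
  filter_upwards [self_mem_nhdsWithin] with s hs
  rw [((hu.memH1 s hs).sub (hu.memH1 t ht)).h1Norm_eq,
    (hu.memH1 s hs).slopeCoeff_sub (hu.memH1 t ht), inv_mul_cancel_left₀]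
  exact (Real.sqrt_pos.2 Real.two_pi_pos).ne'

theorem sqSummable (hu : IsH1Solution I u) : ∀ t ∈ I, SqSummable (slopeCoeff (u t)) :=
  fun t ht => (hu.memH1 t ht).sqSummable_slopeCoeff

theorem continuousOn_rhs (hu : IsH1Solution I u) (k : ℤ) :
    ContinuousOn (fun s => -(k : ℂ) ^ 4 * fcoeff (fun x => ((u s x : ℝ) : ℂ)) k +
      (k : ℂ) ^ 2 * seqConv (slopeCoeff (u s)) (slopeCoeff (u s)) k) I := by
  have h1 := continuousOn_of_tendsto_l2Norm_sub hu.sqSummable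
    (fun t ht => hu.tendsto_l2Norm_sub ht) k
  have h2 := continuousOn_seqConv_of_tendsto hu.sqSummable
    (fun t ht => hu.tendsto_l2Norm_sub ht) k
  have h3 : ContinuousOn (fun s => fcoeff (fun x => ((u s x : ℝ) : ℂ)) k) I :=
    (h1.div_const (Complex.I * k)).congr fun s hs => (hu.memH1 s hs).fcoeff_eq k
  exact (h3.const_mul _).add (h2.const_mul _)

theorem integral_trig_eq {f : ℝ → ℝ} (hf : MemH1 f) {c : ℝ} {θ : ℝ → ℝ} (hθ : Continuous θ)
    (h2 : iteratedDeriv 2 θ = fun x => -c ^ 2 * θ x)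
    (h4 : iteratedDeriv 4 θ = fun x => c ^ 4 * θ x) :
    ∫ x in (0 : ℝ)..(2 * π), (-(f x * iteratedDeriv 4 θ x) - deriv f x ^ 2 * iteratedDeriv 2 θ x) =
      -c ^ 4 * (∫ x in (0 : ℝ)..(2 * π), f x * θ x) +
        c ^ 2 * ∫ x in (0 : ℝ)..(2 * π), deriv f x ^ 2 * θ x := by
  rw [← intervalIntegral.integral_const_mul, ← intervalIntegral.integral_const_mul,
    ← intervalIntegral.integral_add]
  · refine intervalIntegral.integral_congr fun x _ => ?_
    simp only [h2, h4]; ring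
  · exact (hf.intervalIntegrable.mul_continuousOn hθ.continuousOn).const_mul _
  · exact (hf.intervalIntegrable_deriv_sq.mul_continuousOn hθ.continuousOn).const_mul _

/-- The weak formulation tested with Fourier modes. -/
theorem fcoeff_sub_eq_integral (hu : IsH1Solution I u) {t : ℝ} (ht : t ∈ I) (k : ℤ) :
    fcoeff (fun x => ((u t x : ℝ) : ℂ)) k - fcoeff (fun x => ((u 0 x : ℝ) : ℂ)) k =
      ∫ s in (0 : ℝ)..t, (-(k : ℂ) ^ 4 * fcoeff (fun x => ((u s x : ℝ) : ℂ)) k +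
        (k : ℂ) ^ 2 * seqConv (slopeCoeff (u s)) (slopeCoeff (u s)) k) := by
  have ht0 : 0 ≤ t := hu.subset_nonneg ht
  have hsub := hu.Icc_subset ht
  have hint : IntervalIntegrable (fun s => -(k : ℂ) ^ 4 * fcoeff (fun x => ((u s x : ℝ) : ℂ)) k +
      (k : ℂ) ^ 2 * seqConv (slopeCoeff (u s)) (slopeCoeff (u s)) k) volume 0 t :=
    ((hu.continuousOn_rhs k).mono (by rwa [uIcc_of_le ht0])).intervalIntegrable
  have hper : ∀ x : ℝ, (k : ℝ) * (x + 2 * π) = k * x + k * (2 * π) := fun x => by ring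
  have hc := hu.weak_eq (fun x => Real.cos (k * x)) (by fun_prop)
    (fun x => by dsimp only; rw [hper, Real.cos_add_int_mul_two_pi]) t ht
  have hs := hu.weak_eq (fun x => Real.sin (k * x)) (by fun_prop)
    (fun x => by dsimp only; rw [hper, Real.sin_add_int_mul_two_pi]) t ht
  have hval : ∀ s ∈ Icc 0 t, -(k : ℂ) ^ 4 * fcoeff (fun x => ((u s x : ℝ) : ℂ)) k +
      (k : ℂ) ^ 2 * seqConv (slopeCoeff (u s)) (slopeCoeff (u s)) k = (1 / (2 * π) : ℝ) *
        (((∫ x in (0 : ℝ)..(2 * π), (-(u s x * iteratedDeriv 4 (fun x => Real.cos (k * x)) x) -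
          deriv (u s) x ^ 2 * iteratedDeriv 2 (fun x => Real.cos (k * x)) x) : ℝ) : ℂ) -
        ((∫ x in (0 : ℝ)..(2 * π), (-(u s x * iteratedDeriv 4 (fun x => Real.sin (k * x)) x) -
          deriv (u s) x ^ 2 * iteratedDeriv 2 (fun x => Real.sin (k * x)) x) : ℝ) : ℂ) *
            Complex.I) := by
    intro s hs
    have hm := hu.memH1 s (hsub hs)
    rw [hm.seqConv_slopeCoeff, fcoeff_ofReal_eq hm.intervalIntegrable,
      fcoeff_ofReal_eq hm.intervalIntegrable_deriv_sq,
      integral_trig_eq hm (by fun_prop) (iteratedDeriv_two_cos_const_mul k)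
        (iteratedDeriv_four_cos_const_mul k),
      integral_trig_eq hm (by fun_prop) (iteratedDeriv_two_sin_const_mul k)
        (iteratedDeriv_four_sin_const_mul k)]
    push_cast; ring
  have hre : (∫ s in (0 : ℝ)..t, (-(k : ℂ) ^ 4 * fcoeff (fun x => ((u s x : ℝ) : ℂ)) k +
      (k : ℂ) ^ 2 * seqConv (slopeCoeff (u s)) (slopeCoeff (u s)) k)).re =
      (1 / (2 * π)) * ∫ s in (0 : ℝ)..t, ∫ x in (0 : ℝ)..(2 * π),
        (-(u s x * iteratedDeriv 4 (fun x => Real.cos (k * x)) x) -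
          deriv (u s) x ^ 2 * iteratedDeriv 2 (fun x => Real.cos (k * x)) x) := by
    rw [← Complex.reCLM_apply, ← Complex.reCLM.intervalIntegral_comp_comm hint,
      ← intervalIntegral.integral_const_mul]
    refine intervalIntegral.integral_congr fun s hs => ?_
    rw [uIcc_of_le ht0] at hs
    rw [hval s hs, Complex.reCLM_apply, Complex.re_ofReal_mul]
    simp
  have him : (∫ s in (0 : ℝ)..t, (-(k : ℂ) ^ 4 * fcoeff (fun x => ((u s x : ℝ) : ℂ)) k +
      (k : ℂ) ^ 2 * seqConv (slopeCoeff (u s)) (slopeCoeff (u s)) k)).im =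
      -(1 / (2 * π)) * ∫ s in (0 : ℝ)..t, ∫ x in (0 : ℝ)..(2 * π),
        (-(u s x * iteratedDeriv 4 (fun x => Real.sin (k * x)) x) -
          deriv (u s) x ^ 2 * iteratedDeriv 2 (fun x => Real.sin (k * x)) x) := by
    rw [← Complex.imCLM_apply, ← Complex.imCLM.intervalIntegral_comp_comm hint,
      ← intervalIntegral.integral_const_mul]
    refine intervalIntegral.integral_congr fun s hs => ?_
    rw [uIcc_of_le ht0] at hs
    rw [hval s hs, Complex.imCLM_apply, Complex.im_ofReal_mul]
    simp
  rw [fcoeff_ofReal_eq (hu.memH1 t ht).intervalIntegrable,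
    fcoeff_ofReal_eq (hu.memH1 0 hu.zero_mem).intervalIntegrable]
  apply Complex.ext
  · rw [hre, ← hc, Complex.sub_re, Complex.re_ofReal_mul, Complex.re_ofReal_mul]
    simp; ring
  · rw [him, ← hs, Complex.sub_im, Complex.im_ofReal_mul, Complex.im_ofReal_mul]
    simp; ring

theorem hasDerivWithinAt_slopeCoeff (hu : IsH1Solution I u) {T : ℝ} (hT : T ∈ I) (k : ℤ) {t : ℝ}
    (ht : t ∈ Icc 0 T) : HasDerivWithinAt (fun s => slopeCoeff (u s) k)
      (-(k : ℂ) ^ 4 * slopeCoeff (u t) k + Complex.I * (k : ℂ) ^ 3 *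
        seqConv (slopeCoeff (u t)) (slopeCoeff (u t)) k) (Icc 0 T) t := by
  have hsub := hu.Icc_subset hT
  have h := (hasDerivWithinAt_of_eq_integral ((hu.continuousOn_rhs k).mono hsub)
    (fun s hs => hu.fcoeff_sub_eq_integral (hsub hs) k) ht).const_mul (Complex.I * k)
  refine (h.congr (fun s hs => (hu.memH1 s (hsub hs)).slopeCoeff_eq k)
    ((hu.memH1 t (hsub ht)).slopeCoeff_eq k)).congr_deriv ?_
  rw [(hu.memH1 t (hsub ht)).slopeCoeff_eq k]
  ring

theorem exists_norm_seqConv_le (hu : IsH1Solution I u) {T : ℝ} (hT : T ∈ I) :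
    ∃ N, 0 ≤ N ∧ ∀ t ∈ Icc 0 T, ∀ k,
      ‖seqConv (slopeCoeff (u t)) (slopeCoeff (u t)) k‖ ≤ N := by
  have hsub := hu.Icc_subset hT
  obtain ⟨M, hM⟩ := (isCompact_Icc (a := (0 : ℝ)) (b := T)).exists_bound_of_continuousOn
    ((continuousOn_l2Norm_of_tendsto hu.sqSummable
      (fun t ht => hu.tendsto_l2Norm_sub ht)).mono hsub)
  have hM' : ∀ t ∈ Icc 0 T, l2Norm (slopeCoeff (u t)) ≤ M := fun t ht =>
    (le_abs_self _).trans (hM t ht)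
  have hM0 : 0 ≤ M := (norm_nonneg _).trans (hM 0 ⟨le_rfl, hu.subset_nonneg hT⟩)
  exact ⟨M * M, by positivity, fun s hs k =>
    (norm_seqConv_le (hu.sqSummable s (hsub hs)) (hu.sqSummable s (hsub hs)) k).trans
      (mul_le_mul (hM' s hs) (hM' s hs) (l2Norm_nonneg _) hM0)⟩

/-- The slope coefficients of an `H¹` solution solve the coefficient equation. -/
theorem seqSol (hu : IsH1Solution I u) {T : ℝ} (hT : T ∈ I) :
    SeqSol T fun t => slopeCoeff (u t) := by
  have hsub := hu.Icc_subset hT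
  obtain ⟨N, hN0, hN⟩ := hu.exists_norm_seqConv_le hT
  have hsum : Summable fun k : ℤ => (N * |(k : ℝ)|⁻¹) ^ 2 := by
    simpa only [mul_pow] using summable_abs_int_inv_sq.mul_left (N ^ 2)
  -- Continuity in `H¹` bounds the norms uniformly but gives no common majorant. Duhamel's formula
  -- does: the initial coefficient plus `|k|³ N / k⁴ = N / |k|`.
  have hA : Summable fun k : ℤ => (‖slopeCoeff (u 0) k‖ + N * |(k : ℝ)|⁻¹) ^ 2 :=
    summable_add_sq (f := fun k => ‖slopeCoeff (u 0) k‖) (hu.sqSummable 0 hu.zero_mem) hsum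
  refine ⟨fun t ht => (hu.memH1 t (hsub ht)).slopeCoeff_zero,
    ⟨_, hA, fun t ht k => ?_⟩, fun k t ht => hu.hasDerivWithinAt_slopeCoeff hT k ht⟩
  rcases eq_or_ne k 0 with rfl | hk
  · rw [(hu.memH1 t (hsub ht)).slopeCoeff_zero, norm_zero]; positivity
  have hk0 : 0 < |(k : ℝ)| := abs_pos.2 (by exact_mod_cast hk)
  have hk4 : (k : ℝ) ^ 4 = |(k : ℝ)| ^ 4 := (Even.pow_abs (by decide) _).symm
  have hkpos : 0 < (k : ℝ) ^ 4 := by positivity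
  have hb := norm_le_of_hasDerivWithinAt_linear (y := fun s => slopeCoeff (u s) k)
    (f := fun s => Complex.I * (k : ℂ) ^ 3 * seqConv (slopeCoeff (u s)) (slopeCoeff (u s)) k)
    (F := |(k : ℝ)| ^ 3 * (N)) hkpos
    (fun s hs => by push_cast; exact hu.hasDerivWithinAt_slopeCoeff hT k hs)
    (fun s hs => by
      rw [norm_mul, norm_mul, Complex.norm_I, one_mul, norm_pow, Complex.norm_intCast]
      exact mul_le_mul_of_nonneg_left (hN s hs k) (by positivity)) ht
  have hexp := Real.exp_pos (-((k : ℝ) ^ 4 * (t - 0)))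
  have hexp1 : rexp (-((k : ℝ) ^ 4 * (t - 0))) ≤ 1 := by
    rw [Real.exp_le_one_iff, sub_zero]
    have := mul_nonneg hkpos.le ht.1
    linarith
  refine hb.trans (add_le_add (mul_le_of_le_one_left (norm_nonneg _) hexp1) ?_)
  have e : N * |(k : ℝ)|⁻¹ = |(k : ℝ)| ^ 3 * (N) / (k : ℝ) ^ 4 := by
    rw [hk4]; field_simp
  rw [e]
  exact mul_le_of_le_one_right (by positivity) (by linarith)

end IsH1Solution

/-! ### Sums of Fourier modes -/

/-- The sum of the Fourier series with the given coefficients. -/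
noncomputable def modeSum (c : ℤ → ℂ) (x : ℝ) : ℂ := ∑' k, c k * mode k x

theorem summable_mul_mode {c : ℤ → ℂ} (hc : Summable fun k => ‖c k‖) (x : ℝ) :
    Summable fun k => c k * mode k x :=
  Summable.of_norm (by simpa using hc)

theorem modeSum_periodic (c : ℤ → ℂ) : Function.Periodic (modeSum c) (2 * π) := fun x =>
  tsum_congr fun k => by rw [mode_periodic k x]

theorem im_modeSum_eq_zero {c : ℤ → ℂ} (hc : ∀ k, c (-k) = (starRingEnd ℂ) (c k)) (x : ℝ) :
    (modeSum c x).im = 0 := by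
  rw [← Complex.conj_eq_iff_im, modeSum, Complex.conj_tsum, ← (Equiv.neg ℤ).tsum_eq]
  refine tsum_congr fun k => ?_
  rw [Equiv.neg_apply, map_mul, hc, mode_neg, Complex.conj_conj, Complex.conj_conj]

theorem ofReal_re_modeSum {c : ℤ → ℂ} (hc : ∀ k, c (-k) = (starRingEnd ℂ) (c k)) (x : ℝ) :
    (((modeSum c x).re : ℝ) : ℂ) = modeSum c x :=
  Complex.ext (by simp) (by simp [im_modeSum_eq_zero hc])

theorem modeSum_mul_modeSum {a b : ℤ → ℂ} (ha : Summable fun k => ‖a k‖)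
    (hb : Summable fun k => ‖b k‖) (x : ℝ) :
    modeSum a x * modeSum b x = modeSum (seqConv a b) x := by
  have ha' : Summable fun k => ‖a k * mode k x‖ := by simpa using ha
  have hb' : Summable fun k => ‖b k * mode k x‖ := by simpa using hb
  have hprod := summable_mul_of_summable_norm ha' hb'
  -- This shear groups pairs of frequencies by their sum.
  let e : ℤ × ℤ ≃ ℤ × ℤ :=
    { toFun := fun p => (p.2, p.1 - p.2)
      invFun := fun p => (p.1 + p.2, p.1)
      left_inv := fun p => by simp
      right_inv := fun p => by simp }
  have hprod' : Summable fun p : ℤ × ℤ => (a p.2 * b (p.1 - p.2)) * mode p.1 x := by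
    refine (e.summable_iff.2 hprod).congr fun p => ?_
    have : mode p.1 x = mode p.2 x * mode (p.1 - p.2) x := by
      rw [← mode_add, add_sub_cancel]
    simp only [Function.comp_apply, e, Equiv.coe_fn_mk, this]
    ring
  rw [modeSum, modeSum, tsum_mul_tsum_of_summable_norm ha' hb', ← e.tsum_eq]
  calc _ = ∑' p : ℤ × ℤ, (a p.2 * b (p.1 - p.2)) * mode p.1 x := by
        refine tsum_congr fun p => ?_
        have : mode p.1 x = mode p.2 x * mode (p.1 - p.2) x := by
          rw [← mode_add, add_sub_cancel]
        simp only [e, Equiv.coe_fn_mk, this]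
        ring
    _ = ∑' k, ∑' m, (a m * b (k - m)) * mode k x := hprod'.tsum_prod
    _ = _ := tsum_congr fun k => tsum_mul_right

/-- A Parseval pairing that asks only integrability of `f`, at the price of an absolutely summable
series for `θ`; it has to cover `u_x²`, which is merely integrable. -/
theorem hasSum_fcoeff_mul {f : ℝ → ℂ} (hf : IntervalIntegrable f volume 0 (2 * π)) {c : ℤ → ℂ}
    (hc : Summable fun k => ‖c k‖) {θ : ℝ → ℂ} (hθ : ∀ x, HasSum (fun k => c k * mode k x) (θ x)) :
    HasSum (fun k => c k * ((2 * π : ℝ) * fcoeff f (-k)))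
      (∫ x in (0 : ℝ)..(2 * π), f x * θ x) := by
  have h := intervalIntegral.hasSum_integral_of_dominated_convergence (μ := volume) (a := 0)
    (b := 2 * π) (F := fun k x => c k * (mode k x * f x)) (f := fun x => f x * θ x)
    (fun k x => ‖c k‖ * ‖f x‖)
    (fun k => ((continuous_mode k).aestronglyMeasurable.mul
      (intervalIntegrable_iff.1 hf).aestronglyMeasurable).const_mul _)
    (fun k => Eventually.of_forall fun x _ => by simp)
    (Eventually.of_forall fun x _ => hc.mul_right _)
    (by simp only [tsum_mul_right]; exact hf.norm.const_mul _)
    (Eventually.of_forall fun x _ => by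
      have e : (fun k => c k * (mode k x * f x)) = fun k => f x * (c k * mode k x) :=
        funext fun k => by ring
      rw [e]
      exact (hθ x).mul_left (f x))
  have hπ : (2 * π : ℂ) ≠ 0 := by exact_mod_cast Real.two_pi_pos.ne'
  have e : (fun k => c k * ((2 * π : ℝ) * fcoeff f (-k))) =
      fun k => ∫ x in (0 : ℝ)..(2 * π), c k * (mode k x * f x) := by
    funext k
    rw [intervalIntegral.integral_const_mul, fcoeff, neg_neg, ← mul_assoc ((2 * π : ℝ) : ℂ)]
    push_cast
    rw [mul_one_div_cancel hπ, one_mul]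
  rw [e]
  exact h

theorem fcoeff_mode (k m : ℤ) : fcoeff (mode m) k = if m = k then 1 else 0 := by
  have hπ : (2 * π : ℂ) ≠ 0 := by exact_mod_cast Real.two_pi_pos.ne'
  have e : ∀ x, mode (-k) x * mode m x = mode (m - k) x := fun x => by
    rw [← mode_add]; congr 1; ring
  simp only [fcoeff, e]
  split_ifs with h
  · subst h
    simp only [sub_self, mode_zero, intervalIntegral.integral_const, sub_zero, Complex.real_smul,
      mul_one]
    push_cast
    exact one_div_mul_cancel hπ
  · have hmk : (Complex.I * ((m - k : ℤ) : ℂ)) ≠ 0 :=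
      mul_ne_zero Complex.I_ne_zero (by exact_mod_cast sub_ne_zero.2 h)
    have hd : ∀ x : ℝ, HasDerivAt (fun x => mode (m - k) x / (Complex.I * ((m - k : ℤ) : ℂ)))
        (mode (m - k) x) x := fun x => by
      refine ((hasDerivAt_mode (m - k) x).div_const _).congr_deriv ?_
      field_simp
    rw [intervalIntegral.integral_eq_sub_of_hasDerivAt (fun x _ => hd x)
      ((continuous_mode _).intervalIntegrable _ _)]
    have := mode_periodic (m - k) 0
    rw [zero_add] at this
    rw [this, sub_self, mul_zero]

theorem fcoeff_modeSum {c : ℤ → ℂ} (hc : Summable fun k => ‖c k‖) (k : ℤ) :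
    fcoeff (modeSum c) k = c k := by
  have hθ : ∀ x, HasSum (fun k => c k * mode k x) (modeSum c x) := fun x =>
    (summable_mul_mode hc x).hasSum
  have h := hasSum_fcoeff_mul (f := mode (-k)) ((continuous_mode _).intervalIntegrable _ _) hc hθ
  have hπ : (2 * π : ℂ) ≠ 0 := by exact_mod_cast Real.two_pi_pos.ne'
  have h2 := h.mul_left ((1 / (2 * π) : ℝ) : ℂ)
  rw [← fcoeff] at h2
  have e : (fun m => ((1 / (2 * π) : ℝ) : ℂ) * (c m * ((2 * π : ℝ) * fcoeff (mode (-k)) (-m)))) =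
      fun m => if m = k then c k else 0 := by
    funext m
    rw [fcoeff_mode]
    by_cases hm : m = k
    · subst hm
      rw [if_pos rfl, if_pos rfl, mul_one]
      push_cast
      field_simp
    · rw [if_neg fun h => hm (by omega), if_neg hm, mul_zero, mul_zero, mul_zero]
  rw [e] at h2
  exact h2.unique (hasSum_ite_eq k (c k))

theorem summable_inv_one_add_sq : Summable fun k : ℤ => (1 + |(k : ℝ)| ^ 2)⁻¹ := by
  have h1 : Summable fun k : ℤ => if k = 0 then (1 : ℝ) else 0 := (hasSum_ite_eq 0 1).summable
  refine Summable.of_nonneg_of_le (fun k => by positivity) (fun k => ?_)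
    (summable_abs_int_inv_sq.add h1)
  rcases eq_or_ne k 0 with rfl | hk
  · simp
  · have : 0 < |(k : ℝ)| := abs_pos.2 (by exact_mod_cast hk)
    rw [if_neg hk, add_zero, inv_pow]
    exact inv_anti₀ (by positivity) (by linarith)

/-- Families of coefficients depending continuously on `t > 0`, which decay rapidly, locally
uniformly in `t > 0`. -/
structure DecayFamily (c : ℝ → ℤ → ℂ) : Prop where
  continuousOn : ∀ k, ContinuousOn (fun t => c t k) (Ioi 0)
  decay : ∀ (n : ℕ) (δ T : ℝ), 0 < δ → ∃ C, ∀ t ∈ Icc δ T, ∀ k : ℤ, |(k : ℝ)| ^ n * ‖c t k‖ ≤ C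

namespace DecayFamily

variable {c d : ℝ → ℤ → ℂ}

theorem neg_sub (hc : DecayFamily c) (hd : DecayFamily d) :
    DecayFamily fun t k => -c t k - d t k where
  continuousOn k := (hc.continuousOn k).neg.sub (hd.continuousOn k)
  decay n δ T hδ := by
    obtain ⟨C, hC⟩ := hc.decay n δ T hδ
    obtain ⟨D, hD⟩ := hd.decay n δ T hδ
    refine ⟨C + D, fun t ht k => ?_⟩
    have h1 : ‖-c t k - d t k‖ ≤ ‖c t k‖ + ‖d t k‖ := by
      simpa using norm_sub_le (-c t k) (d t k)
    calc _ ≤ |(k : ℝ)| ^ n * (‖c t k‖ + ‖d t k‖) := by gcongr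
      _ ≤ _ := by rw [mul_add]; exact add_le_add (hC t ht k) (hD t ht k)

theorem I_mul_pow (hc : DecayFamily c) (j : ℕ) :
    DecayFamily fun t k => (Complex.I * k) ^ j * c t k where
  continuousOn k := continuousOn_const.mul (hc.continuousOn k)
  decay n δ T hδ := by
    obtain ⟨C, hC⟩ := hc.decay (n + j) δ T hδ
    refine ⟨C, fun t ht k => (le_of_eq ?_).trans (hC t ht k)⟩
    rw [norm_mul, norm_pow, norm_mul, Complex.norm_I, one_mul, Complex.norm_intCast]
    ring

theorem exists_norm_le (hc : DecayFamily c) {δ : ℝ} (T : ℝ) (hδ : 0 < δ) :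
    ∃ C, ∀ t ∈ Icc δ T, ∀ k : ℤ, ‖c t k‖ ≤ C * (1 + |(k : ℝ)| ^ 2)⁻¹ := by
  obtain ⟨C, hC⟩ := hc.decay 0 δ T hδ
  obtain ⟨D, hD⟩ := hc.decay 2 δ T hδ
  refine ⟨C + D, fun t ht k => ?_⟩
  have h1 := hC t ht k
  have h2 := hD t ht k
  rw [← div_eq_mul_inv, le_div_iff₀ (by positivity)]
  linarith

theorem summable_norm (hc : DecayFamily c) {t : ℝ} (ht : 0 < t) : Summable fun k => ‖c t k‖ := by
  obtain ⟨C, hC⟩ := hc.exists_norm_le t ht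
  exact Summable.of_nonneg_of_le (fun _ => norm_nonneg _) (hC t ⟨le_rfl, le_rfl⟩)
    (summable_inv_one_add_sq.mul_left C)

theorem continuousOn_modeSum (hc : DecayFamily c) :
    ContinuousOn (fun p : ℝ × ℝ => modeSum (c p.1) p.2) (Ioi 0 ×ˢ univ) := by
  rintro ⟨t, x⟩ ⟨ht, -⟩
  have ht' : 0 < t := ht
  obtain ⟨C, hC⟩ := hc.exists_norm_le (t + 1) (half_pos ht')
  have hcont : ContinuousOn (fun p : ℝ × ℝ => modeSum (c p.1) p.2)
      (Ioo (t / 2) (t + 1) ×ˢ univ) := by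
    refine continuousOn_tsum (fun k => ?_) (summable_inv_one_add_sq.mul_left C) fun k p hp => ?_
    · refine ContinuousOn.mul ?_ ((continuous_mode k).comp continuous_snd).continuousOn
      exact (hc.continuousOn k).comp continuousOn_fst fun p hp => (half_pos ht').trans hp.1.1
    · rw [norm_mul, norm_mode, mul_one]
      exact hC p.1 (Ioo_subset_Icc_self hp.1) k
  refine (hcont.continuousAt ?_).continuousWithinAt
  exact (isOpen_Ioo.prod isOpen_univ).mem_nhds
    ⟨⟨by dsimp only; linarith, by dsimp only; linarith⟩, mem_univ _⟩

theorem hasDerivAt_modeSum_space (hc : DecayFamily c) {t : ℝ} (ht : 0 < t) (x : ℝ) :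
    HasDerivAt (modeSum (c t)) (modeSum (fun k => Complex.I * k * c t k) x) x := by
  have hc' := hc.I_mul_pow 1
  have hs := hc'.summable_norm ht
  simp only [pow_one] at hs
  have h := hasDerivAt_tsum (g := fun k x => c t k * mode k x)
    (g' := fun k x => c t k * (Complex.I * k * mode k x)) hs
    (fun k y => (hasDerivAt_mode k y).const_mul _) (fun k y => le_of_eq (by simp; ring))
    (summable_mul_mode (hc.summable_norm ht) x) x
  refine h.congr_deriv (tsum_congr fun k => by ring)

theorem hasDerivAt_modeSum_time (hc : DecayFamily c) (hd : DecayFamily d)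
    (h : ∀ t, 0 < t → ∀ k, HasDerivAt (fun s => c s k) (d t k) t) {t : ℝ} (ht : 0 < t) (x : ℝ) :
    HasDerivAt (fun s => modeSum (c s) x) (modeSum (d t) x) t := by
  obtain ⟨C, hC⟩ := hd.exists_norm_le (t + 1) (half_pos ht)
  have htm : t ∈ Ioo (t / 2) (t + 1) := ⟨by linarith, by linarith⟩
  exact hasDerivAt_tsum_of_isPreconnected (summable_inv_one_add_sq.mul_left C) isOpen_Ioo
    isPreconnected_Ioo (g := fun k s => c s k * mode k x) (g' := fun k s => d s k * mode k x)
    (fun k s hs => (h s ((half_pos ht).trans hs.1) k).mul_const _)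
    (fun k s hs => by
      rw [norm_mul, norm_mode, mul_one]; exact hC s (Ioo_subset_Icc_self hs) k)
    htm (summable_mul_mode (hc.summable_norm ht) x) htm

end DecayFamily

/-! ### Joint smoothness -/

section JointSmoothness

variable {G H : ℕ → ℝ → ℝ → ℝ}

theorem iteratedDeriv_eq_of_hasDerivAt {g : ℕ → ℝ → ℝ}
    (hg : ∀ j x, HasDerivAt (g j) (g (j + 1) x) x) (i j : ℕ) : iteratedDeriv i (g j) = g (j + i) := by
  induction i with
  | zero => simp
  | succ i ih => rw [iteratedDeriv_succ, ih]; funext x; exact (hg _ x).deriv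

theorem contDiff_of_hasDerivAt {g : ℕ → ℝ → ℝ}
    (hg : ∀ j x, HasDerivAt (g j) (g (j + 1) x) x) (j : ℕ) : ContDiff ℝ ∞ (g j) :=
  contDiff_of_differentiable_iteratedDeriv fun i _ => by
    rw [iteratedDeriv_eq_of_hasDerivAt hg]
    exact fun x => (hg _ x).differentiableAt

/-- Functions whose space derivatives are the members of a family and whose time derivative is given
by the surface growth equation are jointly smooth. -/
theorem contDiffOn_of_evolution
    (hGc : ∀ j, ContinuousOn (fun p : ℝ × ℝ => G j p.1 p.2) (Ioi 0 ×ˢ univ))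
    (hGx : ∀ j t, 0 < t → ∀ x, HasDerivAt (G j t) (G (j + 1) t x) x)
    (hHx : ∀ j t, 0 < t → ∀ x, HasDerivAt (H j t) (H (j + 1) t x) x)
    (hH : ∀ t, 0 < t → ∀ x, H 0 t x = G 1 t x ^ 2)
    (hGt : ∀ j t, 0 < t → ∀ x, HasDerivAt (fun s => G j s x) (-G (j + 4) t x - H (j + 2) t x) t) :
    ∀ j, ContDiffOn ℝ ∞ (fun p : ℝ × ℝ => G j p.1 p.2) (Ioi 0 ×ˢ univ) := by
  have hopen : IsOpen (Ioi (0 : ℝ) ×ˢ (univ : Set ℝ)) := isOpen_Ioi.prod isOpen_univ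
  -- By Leibniz, the space derivatives of the square are finite sums of products of members of `G`,
  -- so `H` is as regular as `G`.
  have hHG : ∀ j, ∀ p ∈ Ioi (0 : ℝ) ×ˢ (univ : Set ℝ), H j p.1 p.2 =
      ∑ i ∈ Finset.range (j + 1), (j.choose i : ℝ) * G (1 + i) p.1 p.2 *
        G (1 + (j - i)) p.1 p.2 := by
    rintro j ⟨t, x⟩ ⟨ht, -⟩
    have ht' : 0 < t := ht
    have e0 : H 0 t = G 1 t * G 1 t := funext fun y => by
      rw [hH t ht' y, Pi.mul_apply, sq]
    have hsm := contDiff_of_hasDerivAt (g := fun j => G j t) (fun j x => hGx j t ht' x) 1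
    have e1 := iteratedDeriv_eq_of_hasDerivAt (g := fun j => H j t) (fun j x => hHx j t ht' x) j 0
    have e2 := fun i => iteratedDeriv_eq_of_hasDerivAt (g := fun j => G j t)
      (fun j x => hGx j t ht' x) i 1
    rw [zero_add] at e1
    dsimp only at e1 e2 hsm ⊢
    have hsm' : ContDiffAt ℝ j (G 1 t) x := (hsm.of_le (by exact_mod_cast le_top)).contDiffAt
    rw [← e1, e0, iteratedDeriv_mul hsm' hsm']
    simp only [e2]
  -- Induction on the order for all `j` at once: both partial derivatives of `G j` are expressed
  -- through `G` and `H` with other indices, so the loss of four space derivatives costs nothing.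
  have key : ∀ n : ℕ, ∀ j, ContDiffOn ℝ n (fun p : ℝ × ℝ => G j p.1 p.2) (Ioi 0 ×ˢ univ) := by
    intro n
    induction n with
    | zero => exact fun j => contDiffOn_zero.2 (hGc j)
    | succ n ih =>
      intro j
      have hHn : ContDiffOn ℝ n (fun p : ℝ × ℝ => H (j + 2) p.1 p.2) (Ioi 0 ×ˢ univ) :=
        ContDiffOn.congr (ContDiffOn.sum fun i _ =>
          (contDiffOn_const.mul (ih (1 + i))).mul (ih (1 + (j + 2 - i)))) (hHG (j + 2))
      have hT : ContDiffOn ℝ n (fun p : ℝ × ℝ => -G (j + 4) p.1 p.2 - H (j + 2) p.1 p.2)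
          (Ioi 0 ×ˢ univ) := (ih (j + 4)).neg.sub hHn
      let f₁ : ℝ → ℝ → ℝ →L[ℝ] ℝ := fun t x =>
        ContinuousLinearMap.toSpanSingleton ℝ (-G (j + 4) t x - H (j + 2) t x)
      let f₂ : ℝ → ℝ → ℝ →L[ℝ] ℝ := fun t x =>
        ContinuousLinearMap.toSpanSingleton ℝ (G (j + 1) t x)
      have hf₁ : ContDiffOn ℝ n (Function.uncurry f₁) (Ioi 0 ×ˢ univ) :=
        (ContinuousLinearMap.toSpanSingletonCLE (𝕜 := ℝ) (E := ℝ)).contDiff.comp_contDiffOn hT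
      have hf₂ : ContDiffOn ℝ n (Function.uncurry f₂) (Ioi 0 ×ˢ univ) :=
        (ContinuousLinearMap.toSpanSingletonCLE (𝕜 := ℝ) (E := ℝ)).contDiff.comp_contDiffOn
          (ih (j + 1))
      have hd : ∀ p ∈ Ioi (0 : ℝ) ×ˢ (univ : Set ℝ), HasFDerivAt (fun p : ℝ × ℝ => G j p.1 p.2)
          ((Function.uncurry f₁ p).coprod (Function.uncurry f₂ p)) p := by
        intro p hp
        have hnhds := hopen.mem_nhds hp
        refine (hasStrictFDerivAt_uncurry_coprod (f := fun t x => G j t x) (f₁ := f₁) (f₂ := f₂)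
          ?_ ?_ (hf₁.continuousOn.continuousAt hnhds)
          (hf₂.continuousOn.continuousAt hnhds)).hasFDerivAt
        · filter_upwards [hnhds] with q hq
          exact (hGt j q.1 hq.1 q.2).hasFDerivAt
        · filter_upwards [hnhds] with q hq
          exact (hGx j q.1 hq.1 q.2).hasFDerivAt
      push_cast
      rw [contDiffOn_succ_iff_fderiv_of_isOpen hopen]
      refine ⟨fun p hp => (hd p hp).differentiableAt.differentiableWithinAt, by simp, ?_⟩
      have hco : ContDiffOn ℝ n (fun p => (Function.uncurry f₁ p).coprod (Function.uncurry f₂ p))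
          (Ioi 0 ×ˢ univ) :=
        (ContinuousLinearMap.coprodEquivL (𝕜 := ℝ) (E := ℝ) (F := ℝ) (G := ℝ)
          ℝ).contDiff.comp_contDiffOn (hf₁.prodMk hf₂)
      exact hco.congr fun p hp => (hd p hp).fderiv
  exact fun j => contDiffOn_infty.2 fun n => key n j

end JointSmoothness

/-! ### The function with given coefficients -/

theorem conj_seqConv (a b : ℤ → ℂ) (k : ℤ) :
    (starRingEnd ℂ) (seqConv a b (-k)) =
      seqConv (fun k => (starRingEnd ℂ) (a (-k))) (fun k => (starRingEnd ℂ) (b (-k))) k := by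
  rw [seqConv, seqConv, Complex.conj_tsum, ← (Equiv.neg ℤ).tsum_eq]
  refine tsum_congr fun m => ?_
  rw [Equiv.neg_apply, map_mul, show -k - -m = -(k - m) by ring]

/-- The reflection expressing reality is a symmetry of the equation; with uniqueness, a real initial
value keeps the solution real (`GlobalSol.neg`). -/
theorem SeqSol.conj {T : ℝ} {a : ℝ → ℤ → ℂ} (h : SeqSol T a) :
    SeqSol T fun t k => (starRingEnd ℂ) (a t (-k)) := by
  obtain ⟨A, hA, hle⟩ := h.dominated
  refine ⟨fun t ht => by simp [h.zero_mode t ht],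
    ⟨fun k => A (-k), (Equiv.neg ℤ).summable_iff.2 hA, fun t ht k => ?_⟩, fun k t ht => ?_⟩
  · rw [RCLike.norm_conj]; exact hle t ht (-k)
  · refine ((h.ode (-k) t ht).star).congr_deriv ?_
    rw [← conj_seqConv, ← starRingEnd_apply]
    simp only [map_add, map_mul, map_neg, map_pow, Complex.conj_I, Int.cast_neg,
      map_intCast]
    ring

/-- The coefficients of a primitive. -/
noncomputable def primCoeff (b : ℤ → ℂ) (k : ℤ) : ℂ := b k / (Complex.I * k)

theorem norm_primCoeff_le (b : ℤ → ℂ) (k : ℤ) : ‖primCoeff b k‖ ≤ ‖b k‖ := by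
  rw [primCoeff, norm_div, norm_mul, Complex.norm_I, one_mul, Complex.norm_intCast]
  rcases eq_or_ne k 0 with rfl | hk
  · simp
  · exact div_le_self (norm_nonneg _) (by exact_mod_cast Int.one_le_abs hk)

theorem I_mul_primCoeff {b : ℤ → ℂ} (hb : b 0 = 0) (k : ℤ) :
    Complex.I * k * primCoeff b k = b k := by
  rcases eq_or_ne k 0 with rfl | hk
  · simp [hb]
  · have hk' : (k : ℂ) ≠ 0 := by exact_mod_cast hk
    rw [primCoeff, mul_div_cancel₀ _ (mul_ne_zero Complex.I_ne_zero hk')]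

theorem primCoeff_neg {b : ℤ → ℂ} (hb : ∀ k, b (-k) = (starRingEnd ℂ) (b k)) (k : ℤ) :
    primCoeff b (-k) = (starRingEnd ℂ) (primCoeff b k) := by
  simp [primCoeff, hb]

/-- A global solution of the coefficient equation which starts from the slope coefficients of a
function. -/
structure GlobalSol (f : ℝ → ℝ) (b : ℝ → ℤ → ℂ) : Prop where
  memH1 : MemH1 f
  init : b 0 = slopeCoeff f
  seqSol : ∀ T, SeqSol T b

/-- The function whose slope has the coefficients `b t` at time `t`. -/
noncomputable def realization (b : ℝ → ℤ → ℂ) (t x : ℝ) : ℝ := (modeSum (primCoeff (b t)) x).re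

/-- The time derivative of the coefficients of a solution. -/
noncomputable def velocity (b : ℤ → ℂ) (k : ℤ) : ℂ :=
  -((Complex.I * k) ^ 4 * primCoeff b k) - (Complex.I * k) ^ 2 * seqConv b b k

namespace GlobalSol

variable {f : ℝ → ℝ} {b : ℝ → ℤ → ℂ}

theorem zero_mode (h : GlobalSol f b) {t : ℝ} (ht : 0 ≤ t) : b t 0 = 0 :=
  (h.seqSol t).zero_mode t ⟨ht, le_rfl⟩

theorem neg (h : GlobalSol f b) {t : ℝ} (ht : 0 ≤ t) (k : ℤ) :
    b t (-k) = (starRingEnd ℂ) (b t k) := by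
  have e := (h.seqSol t).unique (h.seqSol t).conj (by
    funext k
    rw [h.init, slopeCoeff, fcoeff_neg_of_real, Complex.conj_conj]) t ⟨ht, le_rfl⟩
  have := congrFun e (-k)
  rwa [neg_neg] at this

theorem hasDerivWithinAt_primCoeff (h : GlobalSol f b) {t T : ℝ} (ht : t ∈ Icc 0 T) (k : ℤ) :
    HasDerivWithinAt (fun s => primCoeff (b s) k) (velocity (b t) k) (Icc 0 T) t := by
  refine (((h.seqSol T).ode k t ht).div_const (Complex.I * k)).congr_deriv ?_
  rcases eq_or_ne k 0 with rfl | hk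
  · simp [velocity]
  · have hk' : (k : ℂ) ≠ 0 := by exact_mod_cast hk
    rw [velocity, primCoeff, mul_pow, mul_pow, Complex.I_pow_four, Complex.I_sq]
    field_simp
    ring

theorem hasDerivAt_primCoeff (h : GlobalSol f b) {t : ℝ} (ht : 0 < t) (k : ℤ) :
    HasDerivAt (fun s => primCoeff (b s) k) (velocity (b t) k) t :=
  (h.hasDerivWithinAt_primCoeff (T := t + 1) ⟨ht.le, by linarith⟩ k).hasDerivAt
    (Icc_mem_nhds ht (by linarith))

theorem decayFamily (h : GlobalSol f b) : DecayFamily b where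
  continuousOn k t ht := ((((h.seqSol (t + 1)).continuousOn k).continuousAt
    (Icc_mem_nhds ht (by linarith)))).continuousWithinAt
  decay n δ T hδ := by
    obtain ⟨C, -, hC⟩ := (h.seqSol T).coeff_decay n hδ
    exact ⟨C, hC⟩

theorem decayFamily_seqConv (h : GlobalSol f b) : DecayFamily fun t => seqConv (b t) (b t) where
  continuousOn k t ht := ((((h.seqSol (t + 1)).continuousOn_seqConv k).continuousAt
    (Icc_mem_nhds ht (by linarith)))).continuousWithinAt
  decay n δ T hδ := by
    obtain ⟨C, -, hC⟩ := (h.seqSol T).conv_decay n hδ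
    exact ⟨C, hC⟩

theorem decayFamily_primCoeff (h : GlobalSol f b) : DecayFamily fun t => primCoeff (b t) where
  continuousOn k := (h.decayFamily.continuousOn k).div_const _
  decay n δ T hδ := by
    obtain ⟨C, hC⟩ := h.decayFamily.decay n δ T hδ
    exact ⟨C, fun t ht k => (mul_le_mul_of_nonneg_left (norm_primCoeff_le _ k)
      (by positivity)).trans (hC t ht k)⟩

end GlobalSol

/-- The `j`-th space derivative of the real part of a Fourier series. -/
noncomputable def spaceDeriv (c : ℝ → ℤ → ℂ) (j : ℕ) (t x : ℝ) : ℝ :=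
  (modeSum (fun k => (Complex.I * k) ^ j * c t k) x).re

theorem spaceDeriv_zero (c : ℝ → ℤ → ℂ) (t x : ℝ) : spaceDeriv c 0 t x = (modeSum (c t) x).re := by
  simp [spaceDeriv]

theorem DecayFamily.continuousOn_spaceDeriv {c : ℝ → ℤ → ℂ} (hc : DecayFamily c) (j : ℕ) :
    ContinuousOn (fun p : ℝ × ℝ => spaceDeriv c j p.1 p.2) (Ioi 0 ×ˢ univ) :=
  Complex.continuous_re.comp_continuousOn (hc.I_mul_pow j).continuousOn_modeSum

theorem DecayFamily.hasDerivAt_spaceDeriv {c : ℝ → ℤ → ℂ} (hc : DecayFamily c) (j : ℕ) {t : ℝ}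
    (ht : 0 < t) (x : ℝ) : HasDerivAt (spaceDeriv c j t) (spaceDeriv c (j + 1) t x) x := by
  have h := Complex.reCLM.hasFDerivAt.comp_hasDerivAt x
    ((hc.I_mul_pow j).hasDerivAt_modeSum_space ht x)
  refine h.congr_deriv ?_
  simp only [Complex.reCLM_apply, spaceDeriv, pow_succ', mul_assoc]

namespace GlobalSol

variable {f : ℝ → ℝ} {b : ℝ → ℤ → ℂ}

theorem spaceDeriv_one (h : GlobalSol f b) {t : ℝ} (ht : 0 ≤ t) (x : ℝ) :
    spaceDeriv (fun t => primCoeff (b t)) 1 t x = (modeSum (b t) x).re := by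
  simp only [spaceDeriv, pow_one, I_mul_primCoeff (h.zero_mode ht)]

/-- The real part of the square is the square of the real part because the series of `b t` is real.
-/
theorem spaceDeriv_seqConv_zero (h : GlobalSol f b) {t : ℝ} (ht : 0 < t) (x : ℝ) :
    spaceDeriv (fun t => seqConv (b t) (b t)) 0 t x =
      spaceDeriv (fun t => primCoeff (b t)) 1 t x ^ 2 := by
  have hs := h.decayFamily.summable_norm ht
  rw [spaceDeriv_zero, h.spaceDeriv_one ht.le, ← modeSum_mul_modeSum hs hs, Complex.mul_re,
    im_modeSum_eq_zero (h.neg ht.le), mul_zero, sub_zero, sq]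

theorem hasDerivAt_spaceDeriv_time (h : GlobalSol f b) (j : ℕ) {t : ℝ} (ht : 0 < t) (x : ℝ) :
    HasDerivAt (fun s => spaceDeriv (fun t => primCoeff (b t)) j s x)
      (-spaceDeriv (fun t => primCoeff (b t)) (j + 4) t x -
        spaceDeriv (fun t => seqConv (b t) (b t)) (j + 2) t x) t := by
  have hP := h.decayFamily_primCoeff.I_mul_pow (j + 4)
  have hN := h.decayFamily_seqConv.I_mul_pow (j + 2)
  have hd := (h.decayFamily_primCoeff.I_mul_pow j).hasDerivAt_modeSum_time (hP.neg_sub hN)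
    (fun t ht k => ((h.hasDerivAt_primCoeff ht k).const_mul _).congr_deriv
      (by rw [velocity]; ring)) ht x
  refine (Complex.reCLM.hasFDerivAt.comp_hasDerivAt t hd).congr_deriv ?_
  have e : modeSum (fun k => -((Complex.I * k) ^ (j + 4) * primCoeff (b t) k) -
      (Complex.I * k) ^ (j + 2) * seqConv (b t) (b t) k) x =
      -modeSum (fun k => (Complex.I * k) ^ (j + 4) * primCoeff (b t) k) x -
        modeSum (fun k => (Complex.I * k) ^ (j + 2) * seqConv (b t) (b t) k) x := by
    have h1 := (summable_mul_mode (hP.summable_norm ht) x).hasSum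
    have h2 := (summable_mul_mode (hN.summable_norm ht) x).hasSum
    have h3 := (h1.neg.sub h2).tsum_eq
    rw [modeSum, ← modeSum, ← modeSum] at *
    rw [← h3]
    exact tsum_congr fun k => by ring
  rw [Complex.reCLM_apply, e, Complex.sub_re, Complex.neg_re]
  rfl

theorem realization_eq (b : ℝ → ℤ → ℂ) :
    realization b = spaceDeriv (fun t => primCoeff (b t)) 0 := by
  funext t x
  rw [spaceDeriv_zero, realization]

theorem contDiffOn (h : GlobalSol f b) :
    ContDiffOn ℝ ∞ (fun p : ℝ × ℝ => realization b p.1 p.2) (Ioi 0 ×ˢ univ) := by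
  rw [realization_eq]
  exact contDiffOn_of_evolution (G := spaceDeriv fun t => primCoeff (b t))
    (H := spaceDeriv fun t => seqConv (b t) (b t))
    h.decayFamily_primCoeff.continuousOn_spaceDeriv
    (fun j t ht x => h.decayFamily_primCoeff.hasDerivAt_spaceDeriv j ht x)
    (fun j t ht x => h.decayFamily_seqConv.hasDerivAt_spaceDeriv j ht x)
    (fun t ht x => h.spaceDeriv_seqConv_zero ht x)
    (fun j t ht x => h.hasDerivAt_spaceDeriv_time j ht x) 0

theorem deriv_realization (h : GlobalSol f b) {t : ℝ} (ht : 0 < t) :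
    deriv (realization b t) = spaceDeriv (fun t => primCoeff (b t)) 1 t := by
  rw [realization_eq]
  exact funext fun x => (h.decayFamily_primCoeff.hasDerivAt_spaceDeriv 0 ht x).deriv

theorem deriv_time_realization (h : GlobalSol f b) {t : ℝ} (ht : 0 < t) (x : ℝ) :
    deriv (fun s => realization b s x) t = -iteratedDeriv 4 (realization b t) x -
      iteratedDeriv 2 (fun y => (deriv (realization b t) y) ^ 2) x := by
  have e2 : (fun y => (deriv (realization b t) y) ^ 2) =
      spaceDeriv (fun t => seqConv (b t) (b t)) 0 t := funext fun y => by
    rw [h.deriv_realization ht, h.spaceDeriv_seqConv_zero ht]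
  rw [e2, realization_eq, (h.hasDerivAt_spaceDeriv_time 0 ht x).deriv,
    iteratedDeriv_eq_of_hasDerivAt (g := fun j => spaceDeriv (fun t => primCoeff (b t)) j t)
      (fun j x => h.decayFamily_primCoeff.hasDerivAt_spaceDeriv j ht x) 4 0,
    iteratedDeriv_eq_of_hasDerivAt (g := fun j => spaceDeriv (fun t => seqConv (b t) (b t)) j t)
      (fun j x => h.decayFamily_seqConv.hasDerivAt_spaceDeriv j ht x) 2 0]

theorem realization_eq_of_slopeCoeff {g : ℝ → ℝ} (hg : MemH1 g) {t : ℝ} (hb : b t = slopeCoeff g) :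
    realization b t = g := by
  funext x
  have := (hg.hasSum_slopeCoeff x).tsum_eq
  rw [realization, hb]
  exact (congrArg Complex.re this).trans (Complex.ofReal_re _)

theorem ofReal_realization (h : GlobalSol f b) {t : ℝ} (ht : 0 ≤ t) :
    (fun x => ((realization b t x : ℝ) : ℂ)) = modeSum (primCoeff (b t)) :=
  funext fun x => ofReal_re_modeSum (primCoeff_neg (h.neg ht)) x

theorem slopeCoeff_realization_of_pos (h : GlobalSol f b) {t : ℝ} (ht : 0 < t) :
    slopeCoeff (realization b t) = b t := by
  have e : (fun x => ((deriv (realization b t) x : ℝ) : ℂ)) = modeSum (b t) := funext fun x => by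
    rw [h.deriv_realization ht, h.spaceDeriv_one ht.le, ofReal_re_modeSum (h.neg ht.le)]
  rw [slopeCoeff, e]
  exact funext fun k => fcoeff_modeSum (h.decayFamily.summable_norm ht) k

theorem memH1_realization_of_pos (h : GlobalSol f b) {t : ℝ} (ht : 0 < t) :
    MemH1 (realization b t) := by
  have hd := fun j x => h.decayFamily_primCoeff.hasDerivAt_spaceDeriv j ht x
  have hsm := contDiff_of_hasDerivAt hd
  refine ⟨fun x => ?_, ?_, ?_, ?_⟩
  · rw [realization, realization, modeSum_periodic _ x]
  · rw [realization_eq]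
    exact ContDiffOn.absolutelyContinuousOnInterval
      ((hsm 0).of_le (by exact_mod_cast le_top)).contDiffOn
  · rw [h.deriv_realization ht]
    have hcont : Continuous (spaceDeriv (fun t => primCoeff (b t)) 1 t) := (hsm 1).continuous
    obtain ⟨C, hC⟩ := (isCompact_Icc (a := (0 : ℝ)) (b := 2 * π)).exists_bound_of_continuousOn
      hcont.continuousOn
    exact MemLp.of_bound hcont.aestronglyMeasurable C
      ((ae_restrict_iff' measurableSet_Ioc).2
        (Eventually.of_forall fun x hx => hC x (Ioc_subset_Icc_self hx)))
  · have h0 := fcoeff_modeSum (h.decayFamily_primCoeff.summable_norm ht) 0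
    rw [← h.ofReal_realization ht.le, fcoeff_ofReal_eq
      ((by rw [realization_eq]; exact (hsm 0).continuous :
        Continuous (realization b t)).intervalIntegrable _ _)] at h0
    simpa [primCoeff, Real.pi_ne_zero] using h0

theorem realization_zero (h : GlobalSol f b) : realization b 0 = f :=
  realization_eq_of_slopeCoeff h.memH1 h.init

/-- Termwise differentiation is available only for positive times; at time zero the realization is
the initial function itself. -/
theorem slopeCoeff_realization (h : GlobalSol f b) {t : ℝ} (ht : 0 ≤ t) :
    slopeCoeff (realization b t) = b t := by
  rcases ht.eq_or_lt with rfl | ht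
  · rw [h.realization_zero, h.init]
  · exact h.slopeCoeff_realization_of_pos ht

theorem memH1_realization (h : GlobalSol f b) {t : ℝ} (ht : 0 ≤ t) : MemH1 (realization b t) := by
  rcases ht.eq_or_lt with rfl | ht
  · rw [h.realization_zero]; exact h.memH1
  · exact h.memH1_realization_of_pos ht

/-- Parseval reduces this to continuity of a series of squares, dominated on `[0, t + 1]` by the
common majorant. -/
theorem tendsto_h1Norm (h : GlobalSol f b) {t : ℝ} (ht : 0 ≤ t) :
    Tendsto (fun s => h1Norm (fun x => realization b s x - realization b t x)) (𝓝[Ici 0] t)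
      (𝓝 0) := by
  obtain ⟨A, hA, hle⟩ := (h.seqSol (t + 1)).dominated
  have htm : t ∈ Icc 0 (t + 1) := ⟨ht, by linarith⟩
  have hcont : ContinuousOn (fun s => ∑' k, ‖(b s - b t) k‖ ^ 2) (Icc 0 (t + 1)) := by
    refine continuousOn_tsum (u := fun k => (A k + A k) ^ 2)
      (fun k => (((h.seqSol (t + 1)).continuousOn k).sub continuousOn_const).norm.pow 2)
      (summable_add_sq hA hA) fun k s hs => ?_
    rw [Real.norm_of_nonneg (by positivity)]
    exact pow_le_pow_left₀ (norm_nonneg _)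
      ((norm_sub_le _ _).trans (add_le_add (hle s hs k) (hle t htm k))) 2
  have hnhds : Icc 0 (t + 1) ∈ 𝓝[Ici 0] t := by
    rw [← Ici_inter_Iic]
    exact inter_mem self_mem_nhdsWithin (mem_nhdsWithin_of_mem_nhds (Iic_mem_nhds (by linarith)))
  have hlim := ((hcont.sqrt t htm).mono_of_mem_nhdsWithin hnhds).tendsto.const_mul √(2 * π)
  simp only [sub_self, Pi.zero_apply, norm_zero, ne_eq, OfNat.ofNat_ne_zero, not_false_eq_true,
    zero_pow, tsum_zero, Real.sqrt_zero, mul_zero] at hlim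
  refine hlim.congr' ?_
  filter_upwards [self_mem_nhdsWithin] with s hs
  have hs1 := h.memH1_realization hs
  have ht1 := h.memH1_realization ht
  rw [(hs1.sub ht1).h1Norm_eq, hs1.slopeCoeff_sub ht1, h.slopeCoeff_realization hs,
    h.slopeCoeff_realization ht, l2Norm]

end GlobalSol

/-! ### The weak formulation and the theorem -/

section TestFunctions

variable {φ : ℝ → ℝ}

theorem periodic_iteratedDeriv (hper : Function.Periodic φ (2 * π)) (n : ℕ) :
    Function.Periodic (iteratedDeriv n φ) (2 * π) := fun x => by
  have h := iteratedDeriv_comp_add_const n φ (2 * π)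
  rw [show (fun z => φ (z + 2 * π)) = φ from funext hper] at h
  exact (congrFun h x).symm

theorem fcoeff_iteratedDeriv (hφ : ContDiff ℝ ∞ φ) (hper : Function.Periodic φ (2 * π)) (n : ℕ)
    (k : ℤ) : fcoeff (fun x => ((iteratedDeriv n φ x : ℝ) : ℂ)) k =
      (Complex.I * k) ^ n * fcoeff (fun x => ((φ x : ℝ) : ℂ)) k := by
  induction n with
  | zero => simp
  | succ n ih =>
    have hsm : ContDiff ℝ ∞ (iteratedDeriv n φ) := by
      rw [iteratedDeriv_eq_iterate]
      exact ContDiff.iterate_deriv n hφ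
    have hac : AbsolutelyContinuousOnInterval (iteratedDeriv n φ) 0 (2 * π) :=
      ContDiffOn.absolutelyContinuousOnInterval (hsm.of_le (by exact_mod_cast le_top)).contDiffOn
    have h := fcoeff_deriv hac (by simpa using periodic_iteratedDeriv hper n 0) k
    rw [iteratedDeriv_succ, h, ih, pow_succ']
    ring

/-- Boundedness of the coefficients of orders `n` and `n + 2` together gives decay like `1 / (1 +
k²)`. -/
theorem summable_norm_mul_fcoeff (hφ : ContDiff ℝ ∞ φ) (hper : Function.Periodic φ (2 * π))
    (n : ℕ) :
    Summable fun k : ℤ => ‖(Complex.I * k) ^ n * fcoeff (fun x => ((φ x : ℝ) : ℂ)) k‖ := by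
  have h0 := norm_fcoeff_le fun x => ((iteratedDeriv n φ x : ℝ) : ℂ)
  have h2 := norm_fcoeff_le fun x => ((iteratedDeriv (n + 2) φ x : ℝ) : ℂ)
  simp only [fcoeff_iteratedDeriv hφ hper] at h0 h2
  set C := 1 / (2 * π) * ∫ x in (0 : ℝ)..(2 * π), ‖((iteratedDeriv n φ x : ℝ) : ℂ)‖
  set D := 1 / (2 * π) * ∫ x in (0 : ℝ)..(2 * π), ‖((iteratedDeriv (n + 2) φ x : ℝ) : ℂ)‖
  refine Summable.of_nonneg_of_le (fun _ => norm_nonneg _) (fun k => ?_)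
    (summable_inv_one_add_sq.mul_left (C + D))
  rw [← div_eq_mul_inv, le_div_iff₀ (by positivity)]
  have e : ‖(Complex.I * k) ^ (n + 2) * fcoeff (fun x => ((φ x : ℝ) : ℂ)) k‖ =
      ‖(Complex.I * k) ^ n * fcoeff (fun x => ((φ x : ℝ) : ℂ)) k‖ * |(k : ℝ)| ^ 2 := by
    simp only [norm_mul, norm_pow, Complex.norm_I, Complex.norm_intCast, one_mul]
    ring
  have h2' := h2 k
  rw [e] at h2'
  linarith [h0 k]

theorem hasSum_iteratedDeriv (hφ : ContDiff ℝ ∞ φ) (hper : Function.Periodic φ (2 * π)) (n : ℕ)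
    (x : ℝ) : HasSum (fun k : ℤ => (Complex.I * k) ^ n * fcoeff (fun x => ((φ x : ℝ) : ℂ)) k *
      mode k x) ((iteratedDeriv n φ x : ℝ) : ℂ) := by
  have hcont : Continuous (iteratedDeriv n φ) :=
    hφ.continuous_iteratedDeriv n (by exact_mod_cast le_top)
  have e : fcoeff (fun x => ((iteratedDeriv n φ x : ℝ) : ℂ)) =
      fun k : ℤ => (Complex.I * k) ^ n * fcoeff (fun x => ((φ x : ℝ) : ℂ)) k :=
    funext fun k => fcoeff_iteratedDeriv hφ hper n k
  have h := hasSum_fcoeff_mul_mode (f := fun x => ((iteratedDeriv n φ x : ℝ) : ℂ))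
    (fun x => by simp only [periodic_iteratedDeriv hper n x])
    (Complex.continuous_ofReal.comp hcont).continuousOn
    (by rw [e]; exact (summable_norm_mul_fcoeff hφ hper n).of_norm) x
  simpa only [fcoeff_iteratedDeriv hφ hper] using h

theorem hasSum_integral_mul_iteratedDeriv (hφ : ContDiff ℝ ∞ φ)
    (hper : Function.Periodic φ (2 * π)) {g : ℝ → ℝ} (hg : IntervalIntegrable g volume 0 (2 * π))
    (n : ℕ) : HasSum (fun k : ℤ => (Complex.I * k) ^ n * fcoeff (fun x => ((φ x : ℝ) : ℂ)) k *
      ((2 * π : ℝ) * fcoeff (fun x => ((g x : ℝ) : ℂ)) (-k)))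
      ((∫ x in (0 : ℝ)..(2 * π), g x * iteratedDeriv n φ x : ℝ) : ℂ) := by
  have h := hasSum_fcoeff_mul (f := fun x => ((g x : ℝ) : ℂ)) ⟨hg.1.ofReal, hg.2.ofReal⟩
    (summable_norm_mul_fcoeff hφ hper n) (hasSum_iteratedDeriv hφ hper n)
  rw [← intervalIntegral.integral_ofReal]
  simpa only [Complex.ofReal_mul] using h

theorem hasSum_weak_rhs (hφ : ContDiff ℝ ∞ φ) (hper : Function.Periodic φ (2 * π)) {f : ℝ → ℝ}
    (hf : MemH1 f) : HasSum (fun k : ℤ => fcoeff (fun x => ((φ x : ℝ) : ℂ)) k *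
      ((2 * π : ℝ) * velocity (slopeCoeff f) (-k)))
      ((∫ x in (0 : ℝ)..(2 * π), (-(f x * iteratedDeriv 4 φ x) -
        deriv f x ^ 2 * iteratedDeriv 2 φ x) : ℝ) : ℂ) := by
  have hc : ∀ n, ContinuousOn (iteratedDeriv n φ) (uIcc 0 (2 * π)) := fun n =>
    (hφ.continuous_iteratedDeriv n (by exact_mod_cast le_top)).continuousOn
  have h4 := hasSum_integral_mul_iteratedDeriv hφ hper hf.intervalIntegrable 4
  have h2 := hasSum_integral_mul_iteratedDeriv hφ hper hf.intervalIntegrable_deriv_sq 2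
  have e1 : (∫ x in (0 : ℝ)..(2 * π), (-(f x * iteratedDeriv 4 φ x) -
      deriv f x ^ 2 * iteratedDeriv 2 φ x)) = -(∫ x in (0 : ℝ)..(2 * π), f x * iteratedDeriv 4 φ x) -
      ∫ x in (0 : ℝ)..(2 * π), deriv f x ^ 2 * iteratedDeriv 2 φ x := by
    rw [← intervalIntegral.integral_neg]
    exact intervalIntegral.integral_sub (hf.intervalIntegrable.mul_continuousOn (hc 4)).neg
      (hf.intervalIntegrable_deriv_sq.mul_continuousOn (hc 2))
  rw [e1, Complex.ofReal_sub, Complex.ofReal_neg]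
  have e2 : (fun k : ℤ => fcoeff (fun x => ((φ x : ℝ) : ℂ)) k *
      ((2 * π : ℝ) * velocity (slopeCoeff f) (-k))) = fun k : ℤ =>
      -((Complex.I * k) ^ 4 * fcoeff (fun x => ((φ x : ℝ) : ℂ)) k *
        ((2 * π : ℝ) * fcoeff (fun x => ((f x : ℝ) : ℂ)) (-k))) -
      (Complex.I * k) ^ 2 * fcoeff (fun x => ((φ x : ℝ) : ℂ)) k *
        ((2 * π : ℝ) * fcoeff (fun x => ((deriv f x ^ 2 : ℝ) : ℂ)) (-k)) := by
    funext k
    rw [velocity, hf.seqConv_slopeCoeff, hf.fcoeff_eq, primCoeff]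
    push_cast
    ring
  rw [e2]
  exact h4.neg.sub h2

end TestFunctions

namespace GlobalSol

variable {f : ℝ → ℝ} {b : ℝ → ℤ → ℂ}

theorem continuousOn_velocity (h : GlobalSol f b) (T : ℝ) (k : ℤ) :
    ContinuousOn (fun s => velocity (b s) k) (Icc 0 T) := by
  have h1 := (h.seqSol T).continuousOn k
  have h2 := (h.seqSol T).continuousOn_seqConv k
  exact (continuousOn_const.mul (h1.div_const _)).neg.sub (continuousOn_const.mul h2)

theorem integral_velocity (h : GlobalSol f b) {t : ℝ} (ht : 0 ≤ t) (k : ℤ) :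
    ∫ s in (0 : ℝ)..t, velocity (b s) k = primCoeff (b t) k - primCoeff (b 0) k :=
  intervalIntegral.integral_eq_sub_of_hasDerivAt_of_le (f := fun s => primCoeff (b s) k) ht
    (fun _ hs => (h.hasDerivWithinAt_primCoeff hs k).continuousWithinAt)
    (fun _ hs => h.hasDerivAt_primCoeff hs.1 k)
    ((h.continuousOn_velocity t k).intervalIntegrable_of_Icc ht)

theorem exists_norm_velocity_le (h : GlobalSol f b) (T : ℝ) :
    ∃ M, 0 ≤ M ∧ ∀ t ∈ Icc 0 T, ∀ k : ℤ,
      ‖velocity (b t) k‖ ≤ |(k : ℝ)| ^ 4 * M + |(k : ℝ)| ^ 2 * (M * M) := by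
  obtain ⟨M, hM0, hM⟩ := (h.seqSol T).exists_l2Norm_le
  refine ⟨M, hM0, fun t ht k => ?_⟩
  have hb := (h.seqSol T).sqSummable ht
  have h1 : ‖primCoeff (b t) k‖ ≤ M :=
    (norm_primCoeff_le _ k).trans ((norm_le_l2Norm hb k).trans (hM t ht))
  have h2 : ‖seqConv (b t) (b t) k‖ ≤ M * M := (norm_seqConv_le hb hb k).trans
    (mul_le_mul (hM t ht) (hM t ht) (l2Norm_nonneg _) hM0)
  refine (norm_sub_le _ _).trans ?_
  simp only [norm_neg, norm_mul, norm_pow, Complex.norm_I, Complex.norm_intCast, one_mul]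
  gcongr

/-- The sum over modes and the time integral are exchanged down to time zero, where the solution is
only in `H¹`: the velocity may grow like `k⁴`, but the smooth test function absorbs this. -/
theorem hasSum_integral_weak_rhs (h : GlobalSol f b) {φ : ℝ → ℝ} (hφ : ContDiff ℝ ∞ φ)
    (hper : Function.Periodic φ (2 * π)) {t : ℝ} (ht : 0 ≤ t) :
    HasSum (fun k : ℤ => fcoeff (fun x => ((φ x : ℝ) : ℂ)) k *
      ((2 * π : ℝ) * (primCoeff (b t) (-k) - primCoeff (b 0) (-k))))
      ((∫ s in (0 : ℝ)..t, ∫ x in (0 : ℝ)..(2 * π),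
        (-(realization b s x * iteratedDeriv 4 φ x) -
          (deriv (realization b s) x) ^ 2 * iteratedDeriv 2 φ x) : ℝ) : ℂ) := by
  obtain ⟨M, hM0, hM⟩ := h.exists_norm_velocity_le t
  have hsub : uIoc 0 t ⊆ Icc 0 t := by rw [uIoc_of_le ht]; exact Ioc_subset_Icc_self
  set p : ℤ → ℂ := fcoeff fun x => ((φ x : ℝ) : ℂ) with hp
  have hsum : Summable fun k : ℤ => 2 * π * (‖(Complex.I * k) ^ 4 * p k‖ * M +
      ‖(Complex.I * k) ^ 2 * p k‖ * (M * M)) :=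
    (((summable_norm_mul_fcoeff hφ hper 4).mul_right M).add
      ((summable_norm_mul_fcoeff hφ hper 2).mul_right (M * M))).mul_left _
  have key := intervalIntegral.hasSum_integral_of_dominated_convergence (μ := volume) (a := 0)
    (b := t) (F := fun (k : ℤ) s => p k * ((2 * π : ℝ) * velocity (b s) (-k)))
    (f := fun s => ((∫ x in (0 : ℝ)..(2 * π), (-(realization b s x * iteratedDeriv 4 φ x) -
          (deriv (realization b s) x) ^ 2 * iteratedDeriv 2 φ x) : ℝ) : ℂ))
    (fun k _ => 2 * π * (‖(Complex.I * k) ^ 4 * p k‖ * M + ‖(Complex.I * k) ^ 2 * p k‖ * (M * M)))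
    (fun k => ((continuousOn_const.mul (continuousOn_const.mul
      (h.continuousOn_velocity t (-k)))).mono hsub).aestronglyMeasurable measurableSet_uIoc)
    (fun k => Eventually.of_forall fun s hs => ?_)
    (Eventually.of_forall fun s _ => hsum)
    intervalIntegrable_const
    (Eventually.of_forall fun s hs => ?_)
  · rw [← intervalIntegral.integral_ofReal]
    simpa only [intervalIntegral.integral_const_mul, h.integral_velocity ht] using key
  · have h1 := hM s (hsub hs) (-k)
    simp only [norm_mul, norm_pow, Complex.norm_I, Complex.norm_intCast, one_mul,
      Complex.norm_real, Real.norm_of_nonneg Real.two_pi_pos.le]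
    rw [Int.cast_neg, abs_neg] at h1
    calc _ ≤ ‖p k‖ * (2 * π * (|(k : ℝ)| ^ 4 * M + |(k : ℝ)| ^ 2 * (M * M))) := by gcongr
      _ = _ := by ring
  · have hs0 : 0 ≤ s := (hsub hs).1
    have := hasSum_weak_rhs hφ hper (h.memH1_realization hs0)
    rwa [h.slopeCoeff_realization hs0] at this

theorem hasSum_integral_mul (h : GlobalSol f b) {φ : ℝ → ℝ} (hφ : ContDiff ℝ ∞ φ)
    (hper : Function.Periodic φ (2 * π)) {t : ℝ} (ht : 0 ≤ t) :
    HasSum (fun k : ℤ => fcoeff (fun x => ((φ x : ℝ) : ℂ)) k *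
      ((2 * π : ℝ) * primCoeff (b t) (-k)))
      ((∫ x in (0 : ℝ)..(2 * π), realization b t x * φ x : ℝ) : ℂ) := by
  have hm := h.memH1_realization ht
  have h0 := hasSum_integral_mul_iteratedDeriv hφ hper hm.intervalIntegrable 0
  simpa only [pow_zero, one_mul, iteratedDeriv_zero, hm.fcoeff_eq, h.slopeCoeff_realization ht,
    primCoeff] using h0

theorem isH1Solution (h : GlobalSol f b) : IsH1Solution (Ici 0) (realization b) where
  zero_mem := self_mem_Ici
  subset_nonneg := subset_rfl
  ordConnected := ordConnected_Ici
  memH1 _ ht := h.memH1_realization ht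
  continuous_h1 _ ht := h.tendsto_h1Norm ht
  weak_eq φ hφ hper t ht := by
    have h1 := h.hasSum_integral_weak_rhs hφ hper ht
    have h2 := (h.hasSum_integral_mul hφ hper ht).sub (h.hasSum_integral_mul hφ hper le_rfl)
    have e : (fun k : ℤ => fcoeff (fun x => ((φ x : ℝ) : ℂ)) k *
        ((2 * π : ℝ) * primCoeff (b t) (-k)) - fcoeff (fun x => ((φ x : ℝ) : ℂ)) k *
        ((2 * π : ℝ) * primCoeff (b 0) (-k))) = fun k : ℤ =>
        fcoeff (fun x => ((φ x : ℝ) : ℂ)) k *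
          ((2 * π : ℝ) * (primCoeff (b t) (-k) - primCoeff (b 0) (-k))) :=
      funext fun k => by ring
    rw [e] at h2
    exact_mod_cast h2.unique h1

/-- Uniqueness for the coefficients suffices, because an `H¹` function of zero mean is the sum of
the series built from its slope coefficients. -/
theorem eq_realization (h : GlobalSol f b) {J : Set ℝ} {w : ℝ → ℝ → ℝ} (hw : IsH1Solution J w)
    (hw0 : w 0 = f) {s : ℝ} (hs : s ∈ J) : w s = realization b s := by
  have e := (hw.seqSol hs).unique (h.seqSol s) (by rw [hw0, h.init]) s
    ⟨hw.subset_nonneg hs, le_rfl⟩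
  exact (realization_eq_of_slopeCoeff (hw.memH1 s hs) e.symm).symm

end GlobalSol

theorem exists_globalSol {I : Set ℝ} {u : ℝ → ℝ → ℝ} (hu : IsH1Solution I u) {t : ℝ} (ht : t ∈ I)
    (hsmall : h1Norm (u t) < 1 / 2) : ∃ b, GlobalSol (u 0) b := by
  have hpos : 0 < √(2 * π) := Real.sqrt_pos.2 Real.two_pi_pos
  -- The threshold `1/2` is `1 / (2 √(2π))` in the `ℓ²` norm; the condition of the energy estimate
  -- then reads `π² / 3 ≤ 2π`, that is `π ≤ 6`.
  have hr : 2 * √(π ^ 2 / 3) * (1 / 2 / √(2 * π)) ≤ 1 := by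
    have h1 : √(π ^ 2 / 3) ≤ √(2 * π) :=
      Real.sqrt_le_sqrt (by nlinarith [Real.pi_pos, Real.pi_lt_four])
    calc _ = √(π ^ 2 / 3) / √(2 * π) := by ring
      _ ≤ 1 := (div_le_one hpos).2 h1
  have hlt : l2Norm (slopeCoeff (u t)) < 1 / 2 / √(2 * π) := by
    rw [lt_div_iff₀ hpos, mul_comm, ← (hu.memH1 t ht).h1Norm_eq]
    exact hsmall
  -- Smallness is known at time `t` only: up to `t` the given solution is itself the coefficient
  -- solution, and it is continued from there.
  obtain ⟨b, hb, hb0⟩ := (hu.seqSol ht).exists_global (hu.subset_nonneg ht) hr hlt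
  exact ⟨b, hu.memH1 0 hu.zero_mem, hb0, hb⟩

/-- If an `H¹` solution `u` on a time interval `I` satisfies `‖u(t)‖_{H¹} < 1 / 2` for some time
`t` in `I`, then `u` extends to a solution on `[0, ∞)`, which is smooth in space and time for
positive times, satisfies the equation pointwise there, and agrees with every `H¹` solution with the
same initial value as long as that exists. -/
theorem theorem2p2 (I : Set ℝ) (u : ℝ → ℝ → ℝ) (hu : IsH1Solution I u)
    (t : ℝ) (ht : t ∈ I) (hsmall : h1Norm (u t) < 1 / 2) :
    ∃ v : ℝ → ℝ → ℝ,
      IsH1Solution (Ici 0) v ∧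
      (∀ s ∈ I, v s = u s) ∧
      ContDiffOn ℝ ∞ (fun p : ℝ × ℝ => v p.1 p.2) (Ioi 0 ×ˢ univ) ∧
      (∀ s : ℝ, 0 < s → ∀ x : ℝ,
        deriv (fun r => v r x) s =
          -iteratedDeriv 4 (v s) x - iteratedDeriv 2 (fun y => (deriv (v s) y) ^ 2) x) ∧
      (∀ (J : Set ℝ) (w : ℝ → ℝ → ℝ), IsH1Solution J w → w 0 = u 0 →
        ∀ s ∈ J, w s = v s) := by
  obtain ⟨b, hb⟩ := exists_globalSol hu ht hsmall
  exact ⟨realization b, hb.isH1Solution, fun s hs => (hb.eq_realization hu rfl hs).symm,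
    hb.contDiffOn, fun s hs x => hb.deriv_time_realization hs x,
    fun J w hw hw0 s hs => hb.eq_realization hw hw0 hs⟩
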